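/- Let $\Omega=(0,L_1)\times(0,L_2)$, $\gamma_c,\gamma_e\ge 0$, and $J=J_c-J_e$, where $J_c,J_e:\mathbb R^2\to\mathbb R$ are $C^\infty$, $\Omega$-periodic, non-negative and even ($J_\alpha(-\mathbf x)=J_\alpha(\mathbf x)$), with $\int_\Omega J>0$ and $\gamma_c-\gamma_e+J*1>0$; here $(J*f)(\mathbf x)=\int_\Omega J(\mathbf y)f(\mathbf x-\mathbf y)\,d\mathbf y$. Let $T>0$ and let $\Phi(x,y,t)$ be an $\Omega$-periodic (in space) function, $C^\infty$ on $\mathbb R^2\times[0,T]$, solving the nonlocal Cahn–Hilliard (nCH) equation $$\partial_t\Phi=\Delta w,\qquad w=\Phi^3+\gamma_c\Phi-\gamma_e\Phi+(J*1)\Phi-J*\Phi,\qquad 0<t\le T.$$ Grid. Let $h>0$ with $L_1=mh$, $L_2=nh$, $m,n\in\mathbb N$; put $p_r=(r-\tfrac12)h$. For a grid function $\varphi=(\varphi_{i,j})_{i,j\in\mathbb Z}$, periodic with periods $m$ in $i$ and $n$ in $j$, and a kernel $f$, let $f_{k+\frac12,l+\frac12}=f(p_{k+\frac12},p_{l+\frac12})$,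 $$[f\star\varphi]_{i,j}=h^2\sum_{k=1}^m\sum_{l=1}^n f_{k+\frac12,l+\frac12}\,\varphi_{i-k,j-l},\qquad \|\varphi\|_\infty=\max_{1\le i\le m,\,1\le j\le n}|\varphi_{i,j}|,$$ let $\Delta_h$ be the standard five-point discrete Laplacian, and let $B_c=[J_c\star\mathbf 1]+\gamma_c$, $B_e=[J_e\star\mathbf 1]+\gamma_e$ (constants depending on $h$). Assume that there is $\alpha_0>0$, independent of $h$, such that $B_c-3B_e\ge\alpha_0$ for all sufficiently small admissible $h$. Scheme. For a time step $s>0$, let $\phi^0_{i,j}=\Phi(p_i,p_j,0)$, $\phi^{-1}=\phi^0$, and let $\phi^{k+1}$, for $(k+1)s\le T$, be periodic solutions of $$\phi^{k+1}-\phi^k=s\,\Delta_h w^{k+1/2},$$ $$w^{k+1/2}=\tfrac14\big((\phi^k)^2+(\phi^{k+1})^2\big)(\phi^k+\phi^{k+1})+B_c\,\tfrac12(\phi^k+\phi^{k+1})-B_e\,\hat\phi^{k+1/2}-[J\star\hat\phi^{k+1/2}],\qquad \hat\phi^{k+1/2}=\tfrac32\phi^k-\tfrac12\phi^{k-1}.$$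 Theorem. For every constant $K>0$ there are $C>0$, $h_0>0$ and $s_0>0$, independent of $h$ and $s$, such that whenever $0<h\le h_0$ (with $L_1=mh$, $L_2=nh$), $0<s\le s_0$ and $s\le Kh$, the error $e^l_{i,j}=\Phi(p_i,p_j,ls)-\phi^l_{i,j}$ satisfies $$\|e^l\|_\infty\le C\,(h^2+s^2)\qquad\text{for all positive integers } l \text{ with } ls\le T.$$ -/

import Mathlib

open scoped ContDiff

noncomputable section

namespace NonlocalCH

/-! ### Continuous problem on the rectangle `(0, L₁) × (0, L₂)` -/

/-- `f : ℝ² → ℝ` is periodic with respect to the rectangle `(0, L₁) × (0, L₂)`. -/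
def IsPeriodic (L₁ L₂ : ℝ) (f : ℝ → ℝ → ℝ) : Prop :=
  ∀ x y, f (x + L₁) y = f x y ∧ f x (y + L₂) = f x y

/-- The conditions on each of the two parts of the interaction kernel: smooth and periodic,
non-negative, and even. -/
structure IsKernelPart (L₁ L₂ : ℝ) (J : ℝ → ℝ → ℝ) : Prop where
  smooth : ContDiff ℝ ∞ (fun p : ℝ × ℝ => J p.1 p.2)
  periodic : IsPeriodic L₁ L₂ J
  nonneg : ∀ x y, 0 ≤ J x y
  even : ∀ x y, J (-x) (-y) = J x y

/-- Periodic convolution `(J * f)(x, y) = ∫_Ω J(u, v) f(x - u, y - v) d(u, v)`. -/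
def conv (L₁ L₂ : ℝ) (J f : ℝ → ℝ → ℝ) (x y : ℝ) : ℝ :=
  ∫ u in (0 : ℝ)..L₁, ∫ v in (0 : ℝ)..L₂, J u v * f (x - u) (y - v)

/-- The integral of `J` over the rectangle, i.e. the constant `J * 1`. -/
def kernelMass (L₁ L₂ : ℝ) (J : ℝ → ℝ → ℝ) : ℝ :=
  ∫ u in (0 : ℝ)..L₁, ∫ v in (0 : ℝ)..L₂, J u v

/-- The Laplacian `∂²f/∂x² + ∂²f/∂y²` at `(x, y)`. -/
def laplacian (f : ℝ → ℝ → ℝ) (x y : ℝ) : ℝ :=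
  iteratedDeriv 2 (fun x' => f x' y) x + iteratedDeriv 2 (fun y' => f x y') y

/-- The chemical potential
`w = f³ + γc f - γe f + (J * 1) f - J * f`. -/
def chemPot (L₁ L₂ γc γe : ℝ) (J f : ℝ → ℝ → ℝ) (x y : ℝ) : ℝ :=
  f x y ^ 3 + γc * f x y - γe * f x y + kernelMass L₁ L₂ J * f x y - conv L₁ L₂ J f x y

/-- `Φ x y t` is a smooth (up to `t = 0` and `t = T`), spatially periodic solution of the nonlocal
Cahn-Hilliard equation `∂ₜ Φ = Δ w` on `0 < t ≤ T`. -/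
structure IsSmoothSolution (L₁ L₂ γc γe : ℝ) (J : ℝ → ℝ → ℝ) (T : ℝ)
    (Φ : ℝ → ℝ → ℝ → ℝ) : Prop where
  smooth : ContDiffOn ℝ ∞ (fun p : ℝ × ℝ × ℝ => Φ p.1 p.2.1 p.2.2)
    (Set.univ ×ˢ Set.univ ×ˢ Set.Icc 0 T)
  periodic : ∀ t ∈ Set.Icc 0 T, IsPeriodic L₁ L₂ (fun x y => Φ x y t)
  equation : ∀ x y, ∀ t ∈ Set.Ioc 0 T,
    HasDerivWithinAt (fun t' => Φ x y t')
      (laplacian (chemPot L₁ L₂ γc γe J (fun x' y' => Φ x' y' t)) x y) (Set.Icc 0 T) t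

/-! ### Grid functions

A (periodically extended) cell-centered grid function is a function `φ : ℤ → ℤ → ℝ`, where `φ i j`
is the value at the cell center `(p i, p j)`. A vertex-centered grid function is a function
`f : ℤ → ℤ → ℝ`, where `f i j` is the value at the vertex `(p (i + 1/2), p (j + 1/2))`. -/

/-- The grid coordinate `p_r = (r - 1/2) h`, for integers and half-integers `r`. -/
def gridPt (h r : ℝ) : ℝ := (r - 1 / 2) * h

/-- Restriction of a function on the plane to cell centers. -/
def cellRestrict (h : ℝ) (f : ℝ → ℝ → ℝ) (i j : ℤ) : ℝ :=
  f (gridPt h i) (gridPt h j)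

/-- Restriction of a function on the plane to vertices. -/
def vertexRestrict (h : ℝ) (f : ℝ → ℝ → ℝ) (i j : ℤ) : ℝ :=
  f (gridPt h ((i : ℝ) + 1 / 2)) (gridPt h ((j : ℝ) + 1 / 2))

/-- Periodicity of a grid function on an `m × n` grid. -/
def IsGridPeriodic (m n : ℕ) (φ : ℤ → ℤ → ℝ) : Prop :=
  ∀ i j, φ (i + m) j = φ i j ∧ φ i (j + n) = φ i j

/-- The discrete maximum norm: the largest `|φ i j|` with `1 ≤ i ≤ m`, `1 ≤ j ≤ n`. -/
def maxNorm (m n : ℕ) (φ : ℤ → ℤ → ℝ) : ℝ :=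
  ⨆ p : Fin m × Fin n, |φ ((p.1 : ℕ) + 1 : ℤ) ((p.2 : ℕ) + 1 : ℤ)|

/-- The discrete periodic convolution of a vertex-centered function `f` with a cell-centered
function `φ`. -/
def gridConv (m n : ℕ) (h : ℝ) (f φ : ℤ → ℤ → ℝ) (i j : ℤ) : ℝ :=
  h ^ 2 * ∑ k ∈ Finset.Icc 1 m, ∑ l ∈ Finset.Icc 1 n, f k l * φ (i - k) (j - l)

/-- The standard five-point discrete Laplacian. -/
def gridLaplacian (h : ℝ) (φ : ℤ → ℤ → ℝ) (i j : ℤ) : ℝ :=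
  (φ (i + 1) j + φ (i - 1) j + φ i (j + 1) + φ i (j - 1) - 4 * φ i j) / h ^ 2

/-- The discrete convolution of a kernel with the constant function `1`; the result does not
depend on the grid index (`gridConv_one`). -/
def gridMass (m n : ℕ) (h : ℝ) (J : ℝ → ℝ → ℝ) : ℝ :=
  gridConv m n h (vertexRestrict h J) (fun _ _ => 1) 0 0

theorem gridConv_one (m n : ℕ) (h : ℝ) (J : ℝ → ℝ → ℝ) (i j : ℤ) :
    gridConv m n h (vertexRestrict h J) (fun _ _ => 1) i j = gridMass m n h J := by
  rfl

/-! ### The fully discrete second order convex splitting scheme -/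

/-- The second order approximation of the cubic term,
`η(a, b) = (a² + b²)(a + b) / 4`. -/
def eta (a b : ℝ) : ℝ := 1 / 4 * (a ^ 2 + b ^ 2) * (a + b)

/-- The discrete chemical potential `w^{k+1/2}`, as a function of `φ^{k-1}` (`prev`),
`φ^k` (`cur`) and `φ^{k+1}` (`next`). -/
def gridChemPot (m n : ℕ) (h γc γe : ℝ) (Jc Je : ℝ → ℝ → ℝ) (prev cur next : ℤ → ℤ → ℝ)
    (i j : ℤ) : ℝ :=
  eta (cur i j) (next i j)
    + (gridMass m n h Jc + γc) * (1 / 2 * (cur i j + next i j))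
    - (gridMass m n h Je + γe) * (3 / 2 * cur i j - 1 / 2 * prev i j)
    - gridConv m n h (vertexRestrict h (fun x y => Jc x y - Je x y))
        (fun i' j' => 3 / 2 * cur i' j' - 1 / 2 * prev i' j') i j

/-- The level `φ^{k-1}`, with the starting convention `φ^{-1} = φ^0`. -/
def prevLevel (φ : ℕ → ℤ → ℤ → ℝ) : ℕ → ℤ → ℤ → ℝ
  | 0 => φ 0
  | k + 1 => φ k

/-- `φ 0, φ 1, …` are the periodic numerical solutions of the scheme
`φ^{k+1} - φ^k = s Δ_h w^{k+1/2}` on the time levels `t_k = k s` in `[0, T]`, started from the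
cell-centered grid function `φ₀`. -/
structure IsNumericalSolution (m n : ℕ) (h s T γc γe : ℝ) (Jc Je : ℝ → ℝ → ℝ)
    (φ₀ : ℤ → ℤ → ℝ) (φ : ℕ → ℤ → ℤ → ℝ) : Prop where
  initial : φ 0 = φ₀
  periodic : ∀ k : ℕ, k * s ≤ T → IsGridPeriodic m n (φ k)
  step : ∀ k : ℕ, (k + 1 : ℕ) * s ≤ T → ∀ i j : ℤ,
    φ (k + 1) i j - φ k i j
      = s * gridLaplacian h
          (gridChemPot m n h γc γe Jc Je (prevLevel φ k) (φ k) (φ (k + 1))) i j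

end NonlocalCH

end

/-! The error satisfies e^{k+1} - e^k = s Δ_h(flux difference) + s τ^k, and the theorem follows from
consistency together with stability in a discrete H² norm, which controls the maximum norm in two
dimensions.

Consistency. Taylor expansion about the half step and the periodic trapezoidal rule give τ^k = O(s²
+ h²), uniformly in difference quotients up to order two. Since φ^{-1} = φ^0, the first
extrapolation is only first order and τ^0 = O(s + h²); it occurs once and carries a factor s, so it
does no harm (`exists_trunc_bound`, `exists_isErrorSequence`).

Energy estimate. Difference quotients of the error equation are tested with the average m of the two
levels. The linearised cubic term has the coefficient P² + PQ + Q² ≥ 0. The extrapolated concave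
term, tested with m, costs at most 3 B_e |∇m|² up to telescoping terms, so B_c - 3 B_e ≥ α leaves a
positive multiple of |∇m|² that absorbs the rest (`flux_ineq`, `energy_step`, `sobEnergy_step`).
What remains of the flux must be bounded in H³ by the H² norm of the errors, so one derivative has
to be gained each time: the convolution puts it on the kernel; the term (Q - P)(e^{k+1} - e^k) has a
coefficient O(s) with s ≤ Kh, which pays for an inverse inequality; products of errors gain it if
the errors are at most h pointwise (`sobSq_three_mul_le`, `sobSq_forcing_le`). Gronwall's inequality
then yields the optimal H² bound, conditionally on |e| ≤ h (`exists_energy_bound`).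

Removing the condition. Induction on the time level gives |e^k| ≤ C(h² + s²) for the earlier levels.
A maximum principle for the flux bounds e^{k+1} by a fixed multiple of this, with a factor
independent of h and s (`rough_bound`). As s ≤ Kh, the result is O(h²), hence at most h for small h.
The energy estimate and the discrete Sobolev inequality `sq_le_sobSq_two` now restore the original
constant C, so the loss in the rough bound never accumulates (`exists_error_bound`).

Periodic grid functions are treated as functions on the finite group ZMod m × ZMod n, where
translations, difference quotients and convolutions commute. -/

open scoped ContDiff

noncomputable section

namespace NonlocalCH

/-! ### Difference quotients on an abelian group -/

section DifferenceQuotients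

variable {A : Type*} [AddCommGroup A]

/-- Translation by `c`. -/
def trans (c : A) : (A → ℝ) →ₗ[ℝ] (A → ℝ) where
  toFun f a := f (a + c)
  map_add' _ _ := rfl
  map_smul' _ _ := rfl

@[simp] theorem trans_apply (c : A) (f : A → ℝ) (a : A) : trans c f a = f (a + c) := rfl

/-- The forward difference quotient with step `h` in the direction `b`, where the two unit steps of
the grid are `d false` and `d true`. -/
def dq (d : Bool → A) (h : ℝ) (b : Bool) : (A → ℝ) →ₗ[ℝ] (A → ℝ) where
  toFun f a := (f (a + d b) - f a) / h
  map_add' f g := by ext a; simp; ring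
  map_smul' c f := by ext a; simp; ring

theorem dq_apply (d : Bool → A) (h : ℝ) (b : Bool) (f : A → ℝ) (a : A) :
    dq d h b f a = (f (a + d b) - f a) / h := rfl

/-- The iterated difference quotient along a word. -/
def dqs (d : Bool → A) (h : ℝ) : List Bool → (A → ℝ) →ₗ[ℝ] (A → ℝ)
  | [] => LinearMap.id
  | b :: w => dqs d h w ∘ₗ dq d h b

@[simp] theorem dqs_nil (d : Bool → A) (h : ℝ) (f : A → ℝ) : dqs d h [] f = f := rfl

theorem dqs_cons (d : Bool → A) (h : ℝ) (b : Bool) (w : List Bool) (f : A → ℝ) :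
    dqs d h (b :: w) f = dqs d h w (dq d h b f) := rfl

/-- The five-point Laplacian. -/
def lap (d : Bool → A) (h : ℝ) : (A → ℝ) →ₗ[ℝ] (A → ℝ) where
  toFun f a := ∑ b, (f (a + d b) + f (a - d b) - 2 * f a) / h ^ 2
  map_add' f g := by ext a; simp; ring
  map_smul' c f := by ext a; simp; ring

theorem lap_apply (d : Bool → A) (h : ℝ) (f : A → ℝ) (a : A) :
    lap d h f a = ∑ b, (f (a + d b) + f (a - d b) - 2 * f a) / h ^ 2 := rfl

theorem dq_mul (d : Bool → A) (h : ℝ) (b : Bool) (f g : A → ℝ) :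
    dq d h b (f * g) = f * dq d h b g + dq d h b f * trans (d b) g := by
  ext a
  simp only [dq_apply, Pi.mul_apply, Pi.add_apply, trans_apply]
  ring

/-- A difference quotient is a linear combination of a translation and the identity. This one fact
serves the Laplacian, both convolutions and the translations themselves. -/
theorem dq_comm_of_trans (d : Bool → A) (h : ℝ) (b : Bool) (S : (A → ℝ) →ₗ[ℝ] (A → ℝ))
    (hS : ∀ c f, S (trans c f) = trans c (S f)) (f : A → ℝ) :
    S (dq d h b f) = dq d h b (S f) := by
  have key : ∀ g : A → ℝ, dq d h b g = h⁻¹ • (trans (d b) g - g) := by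
    intro g
    ext a
    simp [dq_apply, div_eq_inv_mul]
  rw [key, key, map_smul, map_sub, hS]

theorem dqs_comm_of_trans (d : Bool → A) (h : ℝ) (S : (A → ℝ) →ₗ[ℝ] (A → ℝ))
    (hS : ∀ c f, S (trans c f) = trans c (S f)) (w : List Bool) (f : A → ℝ) :
    S (dqs d h w f) = dqs d h w (S f) := by
  induction w generalizing f with
  | nil => rfl
  | cons b w ih => rw [dqs_cons, ih, dq_comm_of_trans d h b S hS, dqs_cons]

theorem trans_trans_comm (c c' : A) (f : A → ℝ) : trans c (trans c' f) = trans c' (trans c f) := by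
  ext a
  simp [add_right_comm]

theorem dqs_trans (d : Bool → A) (h : ℝ) (w : List Bool) (c : A) (f : A → ℝ) :
    dqs d h w (trans c f) = trans c (dqs d h w f) :=
  (dqs_comm_of_trans d h (trans c) (trans_trans_comm c) w f).symm

theorem dqs_dq (d : Bool → A) (h : ℝ) (w : List Bool) (b : Bool) (f : A → ℝ) :
    dqs d h w (dq d h b f) = dq d h b (dqs d h w f) :=
  dq_comm_of_trans d h b (dqs d h w) (dqs_trans d h w) f

theorem lap_trans (d : Bool → A) (h : ℝ) (c : A) (f : A → ℝ) :
    lap d h (trans c f) = trans c (lap d h f) := by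
  ext a
  simp [lap_apply, add_right_comm, add_sub_right_comm]

theorem dqs_lap (d : Bool → A) (h : ℝ) (w : List Bool) (f : A → ℝ) :
    dqs d h w (lap d h f) = lap d h (dqs d h w f) :=
  (dqs_comm_of_trans d h (lap d h) (lap_trans d h) w f).symm

theorem lap_eq_sum_dq (d : Bool → A) (h : ℝ) (f : A → ℝ) :
    lap d h f = ∑ b, trans (-d b) (dq d h b (dq d h b f)) := by
  ext a
  simp only [lap_apply, Finset.sum_apply, trans_apply, dq_apply]
  refine Finset.sum_congr rfl fun b _ => ?_
  rw [neg_add_cancel_right, ← sub_eq_add_neg, ← sub_div, div_div, ← sq]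
  ring

/-- Difference quotients commute with pulling back along a map which respects the grid steps. -/
theorem dqs_comp {B : Type*} [AddCommGroup B] (d : Bool → A) (d' : Bool → B) (h : ℝ) (p : A → B)
    (hp : ∀ a b, p (a + d b) = p a + d' b) (w : List Bool) (f : B → ℝ) :
    dqs d h w (f ∘ p) = dqs d' h w f ∘ p := by
  induction w generalizing f with
  | nil => rfl
  | cons b w ih =>
    rw [dqs_cons, dqs_cons, ← ih]
    congr 1
    ext a
    simp [dq_apply, hp]

/-! ### Uniform bounds on difference quotients -/

/-- All difference quotients of order at most `r` are bounded by `M`. -/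
def DqBdd (d : Bool → A) (h : ℝ) (r : ℕ) (M : ℝ) (f : A → ℝ) : Prop :=
  ∀ w : List Bool, w.length ≤ r → ∀ a, |dqs d h w f a| ≤ M

variable {d : Bool → A} {h : ℝ} {r : ℕ} {M M' : ℝ} {f g : A → ℝ}

theorem DqBdd.le (hf : DqBdd d h r M f) (a : A) : |f a| ≤ M :=
  hf [] (Nat.zero_le _) a

theorem DqBdd.nonneg (hf : DqBdd d h r M f) : 0 ≤ M :=
  (abs_nonneg _).trans (hf.le 0)

theorem DqBdd.mono (hf : DqBdd d h r M f) {r' : ℕ} (hr : r' ≤ r) (hM : M ≤ M') :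
    DqBdd d h r' M' f :=
  fun w hw a => (hf w (hw.trans hr) a).trans hM

theorem DqBdd.mono_const (hf : DqBdd d h r M f) (hM : M ≤ M') : DqBdd d h r M' f :=
  hf.mono le_rfl hM

/-- Peeling off the first letter of a word is what drives the inductions on the order. -/
theorem dqBdd_succ_iff :
    DqBdd d h (r + 1) M f ↔ (∀ a, |f a| ≤ M) ∧ ∀ b, DqBdd d h r M (dq d h b f) := by
  constructor
  · exact fun hf => ⟨hf.le, fun b w hw a => hf (b :: w) (by simpa using hw) a⟩
  · rintro ⟨h0, h1⟩ (_ | ⟨b, w⟩) hw a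
    · exact h0 a
    · exact h1 b w (by simpa using hw) a

theorem DqBdd.dq (hf : DqBdd d h (r + 1) M f) (b : Bool) : DqBdd d h r M (dq d h b f) :=
  (dqBdd_succ_iff.1 hf).2 b

theorem DqBdd.add (hf : DqBdd d h r M f) (hg : DqBdd d h r M' g) :
    DqBdd d h r (M + M') (f + g) := fun w hw a => by
  rw [map_add]
  exact (abs_add_le _ _).trans (add_le_add (hf w hw a) (hg w hw a))

theorem DqBdd.sub (hf : DqBdd d h r M f) (hg : DqBdd d h r M' g) :
    DqBdd d h r (M + M') (f - g) := fun w hw a => by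
  rw [map_sub]
  exact (abs_sub _ _).trans (add_le_add (hf w hw a) (hg w hw a))

theorem DqBdd.smul (hf : DqBdd d h r M f) (c : ℝ) : DqBdd d h r (|c| * M) (c • f) :=
  fun w hw a => by
  rw [map_smul, Pi.smul_apply, smul_eq_mul, abs_mul]
  exact mul_le_mul_of_nonneg_left (hf w hw a) (abs_nonneg _)

theorem DqBdd.trans (hf : DqBdd d h r M f) (c : A) : DqBdd d h r M (trans c f) :=
  fun w hw a => by
  rw [dqs_trans]
  exact hf w hw _

theorem DqBdd.mul (hf : DqBdd d h r M f) (hg : DqBdd d h r M' g) :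
    DqBdd d h r (2 ^ r * (M * M')) (f * g) := by
  induction r generalizing f g with
  | zero =>
    intro w hw a
    obtain rfl : w = [] := List.length_eq_zero_iff.1 (Nat.le_zero.1 hw)
    rw [dqs_nil, Pi.mul_apply, abs_mul, pow_zero, one_mul]
    exact mul_le_mul (hf.le a) (hg.le a) (abs_nonneg _) hf.nonneg
  | succ r ih =>
    have hM : 0 ≤ M * M' := mul_nonneg hf.nonneg hg.nonneg
    refine dqBdd_succ_iff.2 ⟨fun a => ?_, fun b => ?_⟩
    · rw [Pi.mul_apply, abs_mul]
      calc |f a| * |g a| ≤ M * M' :=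
            mul_le_mul (hf.le a) (hg.le a) (abs_nonneg _) hf.nonneg
        _ ≤ 2 ^ (r + 1) * (M * M') := le_mul_of_one_le_left hM (one_le_pow₀ one_le_two)
    · rw [dq_mul]
      refine ((ih (hf.mono r.le_succ le_rfl) (hg.dq b)).add
        (ih (hf.dq b) ((hg.mono r.le_succ le_rfl).trans (d b)))).mono_const (le_of_eq ?_)
      ring

theorem DqBdd.lap (hf : DqBdd d h (r + 2) M f) : DqBdd d h r (2 * M) (lap d h f) := by
  rw [lap_eq_sum_dq, Fintype.sum_bool]
  exact ((((hf.dq _).dq _).trans _).add (((hf.dq _).dq _).trans _)).mono_const (by ring_nf; rfl)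

end DifferenceQuotients

/-! ### Sums over words -/

/-- The sum of `f w` over all words `w` of length at most `r`. -/
def wsum : ℕ → (List Bool → ℝ) → ℝ
  | 0, f => f []
  | r + 1, f => f [] + ∑ b, wsum r (fun w => f (b :: w))

theorem wsum_succ (r : ℕ) (f : List Bool → ℝ) :
    wsum (r + 1) f = f [] + ∑ b, wsum r (fun w => f (b :: w)) := rfl

theorem wsum_add (r : ℕ) (f g : List Bool → ℝ) :
    wsum r (fun w => f w + g w) = wsum r f + wsum r g := by
  induction r generalizing f g with
  | zero => rfl
  | succ r ih => simp only [wsum_succ, ih, Finset.sum_add_distrib]; ring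

theorem wsum_mul_left (r : ℕ) (c : ℝ) (f : List Bool → ℝ) :
    wsum r (fun w => c * f w) = c * wsum r f := by
  induction r generalizing f with
  | zero => rfl
  | succ r ih => simp only [wsum_succ, ih, mul_add, Finset.mul_sum]

theorem wsum_le_wsum {r : ℕ} {f g : List Bool → ℝ} (hfg : ∀ w, w.length ≤ r → f w ≤ g w) :
    wsum r f ≤ wsum r g := by
  induction r generalizing f g with
  | zero => exact hfg [] le_rfl
  | succ r ih =>
    exact add_le_add (hfg [] (Nat.zero_le _))
      (Finset.sum_le_sum fun b _ => ih fun w hw => hfg (b :: w) (by simpa using hw))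

theorem wsum_zero (r : ℕ) : wsum r (fun _ => 0) = 0 := by
  simpa using wsum_mul_left r 0 (fun _ => 0)

theorem wsum_nonneg {r : ℕ} {f : List Bool → ℝ} (hf : ∀ w, 0 ≤ f w) : 0 ≤ wsum r f :=
  (wsum_zero r).symm.le.trans (wsum_le_wsum fun w _ => hf w)

theorem le_wsum {r : ℕ} {f : List Bool → ℝ} (hf : ∀ w, 0 ≤ f w) {w : List Bool}
    (hw : w.length ≤ r) : f w ≤ wsum r f := by
  induction r generalizing f w with
  | zero =>
    obtain rfl : w = [] := List.length_eq_zero_iff.1 (Nat.le_zero.1 hw)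
    rfl
  | succ r ih =>
    rw [wsum_succ]
    have hn : ∀ b ∈ Finset.univ, 0 ≤ wsum r (fun w => f (b :: w)) :=
      fun b _ => wsum_nonneg fun w => hf _
    rcases w with _ | ⟨b, w⟩
    · exact le_add_of_nonneg_right (Finset.sum_nonneg hn)
    · refine le_add_of_nonneg_of_le (hf _) (le_trans ?_
        (Finset.single_le_sum hn (Finset.mem_univ b)))
      exact ih (f := fun w => f (b :: w)) (fun w => hf _) (by simpa using hw)

/-- There are 2^(r+1) - 1 ≤ 3^r words of length at most r. -/
theorem wsum_const_le (r : ℕ) {c : ℝ} (hc : 0 ≤ c) : wsum r (fun _ => c) ≤ 3 ^ r * c := by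
  induction r with
  | zero => simp [wsum]
  | succ r ih =>
    rw [wsum_succ, Fintype.sum_bool, pow_succ]
    have : c ≤ 3 ^ r * c := le_mul_of_one_le_left hc (one_le_pow₀ (by norm_num))
    linarith

/-! ### Discrete Sobolev norms -/

section Sobolev

variable {A : Type*} [AddCommGroup A] [Fintype A]

/-- The square of the (unweighted) discrete `L²` norm. -/
def sqNorm (u : A → ℝ) : ℝ := ∑ a, u a ^ 2

/-- The square of the (unweighted) discrete Sobolev norm of order `r`. -/
def sobSq (d : Bool → A) (h : ℝ) (r : ℕ) (u : A → ℝ) : ℝ := wsum r fun w => sqNorm (dqs d h w u)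

/-- The sum of the squares of the first order difference quotients. -/
def gradSq (d : Bool → A) (h : ℝ) (u : A → ℝ) : ℝ := ∑ b, sqNorm (dq d h b u)

variable {d : Bool → A} {h : ℝ} {r : ℕ} {M : ℝ} {u v : A → ℝ}

theorem sqNorm_nonneg (u : A → ℝ) : 0 ≤ sqNorm u := Finset.sum_nonneg fun _ _ => sq_nonneg _

theorem gradSq_nonneg (u : A → ℝ) : 0 ≤ gradSq d h u :=
  Finset.sum_nonneg fun _ _ => sqNorm_nonneg _

theorem sobSq_nonneg (u : A → ℝ) : 0 ≤ sobSq d h r u := wsum_nonneg fun _ => sqNorm_nonneg _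

theorem sobSq_succ (u : A → ℝ) :
    sobSq d h (r + 1) u = sqNorm u + ∑ b, sobSq d h r (dq d h b u) := rfl

theorem sobSq_zero (u : A → ℝ) : sobSq d h 0 u = sqNorm u := rfl

theorem sqNorm_dqs_le {w : List Bool} (hw : w.length ≤ r) (u : A → ℝ) :
    sqNorm (dqs d h w u) ≤ sobSq d h r u :=
  le_wsum (f := fun w => sqNorm (dqs d h w u)) (fun _ => sqNorm_nonneg _) hw

theorem sqNorm_le_sobSq (u : A → ℝ) : sqNorm u ≤ sobSq d h r u :=
  sqNorm_dqs_le (w := []) (Nat.zero_le _) u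

theorem sobSq_dq_le (b : Bool) (u : A → ℝ) : sobSq d h r (dq d h b u) ≤ sobSq d h (r + 1) u := by
  rw [sobSq_succ]
  exact le_add_of_nonneg_of_le (sqNorm_nonneg _)
    (Finset.single_le_sum (f := fun b => sobSq d h r (dq d h b u))
      (fun _ _ => sobSq_nonneg _) (Finset.mem_univ b))

theorem sobSq_le_succ (u : A → ℝ) : sobSq d h r u ≤ sobSq d h (r + 1) u := by
  induction r generalizing u with
  | zero => exact sqNorm_le_sobSq u
  | succ r ih =>
    rw [sobSq_succ, sobSq_succ]
    gcongr
    exact ih _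

theorem sobSq_mono {r r' : ℕ} (hr : r ≤ r') (u : A → ℝ) : sobSq d h r u ≤ sobSq d h r' u :=
  monotone_nat_of_le_succ (f := fun r => sobSq d h r u) (fun _ => sobSq_le_succ u) hr

theorem sobSq_dqs_le (w : List Bool) (u : A → ℝ) :
    sobSq d h r (dqs d h w u) ≤ sobSq d h (r + w.length) u := by
  induction w generalizing u with
  | nil => rfl
  | cons b w ih =>
    rw [dqs_cons, List.length_cons, ← add_assoc]
    exact (ih _).trans (sobSq_dq_le b u)

theorem gradSq_dqs_le {w : List Bool} (hw : w.length ≤ r) (u : A → ℝ) :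
    gradSq d h (dqs d h w u) ≤ sobSq d h (r + 1) u := by
  have h1 : gradSq d h (dqs d h w u) ≤ sobSq d h 1 (dqs d h w u) := by
    rw [sobSq_succ]
    exact le_add_of_nonneg_left (sqNorm_nonneg _)
  exact h1.trans ((sobSq_dqs_le w u).trans (sobSq_mono (by omega) u))

theorem sqNorm_trans (c : A) (u : A → ℝ) : sqNorm (trans c u) = sqNorm u :=
  Equiv.sum_comp (Equiv.addRight c) (fun a => u a ^ 2)

theorem sobSq_trans (c : A) (u : A → ℝ) : sobSq d h r (trans c u) = sobSq d h r u := by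
  simp only [sobSq, dqs_trans, sqNorm_trans]

theorem sqNorm_add_le (u v : A → ℝ) : sqNorm (u + v) ≤ 2 * (sqNorm u + sqNorm v) := by
  rw [sqNorm, sqNorm, sqNorm, ← Finset.sum_add_distrib, Finset.mul_sum]
  refine Finset.sum_le_sum fun a _ => ?_
  rw [Pi.add_apply]
  nlinarith [sq_nonneg (u a - v a)]

theorem sqNorm_smul (c : ℝ) (u : A → ℝ) : sqNorm (c • u) = c ^ 2 * sqNorm u := by
  simp [sqNorm, mul_pow, Finset.mul_sum]

theorem sobSq_smul (c : ℝ) (u : A → ℝ) : sobSq d h r (c • u) = c ^ 2 * sobSq d h r u := by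
  simp only [sobSq, map_smul, sqNorm_smul, wsum_mul_left]

theorem sobSq_add_le (u v : A → ℝ) :
    sobSq d h r (u + v) ≤ 2 * (sobSq d h r u + sobSq d h r v) := by
  rw [sobSq, sobSq, sobSq, ← wsum_add, ← wsum_mul_left]
  refine wsum_le_wsum fun w _ => ?_
  rw [map_add]
  exact sqNorm_add_le _ _

theorem sobSq_sub_le (u v : A → ℝ) :
    sobSq d h r (u - v) ≤ 2 * (sobSq d h r u + sobSq d h r v) := by
  have := sobSq_add_le (d := d) (h := h) (r := r) u ((-1 : ℝ) • v)
  rw [sobSq_smul, neg_one_smul, ← sub_eq_add_neg] at this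
  simpa using this

theorem sqNorm_mul_le {c : A → ℝ} (hc : ∀ a, |c a| ≤ M) (u : A → ℝ) :
    sqNorm (c * u) ≤ M ^ 2 * sqNorm u := by
  rw [sqNorm, sqNorm, Finset.mul_sum]
  refine Finset.sum_le_sum fun a _ => ?_
  rw [Pi.mul_apply, mul_pow]
  exact mul_le_mul_of_nonneg_right (sq_le_sq' (abs_le.1 (hc a)).1 (abs_le.1 (hc a)).2)
    (sq_nonneg _)

/-- Discrete Leibniz rule, by induction on the order; the translate in the product rule does not
change the norm. -/
theorem sobSq_mul_le {c : A → ℝ} (hc : DqBdd d h r M c) (u : A → ℝ) :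
    sobSq d h r (c * u) ≤ 8 ^ r * M ^ 2 * sobSq d h r u := by
  induction r generalizing c u with
  | zero => simpa [sobSq_zero] using sqNorm_mul_le hc.le u
  | succ r ih =>
    rw [sobSq_succ, sobSq_succ, mul_add, Finset.mul_sum]
    have hM := sq_nonneg M
    have h8 : (1 : ℝ) ≤ 8 ^ r := one_le_pow₀ (by norm_num)
    have key : ∀ b, sobSq d h r (dq d h b (c * u)) ≤
        2 * 8 ^ r * M ^ 2 * sobSq d h r (dq d h b u) + 2 * 8 ^ r * M ^ 2 * sobSq d h r u := by
      intro b
      rw [dq_mul]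
      refine (sobSq_add_le _ _).trans ?_
      have h1 := ih (hc.mono r.le_succ le_rfl) (dq d h b u)
      have h2 := ih (hc.dq b) (trans (d b) u)
      rw [sobSq_trans] at h2
      linarith
    have h3 : sobSq d h r u ≤ sqNorm u + ∑ b, sobSq d h r (dq d h b u) := by
      rw [← sobSq_succ]; exact sobSq_le_succ u
    have h4 := sqNorm_mul_le hc.le u
    have h5 : 0 ≤ M ^ 2 * sqNorm u := mul_nonneg hM (sqNorm_nonneg _)
    rw [Fintype.sum_bool] at h3 ⊢
    rw [Fintype.sum_bool]
    have k1 := key true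
    have k2 := key false
    have h6 : 8 ^ r * M ^ 2 * sobSq d h r u ≤ 8 ^ r * M ^ 2 *
      (sqNorm u + (sobSq d h r (dq d h true u) + sobSq d h r (dq d h false u))) :=
      mul_le_mul_of_nonneg_left h3 (by positivity)
    have h7 : M ^ 2 * sqNorm u ≤ 8 ^ r * M ^ 2 * sqNorm u := by
      rw [mul_assoc]; exact le_mul_of_one_le_left h5 h8
    have h8' : 0 ≤ 8 ^ r * M ^ 2 * sobSq d h r (dq d h true u) :=
      mul_nonneg (by positivity) (sobSq_nonneg _)
    have h9 : 0 ≤ 8 ^ r * M ^ 2 * sobSq d h r (dq d h false u) :=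
      mul_nonneg (by positivity) (sobSq_nonneg _)
    rw [pow_succ]
    linarith

theorem sqNorm_dq_le (hh : 0 < h) (b : Bool) (u : A → ℝ) :
    sqNorm (dq d h b u) ≤ 4 / h ^ 2 * sqNorm u := by
  have : dq d h b u = h⁻¹ • (trans (d b) u + (-1 : ℝ) • u) := by
    ext a
    simp [dq_apply, div_eq_inv_mul, sub_eq_add_neg]
  rw [this, sqNorm_smul]
  have h1 := sqNorm_add_le (trans (d b) u) ((-1 : ℝ) • u)
  rw [sqNorm_smul, sqNorm_trans] at h1
  calc h⁻¹ ^ 2 * sqNorm (trans (d b) u + (-1 : ℝ) • u)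
      ≤ h⁻¹ ^ 2 * (4 * sqNorm u) := by gcongr; linarith
    _ = 4 / h ^ 2 * sqNorm u := by field_simp

theorem sobSq_dq_le_inv (hh : 0 < h) (b : Bool) (u : A → ℝ) :
    sobSq d h r (dq d h b u) ≤ 4 / h ^ 2 * sobSq d h r u := by
  rw [sobSq, sobSq, ← wsum_mul_left]
  refine wsum_le_wsum fun w _ => ?_
  rw [dqs_dq]
  exact sqNorm_dq_le hh b _

/-- Inverse inequality: one derivative costs a factor 1/h. It is affordable where a factor s ≤ Kh is
available. -/
theorem sobSq_succ_le_inv (hh : 0 < h) (hh1 : h ≤ 1) (u : A → ℝ) :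
    sobSq d h (r + 1) u ≤ 9 / h ^ 2 * sobSq d h r u := by
  rw [sobSq_succ, Fintype.sum_bool]
  have h1 : sqNorm u ≤ 1 / h ^ 2 * sobSq d h r u :=
    (sqNorm_le_sobSq u).trans (le_mul_of_one_le_left (sobSq_nonneg _)
      ((one_le_div (by positivity)).2 (pow_le_one₀ hh.le hh1)))
  have h2 := sobSq_dq_le_inv (d := d) (r := r) hh true u
  have h3 := sobSq_dq_le_inv (d := d) (r := r) hh false u
  have : 9 / h ^ 2 * sobSq d h r u = 1 / h ^ 2 * sobSq d h r u + (4 / h ^ 2 * sobSq d h r u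
    + 4 / h ^ 2 * sobSq d h r u) := by ring
  linarith

theorem sobSq_le_of_dqBdd (hu : DqBdd d h r M u) :
    sobSq d h r u ≤ 3 ^ r * (Fintype.card A * M ^ 2) := by
  refine le_trans (wsum_le_wsum fun w hw => ?_) (wsum_const_le r
    (c := Fintype.card A * M ^ 2) (by positivity))
  calc sqNorm (dqs d h w u) ≤ ∑ _a : A, M ^ 2 :=
        Finset.sum_le_sum fun a _ => sq_le_sq' (abs_le.1 (hu w hw a)).1 (abs_le.1 (hu w hw a)).2
    _ = Fintype.card A * M ^ 2 := by simp

end Sobolev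

/-! ### The energy estimate for one linear step -/

section Energy

variable {A : Type*} [AddCommGroup A] [Fintype A] {d : Bool → A} {h : ℝ}

theorem sum_lap_mul (f g : A → ℝ) :
    ∑ x, lap d h f x * g x = -∑ b, ∑ x, dq d h b f x * dq d h b g x := by
  simp only [lap_apply, Finset.sum_mul]
  rw [Finset.sum_comm, ← Finset.sum_neg_distrib]
  refine Finset.sum_congr rfl fun b _ => ?_
  have h1 : ∑ x, f (x + d b) * g x = ∑ x, f x * g (x - d b) := by
    rw [← Equiv.sum_comp (Equiv.addRight (d b)) (fun x => f x * g (x - d b))]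
    simp
  have h2 : ∑ x, f (x - d b) * g x = ∑ x, f x * g (x + d b) := by
    rw [← Equiv.sum_comp (Equiv.addRight (d b)) (fun x => f (x - d b) * g x)]
    simp
  have h3 : ∑ x, f (x + d b) * g (x + d b) = ∑ x, f x * g x :=
    Equiv.sum_comp (Equiv.addRight (d b)) (fun x => f x * g x)
  have e1 : ∀ x, (f (x + d b) + f (x - d b) - 2 * f x) / h ^ 2 * g x =
      h⁻¹ ^ 2 * (f (x + d b) * g x + f (x - d b) * g x - 2 * (f x * g x)) := fun x => by
    field_simp
  have e2 : ∀ x, dq d h b f x * dq d h b g x =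
      h⁻¹ ^ 2 * (f (x + d b) * g (x + d b) + f x * g x - f (x + d b) * g x
        - f x * g (x + d b)) := fun x => by
    rw [dq_apply, dq_apply]
    field_simp
    ring
  simp only [e1, e2]
  rw [← Finset.mul_sum, ← Finset.mul_sum, ← mul_neg]
  congr 1
  simp only [Finset.sum_sub_distrib, Finset.sum_add_distrib, ← Finset.mul_sum]
  rw [h2, h3]
  ring

/-- The energy of two consecutive levels of the scheme. -/
def energy (d : Bool → A) (h s Be : ℝ) (u u' : A → ℝ) : ℝ :=
  1 / 2 * sqNorm u + s * Be / 2 * (gradSq d h u + gradSq d h ((1 / 2 : ℝ) • (u + u')))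

theorem sqNorm_le_energy {s Be : ℝ} (hs : 0 ≤ s) (hBe : 0 ≤ Be) (u u' : A → ℝ) :
    sqNorm u ≤ 2 * energy d h s Be u u' := by
  have := mul_nonneg (mul_nonneg hs hBe) (add_nonneg (gradSq_nonneg (d := d) (h := h) u)
    (gradSq_nonneg (d := d) (h := h) ((1 / 2 : ℝ) • (u + u'))))
  unfold energy
  linarith

/-- The algebraic inequality behind the energy estimate: the extrapolated concave term is
controlled by the convex term up to telescoping contributions. -/
theorem flux_ineq {a Bc Be α M p q r S Da G : ℝ} (ha : 0 ≤ a) (hBe : 0 ≤ Be) (hα : 0 < α)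
    (hB : α ≤ Bc - 3 * Be) (hDa : |Da| ≤ M) :
    -((a * ((p + q) / 2) + Da * S + Bc * ((p + q) / 2) - Be * (3 / 2 * q - 1 / 2 * r) + G)
        * ((p + q) / 2)) ≤
      -(Be / 2 * (p ^ 2 - q ^ 2)) - Be / 2 * (((p + q) / 2) ^ 2 - ((q + r) / 2) ^ 2)
        + M ^ 2 / α * S ^ 2 + 1 / α * G ^ 2 := by
  have h1 : -(Da * S * ((p + q) / 2)) ≤ M ^ 2 / α * S ^ 2 + α / 4 * ((p + q) / 2) ^ 2 := by
    have hDa2 : Da ^ 2 * S ^ 2 ≤ M ^ 2 * S ^ 2 :=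
      mul_le_mul_of_nonneg_right (sq_le_sq' (abs_le.1 hDa).1 (abs_le.1 hDa).2) (sq_nonneg _)
    have : M ^ 2 / α * S ^ 2 + α / 4 * ((p + q) / 2) ^ 2 + Da * S * ((p + q) / 2)
        = ((Da * S + α / 2 * ((p + q) / 2)) ^ 2 + (M ^ 2 * S ^ 2 - Da ^ 2 * S ^ 2)) / α := by
      field_simp
      ring
    have h0 : 0 ≤ ((Da * S + α / 2 * ((p + q) / 2)) ^ 2
        + (M ^ 2 * S ^ 2 - Da ^ 2 * S ^ 2)) / α :=
      div_nonneg (add_nonneg (sq_nonneg _) (sub_nonneg.2 hDa2)) hα.le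
    linarith
  have h2 : -(G * ((p + q) / 2)) ≤ 1 / α * G ^ 2 + α / 4 * ((p + q) / 2) ^ 2 := by
    have : 1 / α * G ^ 2 + α / 4 * ((p + q) / 2) ^ 2 + G * ((p + q) / 2)
        = (G + α / 2 * ((p + q) / 2)) ^ 2 / α := by
      field_simp
      ring
    have h0 : 0 ≤ (G + α / 2 * ((p + q) / 2)) ^ 2 / α := div_nonneg (sq_nonneg _) hα.le
    linarith
  have h3 : 0 ≤ a * ((p + q) / 2) ^ 2 := mul_nonneg ha (sq_nonneg _)
  have h4 : α * ((p + q) / 2) ^ 2 ≤ (Bc - 3 * Be) * ((p + q) / 2) ^ 2 :=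
    mul_le_mul_of_nonneg_right hB (sq_nonneg _)
  -- With m = (p + q)/2 and n = (q + r)/2 the extrapolation is 2m - (p - q) - n. Multiplied by m, it
  -- gives 2m² - (p² - q²)/2 - nm, and -nm ≤ (m² + n²)/2 by this square. The total is 3m² minus two
  -- telescoping differences, which is where the factor 3 in `hB` comes from.
  have h5 : 0 ≤ Be * ((p + q) / 2 + (q + r) / 2) ^ 2 := mul_nonneg hBe (sq_nonneg _)
  have h6 : 0 ≤ α * ((p + q) / 2) ^ 2 := mul_nonneg hα.le (sq_nonneg _)
  linear_combination h1 + h2 + h3 + h4 + h5 / 2 + h6 / 2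

/-- Testing with the average m turns the time difference into a difference of squares, and summation
by parts turns the Laplacian into a product of gradients, to which `flux_ineq` applies pointwise.
Only the gradient of `g` enters, so `g` may contain everything that is of lower order. -/
theorem energy_step {s α M Bc Be : ℝ} (hs : 0 ≤ s) (hα : 0 < α) (hBe : 0 ≤ Be)
    (hB : α ≤ Bc - 3 * Be) {a g τ v u u' : A → ℝ} (ha : ∀ x, 0 ≤ a x)
    (hM : ∀ b x, |dq d h b a x| ≤ M)
    (heq : v - u = s • lap d h (a * ((1 / 2 : ℝ) • (v + u)) + Bc • ((1 / 2 : ℝ) • (v + u))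
      - Be • ((3 / 2 : ℝ) • u - (1 / 2 : ℝ) • u') + g) + s • τ) :
    energy d h s Be v u ≤ energy d h s Be u u'
      + s * (2 * M ^ 2 / α * sqNorm ((1 / 2 : ℝ) • (v + u)) + 1 / α * gradSq d h g)
      + s * ∑ x, τ x * ((1 / 2 : ℝ) • (v + u)) x := by
  set m := (1 / 2 : ℝ) • (v + u) with hm
  set n := (1 / 2 : ℝ) • (u + u') with hn
  set Z := a * m + Bc • m - Be • ((3 / 2 : ℝ) • u - (1 / 2 : ℝ) • u') + g with hZ
  have h1 : ∑ x, (v - u) x * m x = 1 / 2 * (sqNorm v - sqNorm u) := by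
    rw [sqNorm, sqNorm, ← Finset.sum_sub_distrib, Finset.mul_sum]
    refine Finset.sum_congr rfl fun x _ => ?_
    simp [hm]
    ring
  have h2 : ∑ x, (v - u) x * m x = s * (-∑ b, ∑ x, dq d h b Z x * dq d h b m x)
      + s * ∑ x, τ x * m x := by
    rw [heq, ← sum_lap_mul, Finset.mul_sum, Finset.mul_sum, ← Finset.sum_add_distrib]
    refine Finset.sum_congr rfl fun x _ => ?_
    simp
    ring
  have hdm : ∀ b x, dq d h b m x = (dq d h b v x + dq d h b u x) / 2 := fun b x => by
    simp [hm]; ring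
  have hdn : ∀ b x, dq d h b n x = (dq d h b u x + dq d h b u' x) / 2 := fun b x => by
    simp [hn]; ring
  have hdZ : ∀ b x, dq d h b Z x = a x * ((dq d h b v x + dq d h b u x) / 2)
      + dq d h b a x * trans (d b) m x + Bc * ((dq d h b v x + dq d h b u x) / 2)
      - Be * (3 / 2 * dq d h b u x - 1 / 2 * dq d h b u' x) + dq d h b g x := fun b x => by
    rw [hZ, map_add, map_sub, map_add, dq_mul]
    simp only [map_smul, map_sub, Pi.add_apply, Pi.sub_apply, Pi.mul_apply, Pi.smul_apply,
      smul_eq_mul, hdm]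
  have h3 : -∑ b, ∑ x, dq d h b Z x * dq d h b m x ≤
      -(Be / 2 * (gradSq d h v - gradSq d h u)) - Be / 2 * (gradSq d h m - gradSq d h n)
        + 2 * M ^ 2 / α * sqNorm m + 1 / α * gradSq d h g := by
    have hb : ∀ b, -∑ x, dq d h b Z x * dq d h b m x ≤
        -(Be / 2 * (sqNorm (dq d h b v) - sqNorm (dq d h b u)))
        - Be / 2 * (sqNorm (dq d h b m) - sqNorm (dq d h b n))
        + M ^ 2 / α * sqNorm (trans (d b) m) + 1 / α * sqNorm (dq d h b g) := by
      intro b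
      simp only [sqNorm]
      rw [← Finset.sum_sub_distrib, ← Finset.sum_sub_distrib, Finset.mul_sum, Finset.mul_sum,
        Finset.mul_sum, Finset.mul_sum, ← Finset.sum_neg_distrib, ← Finset.sum_neg_distrib,
        ← Finset.sum_sub_distrib, ← Finset.sum_add_distrib, ← Finset.sum_add_distrib]
      refine Finset.sum_le_sum fun x _ => ?_
      rw [hdZ, hdm, hdn]
      exact flux_ineq (ha x) hBe hα hB (hM b x)
    have hb1 := hb true
    have hb2 := hb false
    rw [sqNorm_trans] at hb1 hb2
    simp only [gradSq, Fintype.sum_bool]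
    linear_combination hb1 + hb2
  have h4 := mul_le_mul_of_nonneg_left h3 hs
  unfold energy
  rw [h1] at h2
  linear_combination h2 + h4

end Energy

/-! ### Products of grid functions -/

section Products

variable {A : Type*} [AddCommGroup A] [Fintype A] {d : Bool → A} {h : ℝ}

theorem sobSq_zero_right (r : ℕ) : sobSq d h r (0 : A → ℝ) = 0 := by
  simpa using sobSq_smul (d := d) (h := h) (r := r) 0 (0 : A → ℝ)

/-- In the commutator at least one difference quotient falls on `a`, so at most r - 1 fall on `u`;
one further derivative still stays within order r. -/
theorem sobSq_one_commutator_le {r : ℕ} {M : ℝ} {a : A → ℝ} (ha : DqBdd d h (r + 1) M a)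
    (w : List Bool) (hw : w.length ≤ r) (u : A → ℝ) :
    sobSq d h 1 (dqs d h w (a * u) - a * dqs d h w u) ≤ 4 ^ r * 8 ^ r * M ^ 2 * sobSq d h r u := by
  induction r generalizing u w with
  | zero =>
    obtain rfl : w = [] := List.length_eq_zero_iff.1 (Nat.le_zero.1 hw)
    simp only [dqs_nil, sub_self]
    rw [sobSq_zero_right]
    exact mul_nonneg (by positivity) (sobSq_nonneg _)
  | succ r ih =>
    have hmono : sobSq d h r u ≤ sobSq d h (r + 1) u := sobSq_le_succ u
    have hn : 0 ≤ M ^ 2 * sobSq d h (r + 1) u := mul_nonneg (sq_nonneg M) (sobSq_nonneg _)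
    rcases w with _ | ⟨b, w⟩
    · simp only [dqs_nil, sub_self]
      rw [sobSq_zero_right]
      exact mul_nonneg (by positivity) (sobSq_nonneg _)
    · have hw' : w.length ≤ r := by simpa using hw
      have e : dqs d h (b :: w) (a * u) - a * dqs d h (b :: w) u =
          (dqs d h w (a * dq d h b u) - a * dqs d h w (dq d h b u))
            + dqs d h w (dq d h b a * trans (d b) u) := by
        rw [dqs_cons, dqs_cons, dq_mul, map_add]
        abel
      rw [e]
      refine (sobSq_add_le _ _).trans ?_
      have h1 := ih (ha.mono (by omega) le_rfl) w hw' (dq d h b u)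
      have h2 : sobSq d h 1 (dqs d h w (dq d h b a * trans (d b) u)) ≤
          8 ^ (r + 1) * M ^ 2 * sobSq d h (r + 1) u := by
        refine (sobSq_dqs_le w _).trans
          ((sobSq_mono (show 1 + w.length ≤ r + 1 by omega) _).trans ?_)
        refine (sobSq_mul_le (ha.dq b) _).trans ?_
        rw [sobSq_trans]
      have h3 : sobSq d h r (dq d h b u) ≤ sobSq d h (r + 1) u := sobSq_dq_le b u
      have h4 : 4 ^ r * 8 ^ r * M ^ 2 * sobSq d h r (dq d h b u) ≤
          4 ^ r * 8 ^ r * M ^ 2 * sobSq d h (r + 1) u :=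
        mul_le_mul_of_nonneg_left h3 (by positivity)
      have h5 : 8 ^ r * (M ^ 2 * sobSq d h (r + 1) u) ≤
          4 ^ r * (8 ^ r * (M ^ 2 * sobSq d h (r + 1) u)) :=
        le_mul_of_one_le_left (by positivity) (one_le_pow₀ (by norm_num))
      rw [pow_succ, pow_succ] at *
      have h6 : 0 ≤ 4 ^ r * (8 ^ r * (M ^ 2 * sobSq d h (r + 1) u)) := by positivity
      linarith

theorem abs_dq_le {C : ℝ} (hh : 0 < h) {u : A → ℝ} (hu : ∀ x, |u x| ≤ C) (b : Bool) (x : A) :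
    |dq d h b u x| ≤ 2 * C / h := by
  rw [dq_apply, abs_div, abs_of_pos hh]
  gcongr
  have := abs_sub (u (x + d b)) (u x)
  linarith [hu (x + d b), hu x]

/-- Of at most three difference quotients, one factor carries at most one. If it carries none, its
size h compensates the inverse inequality for the other factor; if it carries one, it is bounded by
2 and the other factor has order at most two. -/
theorem sqNorm_dqs_mul_dqs_le (hh : 0 < h) (hh1 : h ≤ 1) {u v : A → ℝ} (hu : ∀ x, |u x| ≤ h)
    (hv : ∀ x, |v x| ≤ h) (w w' : List Bool) (hw : w.length + w'.length ≤ 3) :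
    sqNorm (dqs d h w u * dqs d h w' v) ≤ 4 * (sobSq d h 2 u + sobSq d h 2 v) := by
  wlog hlen : w'.length ≤ w.length generalizing u v w w'
  · rw [mul_comm (dqs d h w u), add_comm (sobSq d h 2 u)]
    exact this hv hu w' w (by omega) (by omega)
  have hU := sobSq_nonneg (d := d) (h := h) (r := 2) u
  have hV := sobSq_nonneg (d := d) (h := h) (r := 2) v
  rcases w' with _ | ⟨b, w'⟩
  · rw [dqs_nil, mul_comm]
    refine (sqNorm_mul_le hv _).trans ?_
    have h1 : sqNorm (dqs d h w u) ≤ 4 / h ^ 2 * sobSq d h 2 u := by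
      rcases w with _ | ⟨b, w⟩
      · refine (sqNorm_le_sobSq (r := 2) u).trans (le_mul_of_one_le_left hU ?_)
        rw [le_div_iff₀ (by positivity)]
        nlinarith
      · rw [dqs_cons, dqs_dq]
        refine (sqNorm_dq_le hh b _).trans ?_
        gcongr
        exact sqNorm_dqs_le (by simp at hw; omega) u
    calc h ^ 2 * sqNorm (dqs d h w u) ≤ h ^ 2 * (4 / h ^ 2 * sobSq d h 2 u) := by gcongr
      _ = 4 * sobSq d h 2 u := by field_simp
      _ ≤ _ := by linarith
  · obtain rfl : w' = [] := List.length_eq_zero_iff.1 (by simp at hw hlen; omega)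
    rw [dqs_cons, dqs_nil, mul_comm]
    have h1 : ∀ x, |dq d h b v x| ≤ 2 := fun x => by
      have := abs_dq_le (d := d) hh hv b x
      rwa [mul_div_assoc, div_self hh.ne', mul_one] at this
    refine (sqNorm_mul_le h1 _).trans ?_
    have h2 : sqNorm (dqs d h w u) ≤ sobSq d h 2 u := sqNorm_dqs_le (by simp at hw; omega) u
    linarith

theorem sobSq_dqs_mul_dqs_le (hh : 0 < h) (hh1 : h ≤ 1) (r : ℕ) {u v : A → ℝ}
    (hu : ∀ x, |u x| ≤ h) (hv : ∀ x, |v x| ≤ h) (w w' : List Bool)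
    (hw : w.length + w'.length + r ≤ 3) :
    sobSq d h r (dqs d h w u * dqs d h w' v) ≤ 9 ^ r * (4 * (sobSq d h 2 u + sobSq d h 2 v)) := by
  induction r generalizing u v w w' with
  | zero => simpa [sobSq_zero] using sqNorm_dqs_mul_dqs_le hh hh1 hu hv w w' hw
  | succ r ih =>
    rw [sobSq_succ]
    have h0 := sqNorm_dqs_mul_dqs_le (d := d) hh hh1 hu hv w w' (by omega)
    have hb : ∀ b, sobSq d h r (dq d h b (dqs d h w u * dqs d h w' v)) ≤
        2 * (2 * (9 ^ r * (4 * (sobSq d h 2 u + sobSq d h 2 v)))) := by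
      intro b
      rw [dq_mul]
      refine (sobSq_add_le _ _).trans ?_
      have h1 := ih hu hv w (b :: w') (by simp; omega)
      have h2 := ih hu (v := trans (d b) v) (fun x => hv _) (b :: w) w' (by simp; omega)
      rw [dqs_trans, sobSq_trans] at h2
      rw [dqs_cons, dqs_dq] at h1 h2
      linarith
    have hb1 := hb true
    have hb2 := hb false
    rw [Fintype.sum_bool, pow_succ]
    have hU := sobSq_nonneg (d := d) (h := h) (r := 2) u
    have hV := sobSq_nonneg (d := d) (h := h) (r := 2) v
    have : 4 * (sobSq d h 2 u + sobSq d h 2 v) ≤ 9 ^ r * (4 * (sobSq d h 2 u + sobSq d h 2 v)) :=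
      le_mul_of_one_le_left (by positivity) (one_le_pow₀ (by norm_num))
    linarith

/-- The product of two grid functions of size `h` gains one order of regularity. -/
theorem sobSq_three_mul_le (hh : 0 < h) (hh1 : h ≤ 1) {u v : A → ℝ}
    (hu : ∀ x, |u x| ≤ h) (hv : ∀ x, |v x| ≤ h) :
    sobSq d h 3 (u * v) ≤ 2916 * (sobSq d h 2 u + sobSq d h 2 v) := by
  have := sobSq_dqs_mul_dqs_le (d := d) hh hh1 3 hu hv [] [] (by simp)
  rw [dqs_nil, dqs_nil] at this
  linarith

end Products

/-! ### Convolution on a finite group -/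

section Convolution

variable {A : Type*} [AddCommGroup A] [Fintype A] {d : Bool → A} {h : ℝ} {r : ℕ} {M V : ℝ}
  {k : A → ℝ}

/-- Discrete convolution with the kernel `k`. -/
def gconv (h : ℝ) (k : A → ℝ) : (A → ℝ) →ₗ[ℝ] (A → ℝ) where
  toFun f a := h ^ 2 * ∑ c, k c * f (a - c)
  map_add' f g := by ext a; simp [mul_add, Finset.sum_add_distrib]
  map_smul' c f := by
    ext a
    simp only [Pi.smul_apply, smul_eq_mul, RingHom.id_apply, Finset.mul_sum]
    exact Finset.sum_congr rfl fun _ _ => by ring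

theorem gconv_apply (k f : A → ℝ) (a : A) : gconv h k f a = h ^ 2 * ∑ c, k c * f (a - c) := rfl

theorem gconv_trans (k : A → ℝ) (c : A) (f : A → ℝ) :
    gconv h k (trans c f) = trans c (gconv h k f) := by
  ext a
  simp [gconv_apply, add_sub_right_comm]

theorem dqs_gconv (w : List Bool) (k f : A → ℝ) :
    dqs d h w (gconv h k f) = gconv h k (dqs d h w f) :=
  (dqs_comm_of_trans d h (gconv h k) (gconv_trans k) w f).symm

theorem dq_gconv (b : Bool) (k f : A → ℝ) :
    dq d h b (gconv h k f) = gconv h (dq d h b k) f := by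
  ext a
  have h1 : ∑ c, k c * f (a + d b - c) = ∑ c, k (c + d b) * f (a - c) := by
    rw [← Equiv.sum_comp (Equiv.addRight (d b)) (fun c => k c * f (a + d b - c))]
    simp
  rw [dq_apply, gconv_apply, gconv_apply, gconv_apply, h1, ← mul_sub, ← Finset.sum_sub_distrib,
    mul_div_assoc, Finset.sum_div]
  congr 1
  refine Finset.sum_congr rfl fun c _ => ?_
  rw [dq_apply]
  ring

theorem abs_gconv_le (hV : h ^ 2 * Fintype.card A = V) (hk : ∀ a, |k a| ≤ M) {f : A → ℝ} {ρ : ℝ}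
    (hf : ∀ a, |f a| ≤ ρ) (a : A) : |gconv h k f a| ≤ V * M * ρ := by
  have hM : 0 ≤ M := (abs_nonneg _).trans (hk a)
  rw [gconv_apply, abs_mul, abs_of_nonneg (sq_nonneg h)]
  calc h ^ 2 * |∑ c, k c * f (a - c)| ≤ h ^ 2 * ∑ _c : A, M * ρ := by
        gcongr
        refine (Finset.abs_sum_le_sum_abs _ _).trans (Finset.sum_le_sum fun c _ => ?_)
        rw [abs_mul]
        exact mul_le_mul (hk c) (hf _) (abs_nonneg _) hM
    _ = V * M * ρ := by simp [← hV]; ring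

theorem sqNorm_gconv_le (hV : h ^ 2 * Fintype.card A = V) (hk : ∀ a, |k a| ≤ M) (f : A → ℝ) :
    sqNorm (gconv h k f) ≤ (V * M) ^ 2 * sqNorm f := by
  have h1 : ∀ a, gconv h k f a ^ 2 ≤ h ^ 4 * (Fintype.card A * M ^ 2 * sqNorm f) := by
    intro a
    have h4 : (h ^ 2) ^ 2 = h ^ 4 := by ring
    rw [gconv_apply, mul_pow, h4]
    refine mul_le_mul_of_nonneg_left ?_ (by positivity)
    refine (Finset.sum_mul_sq_le_sq_mul_sq _ _ _).trans ?_
    have h2 : ∑ c, f (a - c) ^ 2 = sqNorm f :=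
      Equiv.sum_comp (Equiv.subLeft a) (fun c => f c ^ 2)
    rw [h2]
    refine mul_le_mul_of_nonneg_right ?_ (sqNorm_nonneg _)
    calc ∑ c, k c ^ 2 ≤ ∑ _c : A, M ^ 2 :=
          Finset.sum_le_sum fun c _ => sq_le_sq' (abs_le.1 (hk c)).1 (abs_le.1 (hk c)).2
      _ = Fintype.card A * M ^ 2 := by simp
  calc sqNorm (gconv h k f) ≤ ∑ _a : A, h ^ 4 * (Fintype.card A * M ^ 2 * sqNorm f) :=
        Finset.sum_le_sum fun a _ => h1 a
    _ = (V * M) ^ 2 * sqNorm f := by simp [← hV]; ring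

theorem sobSq_gconv_le (hV : h ^ 2 * Fintype.card A = V) (hk : ∀ a, |k a| ≤ M) (f : A → ℝ) :
    sobSq d h r (gconv h k f) ≤ (V * M) ^ 2 * sobSq d h r f := by
  rw [sobSq, sobSq, ← wsum_mul_left]
  refine wsum_le_wsum fun w _ => ?_
  rw [dqs_gconv]
  exact sqNorm_gconv_le hV hk _

/-- The additional difference quotient is moved onto the kernel, so convolution gains one order. -/
theorem sobSq_succ_gconv_le (hV : h ^ 2 * Fintype.card A = V) (hk : DqBdd d h 1 M k) (f : A → ℝ) :
    sobSq d h (r + 1) (gconv h k f) ≤ 3 * (V * M) ^ 2 * sobSq d h r f := by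
  rw [sobSq_succ, Fintype.sum_bool, dq_gconv, dq_gconv]
  have h0 := (sqNorm_gconv_le hV hk.le f).trans
    (mul_le_mul_of_nonneg_left (sqNorm_le_sobSq (d := d) (h := h) (r := r) f)
      (sq_nonneg (V * M)))
  have h1 := sobSq_gconv_le (d := d) (r := r) hV (hk.dq true).le f
  have h2 := sobSq_gconv_le (d := d) (r := r) hV (hk.dq false).le f
  linarith

end Convolution

/-! ### The energy estimate in the discrete Sobolev norm of order two -/

section SobolevEnergy

variable {A : Type*} [AddCommGroup A] [Fintype A] {d : Bool → A} {h : ℝ}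

/-- The energies of all difference quotients of order at most two. -/
def sobEnergy (d : Bool → A) (h s Be : ℝ) (u u' : A → ℝ) : ℝ :=
  wsum 2 fun w => energy d h s Be (dqs d h w u) (dqs d h w u')

theorem sobSq_le_sobEnergy {s Be : ℝ} (hs : 0 ≤ s) (hBe : 0 ≤ Be) (u u' : A → ℝ) :
    sobSq d h 2 u ≤ 2 * sobEnergy d h s Be u u' := by
  rw [sobSq, sobEnergy, ← wsum_mul_left]
  exact wsum_le_wsum fun w _ => sqNorm_le_energy hs hBe _ _

theorem sobEnergy_nonneg {s Be : ℝ} (hs : 0 ≤ s) (hBe : 0 ≤ Be) (u u' : A → ℝ) :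
    0 ≤ sobEnergy d h s Be u u' := by
  have := sobSq_le_sobEnergy (d := d) (h := h) hs hBe u u'
  linarith [sobSq_nonneg (d := d) (h := h) (r := 2) u]

theorem sobEnergy_zero (s Be : ℝ) : sobEnergy d h s Be (0 : A → ℝ) 0 = 0 := by
  have : ∀ w, energy d h s Be (dqs d h w (0 : A → ℝ)) (dqs d h w 0) = 0 := fun w => by
    simp [energy, gradSq, sqNorm]
  simp only [sobEnergy, this, wsum_zero]

theorem gradSq_le_sobSq (u : A → ℝ) : gradSq d h u ≤ sobSq d h 1 u :=
  gradSq_dqs_le (w := []) (r := 0) le_rfl u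

/-- The estimate `energy_step` is applied to each difference quotient of order at most two, with the
commutator of `a` counted as part of the forcing. The weight `μ` is left free because the first step
and the later ones need different choices. -/
theorem sobEnergy_step {s α M Bc Be μ : ℝ} (hs : 0 ≤ s) (hα : 0 < α) (hBe : 0 ≤ Be)
    (hB : α ≤ Bc - 3 * Be) (hμ : 0 < μ) {a g τ v u u' : A → ℝ} (ha : ∀ x, 0 ≤ a x)
    (hM : DqBdd d h 3 M a)
    (heq : v - u = s • lap d h (a * ((1 / 2 : ℝ) • (v + u)) + Bc • ((1 / 2 : ℝ) • (v + u))
      - Be • ((3 / 2 : ℝ) • u - (1 / 2 : ℝ) • u') + g) + s • τ) :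
    sobEnergy d h s Be v u ≤ sobEnergy d h s Be u u'
      + s * (18434 * M ^ 2 / α * sobSq d h 2 ((1 / 2 : ℝ) • (v + u)) + 18 / α * sobSq d h 3 g)
      + (s ^ 2 / (4 * μ) * sobSq d h 2 τ + μ * sobSq d h 2 ((1 / 2 : ℝ) • (v + u))) := by
  set m := (1 / 2 : ℝ) • (v + u) with hm
  -- The number 1024 = 4² · 8² is the commutator constant. Summing 2R/α over at most 9 words gives
  -- 18432 = 18 · 1024, and the direct term 2M²/α raises this to 18434.
  set R := 1024 * M ^ 2 * sobSq d h 2 m + sobSq d h 3 g with hR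
  have hR0 : 0 ≤ R := add_nonneg (mul_nonneg (by positivity) (sobSq_nonneg _)) (sobSq_nonneg _)
  have key : ∀ w : List Bool, w.length ≤ 2 →
      energy d h s Be (dqs d h w v) (dqs d h w u) ≤
        energy d h s Be (dqs d h w u) (dqs d h w u')
        + s * (2 * M ^ 2 / α) * sqNorm (dqs d h w m) + s * (2 / α * R)
        + s ^ 2 / (4 * μ) * sqNorm (dqs d h w τ) + μ * sqNorm (dqs d h w m) := by
    intro w hw
    have hdm : dqs d h w m = (1 / 2 : ℝ) • (dqs d h w v + dqs d h w u) := by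
      rw [hm, map_smul, map_add]
    set gw := (dqs d h w (a * m) - a * dqs d h w m) + dqs d h w g with hgw
    have heqw : dqs d h w v - dqs d h w u = s • lap d h (a * ((1 / 2 : ℝ) • (dqs d h w v
        + dqs d h w u)) + Bc • ((1 / 2 : ℝ) • (dqs d h w v + dqs d h w u))
        - Be • ((3 / 2 : ℝ) • dqs d h w u - (1 / 2 : ℝ) • dqs d h w u') + gw)
        + s • dqs d h w τ := by
      rw [← map_sub, heq, map_add, map_smul, map_smul, dqs_lap, ← hdm, hgw]
      congr 3
      simp only [map_add, map_sub, map_smul]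
      abel
    have h1 := energy_step hs hα hBe hB ha (fun b x => hM [b] (by simp) x) heqw
    rw [← hdm] at h1
    have h2 : gradSq d h gw ≤ 2 * R := by
      refine (gradSq_le_sobSq gw).trans ((sobSq_add_le _ _).trans ?_)
      have c1 := sobSq_one_commutator_le (r := 2) hM w hw m
      have c2 : sobSq d h 1 (dqs d h w g) ≤ sobSq d h 3 g :=
        (sobSq_dqs_le w g).trans (sobSq_mono (by omega) g)
      rw [hR]
      norm_num at c1
      linarith
    have h3 : s * ∑ x, dqs d h w τ x * dqs d h w m x ≤
        s ^ 2 / (4 * μ) * sqNorm (dqs d h w τ) + μ * sqNorm (dqs d h w m) := by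
      rw [sqNorm, sqNorm, Finset.mul_sum, Finset.mul_sum, Finset.mul_sum,
        ← Finset.sum_add_distrib]
      refine Finset.sum_le_sum fun x _ => ?_
      have : s ^ 2 / (4 * μ) * dqs d h w τ x ^ 2 + μ * dqs d h w m x ^ 2
          - s * (dqs d h w τ x * dqs d h w m x)
          = (s * dqs d h w τ x - 2 * μ * dqs d h w m x) ^ 2 / (4 * μ) := by
        field_simp
        ring
      have h0 : 0 ≤ (s * dqs d h w τ x - 2 * μ * dqs d h w m x) ^ 2 / (4 * μ) := by positivity
      linarith
    have h4 : s * (1 / α * gradSq d h gw) ≤ s * (2 / α * R) := by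
      refine mul_le_mul_of_nonneg_left ?_ hs
      calc 1 / α * gradSq d h gw ≤ 1 / α * (2 * R) := by gcongr
        _ = 2 / α * R := by ring
    linarith
  have h5 := wsum_le_wsum key
  rw [wsum_add, wsum_add, wsum_add, wsum_add,
    wsum_mul_left 2 (s * (2 * M ^ 2 / α)) fun w => sqNorm (dqs d h w m),
    wsum_mul_left 2 (s ^ 2 / (4 * μ)) fun w => sqNorm (dqs d h w τ),
    wsum_mul_left 2 μ fun w => sqNorm (dqs d h w m)] at h5
  have h6 := wsum_const_le 2 (c := s * (2 / α * R)) (by positivity)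
  have e : 3 ^ 2 * (s * (2 / α * R)) = s * (18432 * M ^ 2 / α * sobSq d h 2 m
      + 18 / α * sobSq d h 3 g) := by rw [hR]; ring
  rw [e] at h6
  unfold sobEnergy
  simp only [show ∀ f, wsum 2 (fun w => sqNorm (dqs d h w f)) = sobSq d h 2 f from fun _ => rfl]
    at h5
  have e2 : s * (18434 * M ^ 2 / α * sobSq d h 2 m + 18 / α * sobSq d h 3 g) =
      s * (18432 * M ^ 2 / α * sobSq d h 2 m + 18 / α * sobSq d h 3 g) +
        s * (2 * M ^ 2 / α) * sobSq d h 2 m := by ring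
  rw [e2]
  linarith

end SobolevEnergy

/-! ### The lower order part of the error equation -/

section Forcing

variable {A : Type*} [AddCommGroup A] [Fintype A] {d : Bool → A} {h : ℝ}

/-- The difference is split into a non-negative coefficient times the average error, a term with the
small factor q - p, and quadratic and cubic remainders. Only the first is part of the diffusion; the
others go into `forcing`. -/
theorem eta_sub_eta (p q u v : ℝ) :
    eta p q - eta (p - u) (q - v) = (p * p + p * q + q * q) * (1 / 2 * (v + u))
      + (1 / 4 * ((q - p) * (p + q)) * (v - u)
        - (1 / 4 * (3 * p + q) * (u * u) + 1 / 2 * (p + q) * (u * v)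
          + 1 / 4 * (p + 3 * q) * (v * v))
        + 1 / 2 * (u * u + v * v) * (1 / 2 * (u + v))) := by
  unfold eta
  ring

/-- The part of the flux difference which is small in norms of order three. -/
def forcing (h : ℝ) (J P Q v u u' : A → ℝ) : A → ℝ :=
  ((1 / 4 : ℝ) • ((Q - P) * (P + Q))) * (v - u)
    - (((1 / 4 : ℝ) • ((3 : ℝ) • P + Q)) * (u * u) + ((1 / 2 : ℝ) • (P + Q)) * (u * v)
      + ((1 / 4 : ℝ) • (P + (3 : ℝ) • Q)) * (v * v))
    + ((1 / 2 : ℝ) • (u * u + v * v)) * ((1 / 2 : ℝ) • (u + v))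
    - gconv h J ((3 / 2 : ℝ) • u - (1 / 2 : ℝ) • u')

/-- Since h ≤ 1, the function (u² + v²)/2 is again at most h, so the cubic remainder is a product to
which `sobSq_three_mul_le` applies. -/
theorem sobSq_three_eta_le (hh : 0 < h) (hh1 : h ≤ 1) {u v : A → ℝ} (hu : ∀ x, |u x| ≤ h)
    (hv : ∀ x, |v x| ≤ h) :
    sobSq d h 3 (((1 / 2 : ℝ) • (u * u + v * v)) * ((1 / 2 : ℝ) • (u + v))) ≤
      10000000 * (sobSq d h 2 u + sobSq d h 2 v) := by
  have hsq : ∀ y : ℝ, |y| ≤ h → y * y ≤ h := fun y hy => by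
    have := abs_le.1 hy
    nlinarith [abs_nonneg y, abs_mul_abs_self y]
  have h1 : ∀ x, |((1 / 2 : ℝ) • (u * u + v * v)) x| ≤ h := fun x => by
    have h2 := hsq _ (hu x)
    have h3 := hsq _ (hv x)
    simp only [Pi.smul_apply, Pi.add_apply, Pi.mul_apply, smul_eq_mul]
    rw [abs_le]
    constructor <;> nlinarith [mul_self_nonneg (u x), mul_self_nonneg (v x)]
  have h2 : ∀ x, |((1 / 2 : ℝ) • (u + v)) x| ≤ h := fun x => by
    have h3 := abs_le.1 (hu x)
    have h4 := abs_le.1 (hv x)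
    simp only [Pi.smul_apply, Pi.add_apply, smul_eq_mul]
    rw [abs_le]
    constructor <;> linarith
  refine (sobSq_three_mul_le hh hh1 h1 h2).trans ?_
  rw [sobSq_smul, sobSq_smul]
  have h3 := sobSq_add_le (d := d) (h := h) (r := 2) u v
  have h4 := sobSq_add_le (d := d) (h := h) (r := 2) (u * u) (v * v)
  have h5 := (sobSq_le_succ (d := d) (h := h) (r := 2) (u * u)).trans
    (sobSq_three_mul_le hh hh1 hu hu)
  have h6 := (sobSq_le_succ (d := d) (h := h) (r := 2) (v * v)).trans
    (sobSq_three_mul_le hh hh1 hv hv)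
  have := sobSq_nonneg (d := d) (h := h) (r := 2) u
  have := sobSq_nonneg (d := d) (h := h) (r := 2) v
  linarith

theorem sobSq_coef_mul_le {M : ℝ} (hh : 0 < h) (hh1 : h ≤ 1) {c u v : A → ℝ}
    (hc : DqBdd d h 3 M c) (hu : ∀ x, |u x| ≤ h) (hv : ∀ x, |v x| ≤ h) :
    sobSq d h 3 (c * (u * v)) ≤ 1500000 * M ^ 2 * (sobSq d h 2 u + sobSq d h 2 v) := by
  refine (sobSq_mul_le hc _).trans ?_
  have h1 := sobSq_three_mul_le (d := d) hh hh1 hu hv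
  have hU := sobSq_nonneg (d := d) (h := h) (r := 2) u
  have hV := sobSq_nonneg (d := d) (h := h) (r := 2) v
  calc 8 ^ 3 * M ^ 2 * sobSq d h 3 (u * v)
      ≤ 8 ^ 3 * M ^ 2 * (2916 * (sobSq d h 2 u + sobSq d h 2 v)) := by gcongr
    _ = 1492992 * (M ^ 2 * (sobSq d h 2 u + sobSq d h 2 v)) := by ring
    _ ≤ 1500000 * (M ^ 2 * (sobSq d h 2 u + sobSq d h 2 v)) := by gcongr; norm_num
    _ = _ := by ring

theorem sobSq_forcing_le {s M K V : ℝ} (hh : 0 < h) (hh1 : h ≤ 1) (hs : 0 ≤ s) (hsK : s ≤ K * h)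
    (hV : h ^ 2 * Fintype.card A = V) {J P Q v u u' : A → ℝ} (hJ : DqBdd d h 1 M J)
    (hP : DqBdd d h 3 M P) (hQ : DqBdd d h 3 M Q) (hPQ : DqBdd d h 3 (M * s) (Q - P))
    (hu : ∀ x, |u x| ≤ h) (hv : ∀ x, |v x| ≤ h) :
    sobSq d h 3 (forcing h J P Q v u u') ≤
      (10 ^ 8 * M ^ 4 * K ^ 2 + 10 ^ 9 * M ^ 2 + 10 ^ 9 + 1000 * (V * M) ^ 2) *
        (sobSq d h 2 v + sobSq d h 2 u + sobSq d h 2 u') := by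
  have hU := sobSq_nonneg (d := d) (h := h) (r := 2) u
  have hV' := sobSq_nonneg (d := d) (h := h) (r := 2) v
  have hU' := sobSq_nonneg (d := d) (h := h) (r := 2) u'
  set N := sobSq d h 2 v + sobSq d h 2 u + sobSq d h 2 u' with hN
  have hN0 : 0 ≤ N := by positivity
  -- The coefficient is O(s), so its square cancels the 1/h² of the inverse inequality. This is
  -- where s ≤ Kh enters the energy estimate.
  have b1 : sobSq d h 3 (((1 / 4 : ℝ) • ((Q - P) * (P + Q))) * (v - u)) ≤
      147456 * (M ^ 4 * K ^ 2 * N) := by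
    have hc : DqBdd d h 3 (4 * M ^ 2 * s) ((1 / 4 : ℝ) • ((Q - P) * (P + Q))) :=
      ((hPQ.mul (hP.add hQ)).smul _).mono_const (by
        rw [abs_of_pos (by norm_num)]; ring_nf; rfl)
    refine (sobSq_mul_le hc _).trans ?_
    have h1 := sobSq_succ_le_inv (d := d) (r := 2) hh hh1 (v - u)
    have h2 := sobSq_sub_le (d := d) (h := h) (r := 2) v u
    have h3 : s ^ 2 ≤ (K * h) ^ 2 := by gcongr
    calc 8 ^ 3 * (4 * M ^ 2 * s) ^ 2 * sobSq d h 3 (v - u)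
        ≤ 8 ^ 3 * (4 * M ^ 2 * s) ^ 2 * (9 / h ^ 2 * (2 * N)) := by
          gcongr
          refine h1.trans ?_
          gcongr
          linarith
      _ = 8 ^ 3 * 16 * M ^ 4 * (9 / h ^ 2) * 2 * N * s ^ 2 := by ring
      _ ≤ 8 ^ 3 * 16 * M ^ 4 * (9 / h ^ 2) * 2 * N * (K * h) ^ 2 := by gcongr
      _ = 147456 * (M ^ 4 * K ^ 2 * N) := by field_simp; ring
  have c1 : DqBdd d h 3 M ((1 / 4 : ℝ) • ((3 : ℝ) • P + Q)) :=
    (((hP.smul 3).add hQ).smul _).mono_const (by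
      rw [abs_of_pos (by norm_num), abs_of_pos (by norm_num)]; ring_nf; rfl)
  have c2 : DqBdd d h 3 M ((1 / 2 : ℝ) • (P + Q)) :=
    ((hP.add hQ).smul _).mono_const (by rw [abs_of_pos (by norm_num)]; ring_nf; rfl)
  have c3 : DqBdd d h 3 M ((1 / 4 : ℝ) • (P + (3 : ℝ) • Q)) :=
    ((hP.add (hQ.smul 3)).smul _).mono_const (by
      rw [abs_of_pos (by norm_num), abs_of_pos (by norm_num)]; ring_nf; rfl)
  have b2 := sobSq_coef_mul_le hh hh1 c1 hu hu
  have b3 := sobSq_coef_mul_le hh hh1 c2 hu hv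
  have b4 := sobSq_coef_mul_le hh hh1 c3 hv hv
  have b5 := sobSq_three_eta_le (d := d) hh hh1 hu hv
  have b6 : sobSq d h 3 (gconv h J ((3 / 2 : ℝ) • u - (1 / 2 : ℝ) • u')) ≤
      15 * ((V * M) ^ 2 * N) := by
    refine (sobSq_succ_gconv_le hV hJ _).trans ?_
    have h1 := sobSq_sub_le (d := d) (h := h) (r := 2) ((3 / 2 : ℝ) • u) ((1 / 2 : ℝ) • u')
    rw [sobSq_smul, sobSq_smul] at h1
    calc 3 * (V * M) ^ 2 * sobSq d h 2 ((3 / 2 : ℝ) • u - (1 / 2 : ℝ) • u')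
        ≤ 3 * (V * M) ^ 2 * (5 * N) := by gcongr; linarith
      _ = _ := by ring
  have e1 := sobSq_sub_le (d := d) (h := h) (r := 3) (((1 / 4 : ℝ) • ((Q - P) * (P + Q))) * (v - u)
    - (((1 / 4 : ℝ) • ((3 : ℝ) • P + Q)) * (u * u) + ((1 / 2 : ℝ) • (P + Q)) * (u * v)
      + ((1 / 4 : ℝ) • (P + (3 : ℝ) • Q)) * (v * v))
    + ((1 / 2 : ℝ) • (u * u + v * v)) * ((1 / 2 : ℝ) • (u + v)))
    (gconv h J ((3 / 2 : ℝ) • u - (1 / 2 : ℝ) • u'))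
  have e2 := sobSq_add_le (d := d) (h := h) (r := 3) (((1 / 4 : ℝ) • ((Q - P) * (P + Q))) * (v - u)
    - (((1 / 4 : ℝ) • ((3 : ℝ) • P + Q)) * (u * u) + ((1 / 2 : ℝ) • (P + Q)) * (u * v)
      + ((1 / 4 : ℝ) • (P + (3 : ℝ) • Q)) * (v * v)))
    (((1 / 2 : ℝ) • (u * u + v * v)) * ((1 / 2 : ℝ) • (u + v)))
  have e3 := sobSq_sub_le (d := d) (h := h) (r := 3) (((1 / 4 : ℝ) • ((Q - P) * (P + Q))) * (v - u))
    (((1 / 4 : ℝ) • ((3 : ℝ) • P + Q)) * (u * u) + ((1 / 2 : ℝ) • (P + Q)) * (u * v)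
      + ((1 / 4 : ℝ) • (P + (3 : ℝ) • Q)) * (v * v))
  have e4 := sobSq_add_le (d := d) (h := h) (r := 3)
    (((1 / 4 : ℝ) • ((3 : ℝ) • P + Q)) * (u * u) + ((1 / 2 : ℝ) • (P + Q)) * (u * v))
    (((1 / 4 : ℝ) • (P + (3 : ℝ) • Q)) * (v * v))
  have e5 := sobSq_add_le (d := d) (h := h) (r := 3)
    (((1 / 4 : ℝ) • ((3 : ℝ) • P + Q)) * (u * u)) (((1 / 2 : ℝ) • (P + Q)) * (u * v))
  have hMN : 0 ≤ M ^ 2 * N := by positivity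
  have q1 : M ^ 2 * (sobSq d h 2 u + sobSq d h 2 u) ≤ M ^ 2 * (2 * N) := by gcongr; linarith
  have q2 : M ^ 2 * (sobSq d h 2 u + sobSq d h 2 v) ≤ M ^ 2 * (2 * N) := by gcongr; linarith
  have q3 : M ^ 2 * (sobSq d h 2 v + sobSq d h 2 v) ≤ M ^ 2 * (2 * N) := by gcongr; linarith
  have hKN : 0 ≤ M ^ 4 * K ^ 2 * N := by positivity
  have hVN : 0 ≤ (V * M) ^ 2 * N := by positivity
  unfold forcing
  have q4 : sobSq d h 2 u + sobSq d h 2 v ≤ N := by linarith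
  linarith

end Forcing

/-! ### A discrete Sobolev inequality -/

section SobolevInequality

theorem sum_range_zmod (m : ℕ) [NeZero m] (F : ZMod m → ℝ) :
    ∑ r ∈ Finset.range m, F (r : ZMod m) = ∑ z, F z := by
  refine Finset.sum_nbij' (fun r => (r : ZMod m)) (fun z => z.val) ?_ ?_ ?_ ?_ ?_
  · simp
  · intro z _
    simpa using z.val_lt
  · intro r hr
    exact ZMod.val_cast_of_lt (by simpa using hr)
  · intro z _
    simp
  · simp

/-- Some value is at most the average, and walking around the cycle from there changes the function
by at most its total variation. -/
theorem le_average_add_variation (m : ℕ) [NeZero m] (g : ZMod m → ℝ) (i : ZMod m) :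
    g i ≤ (∑ z, g z) / m + ∑ z, |g (z + 1) - g z| := by
  obtain ⟨j, -, hj⟩ : ∃ j ∈ (Finset.univ : Finset (ZMod m)), g j ≤ (∑ z, g z) / m := by
    apply Finset.exists_le_of_sum_le Finset.univ_nonempty
    have : (m : ℝ) ≠ 0 := Nat.cast_ne_zero.2 (NeZero.ne m)
    simp [ZMod.card]
    field_simp
    rfl
  have h1 : ∀ t : ℕ, g (j + t) - g j ≤ ∑ r ∈ Finset.range t, |g (j + r + 1) - g (j + r)| := by
    intro t
    induction t with
    | zero => simp
    | succ t ih =>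
      rw [Finset.sum_range_succ]
      have := le_abs_self (g (j + t + 1) - g (j + t))
      push_cast
      rw [← add_assoc]
      linarith
  have h2 := h1 (i - j).val
  rw [ZMod.natCast_zmod_val, add_sub_cancel] at h2
  have h3 : ∑ r ∈ Finset.range (i - j).val, |g (j + r + 1) - g (j + r)| ≤
      ∑ r ∈ Finset.range m, |g (j + r + 1) - g (j + r)| :=
    Finset.sum_le_sum_of_subset_of_nonneg
      (Finset.range_subset_range.2 (ZMod.val_lt _).le) fun _ _ _ => abs_nonneg _
  rw [sum_range_zmod m (fun z => |g (j + z + 1) - g (j + z)|)] at h3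
  have h4 : ∑ z, |g (j + z + 1) - g (j + z)| = ∑ z, |g (z + 1) - g z| :=
    Equiv.sum_comp (Equiv.addLeft j) (fun z => |g (z + 1) - g z|)
  linarith

/-- The previous bound is applied to f², whose increments are h times a product of the difference
quotient with a sum of two values. -/
theorem sq_le_sum_zmod {m : ℕ} [NeZero m] {h L : ℝ} (hh : 0 < h) (hL : L = m * h)
    (f : ZMod m → ℝ) (i : ZMod m) :
    f i ^ 2 ≤ h * (1 / L + 2) * ∑ z, (f z ^ 2 + ((f (z + 1) - f z) / h) ^ 2) := by
  have hm : (0 : ℝ) < m := Nat.cast_pos.2 (NeZero.pos m)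
  have hL0 : 0 < L := by rw [hL]; positivity
  have h1 := le_average_add_variation m (fun z => f z ^ 2) i
  have h2 : ∑ z, |f (z + 1) ^ 2 - f z ^ 2| ≤
      ∑ z, h * (f (z + 1) ^ 2 + f z ^ 2 + ((f (z + 1) - f z) / h) ^ 2) := by
    refine Finset.sum_le_sum fun z _ => ?_
    set q := (f (z + 1) - f z) / h with hq
    have e : f (z + 1) = f z + h * q := by rw [hq]; field_simp; ring
    have e2 : f (z + 1) ^ 2 - f z ^ 2 = h * (q * (f (z + 1) + f z)) := by rw [e]; ring
    rw [e2, abs_mul, abs_of_pos hh]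
    refine mul_le_mul_of_nonneg_left ?_ hh.le
    rw [abs_le]
    constructor <;> nlinarith [sq_nonneg (q + (f (z + 1) + f z) / 2),
      sq_nonneg (q - (f (z + 1) + f z) / 2), sq_nonneg (f (z + 1) - f z),
      sq_nonneg (f (z + 1) + f z), sq_nonneg (f (z + 1)), sq_nonneg (f z), sq_nonneg q]
  have h3 : ∑ z, f (z + 1) ^ 2 = ∑ z, f z ^ 2 :=
    Equiv.sum_comp (Equiv.addRight (1 : ZMod m)) (fun z => f z ^ 2)
  rw [← Finset.mul_sum, Finset.sum_add_distrib, Finset.sum_add_distrib, h3] at h2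
  rw [Finset.sum_add_distrib]
  have h4 : (∑ z, f z ^ 2) / m = h * (1 / L) * ∑ z, f z ^ 2 := by
    rw [hL]; field_simp
  have h5 : 0 ≤ h * (1 / L + 1) * ∑ z, ((f (z + 1) - f z) / h) ^ 2 :=
    mul_nonneg (by positivity) (Finset.sum_nonneg fun _ _ => sq_nonneg _)
  rw [h4] at h1
  linarith

/-- The unit steps of the grid `ZMod m × ZMod n`. -/
def gridStep (m n : ℕ) : Bool → ZMod m × ZMod n := fun b => cond b (0, 1) (1, 0)

/-- The one-dimensional inequality is used in each direction in turn; of the second order quotients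
only the mixed one is needed. The factor h² supplies the weight missing in the unweighted norm. -/
theorem sq_le_sobSq_two {m n : ℕ} [NeZero m] [NeZero n] {h L₁ L₂ : ℝ} (hh : 0 < h)
    (hL₁ : L₁ = m * h) (hL₂ : L₂ = n * h) (u : ZMod m × ZMod n → ℝ) (a : ZMod m × ZMod n) :
    u a ^ 2 ≤ h ^ 2 * ((1 / L₁ + 2) * (1 / L₂ + 2)) * sobSq (gridStep m n) h 2 u := by
  obtain ⟨i, j⟩ := a
  have hm : (0 : ℝ) < m := Nat.cast_pos.2 (NeZero.pos m)
  have hn : (0 : ℝ) < n := Nat.cast_pos.2 (NeZero.pos n)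
  have hL₁0 : 0 < L₁ := by rw [hL₁]; positivity
  have hL₂0 : 0 < L₂ := by rw [hL₂]; positivity
  have h1 : ∀ (v : ZMod m × ZMod n → ℝ) (i : ZMod m) (j : ZMod n),
      v (i, j) ^ 2 ≤ h * (1 / L₂ + 2) *
        ∑ z, (v (i, z) ^ 2 + dq (gridStep m n) h true v (i, z) ^ 2) := by
    intro v i j
    have := sq_le_sum_zmod hh hL₂ (fun z => v (i, z)) j
    simpa [dq_apply, gridStep] using this
  have h2 := sq_le_sum_zmod hh hL₁ (fun z => u (z, j)) i
  have h3 : ∑ z, (u (z, j) ^ 2 + ((u (z + 1, j) - u (z, j)) / h) ^ 2) ≤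
      ∑ z, (h * (1 / L₂ + 2) * ∑ y, (u (z, y) ^ 2 + dq (gridStep m n) h true u (z, y) ^ 2)
        + h * (1 / L₂ + 2) * ∑ y, (dq (gridStep m n) h false u (z, y) ^ 2
          + dq (gridStep m n) h true (dq (gridStep m n) h false u) (z, y) ^ 2)) := by
    refine Finset.sum_le_sum fun z _ => add_le_add (h1 u z j) ?_
    have := h1 (dq (gridStep m n) h false u) z j
    have e : dq (gridStep m n) h false u (z, j) = (u (z + 1, j) - u (z, j)) / h := by
      simp [dq_apply, gridStep]
    rwa [e] at this
  have h4 : ∀ v : ZMod m × ZMod n → ℝ, ∑ z, ∑ y, v (z, y) ^ 2 = sqNorm v := fun v => by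
    rw [sqNorm, Fintype.sum_prod_type]
  simp only [Finset.sum_add_distrib, ← Finset.mul_sum, h4] at h3
  have h5 : sqNorm u + sqNorm (dq (gridStep m n) h true u) + (sqNorm (dq (gridStep m n) h false u)
      + sqNorm (dq (gridStep m n) h true (dq (gridStep m n) h false u))) ≤
      sobSq (gridStep m n) h 2 u := by
    rw [sobSq_succ, Fintype.sum_bool, sobSq_succ, sobSq_succ, Fintype.sum_bool, Fintype.sum_bool]
    simp only [sobSq_zero]
    have := fun v : ZMod m × ZMod n → ℝ => sqNorm_nonneg v
    linarith [this (dq (gridStep m n) h true (dq (gridStep m n) h true u)),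
      this (dq (gridStep m n) h false (dq (gridStep m n) h true u)),
      this (dq (gridStep m n) h false (dq (gridStep m n) h false u))]
  calc u (i, j) ^ 2 ≤ h * (1 / L₁ + 2) * (h * (1 / L₂ + 2) * sobSq (gridStep m n) h 2 u) := by
        refine h2.trans (mul_le_mul_of_nonneg_left ?_ (by positivity))
        rw [Finset.sum_add_distrib]
        refine h3.trans ?_
        rw [← mul_add]
        exact mul_le_mul_of_nonneg_left h5 (by positivity)
    _ = _ := by ring

end SobolevInequality

/-! ### A rough bound on one step by the maximum principle -/

section MaximumPrinciple

variable {A : Type*} [AddCommGroup A] [Fintype A] {d : Bool → A} {h : ℝ}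

/-- The discrete Laplacian is non-positive at a maximum point. -/
theorem exists_max_le_of_step {s : ℝ} (hs : 0 ≤ s) {v f ζ : A → ℝ}
    (heq : v - f = s • lap d h ζ) : ∃ x₀, (∀ x, ζ x ≤ ζ x₀) ∧ v x₀ ≤ f x₀ := by
  obtain ⟨x₀, hx₀⟩ := Finite.exists_max ζ
  refine ⟨x₀, hx₀, ?_⟩
  have h1 := congrFun heq x₀
  have h2 : lap d h ζ x₀ ≤ 0 := by
    rw [lap_apply]
    refine Finset.sum_nonpos fun b _ => div_nonpos_of_nonpos_of_nonneg ?_ (sq_nonneg h)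
    linarith [hx₀ (x₀ + d b), hx₀ (x₀ - d b)]
  simp only [Pi.sub_apply, Pi.smul_apply, smul_eq_mul] at h1
  linarith [mul_nonpos_of_nonneg_of_nonpos hs h2]

/-- The factor of z is a square plus a positive definite quadratic form, which displays the
monotonicity of `eta p`. -/
theorem eta_sub_right (p q z : ℝ) : eta p q - eta p (q - z) =
    1 / 4 * ((p + (q + (q - z)) / 2) ^ 2 + (3 / 4 * (q - z) ^ 2 + 1 / 2 * q * (q - z)
      + 3 / 4 * q ^ 2)) * z := by
  unfold eta
  ring

/-- The flux has the form ζ = (κ + Bc/2) v + q with κ ≥ 0 and q = O(ρ). At its maximum point v is at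
most 2ρ, so ζ is O(ρ) from above there and hence everywhere; the slope of at least α/2 carries this
back to v. Neither s nor h enters the constant. -/
theorem rough_upper_bound {s α M Bc Be ρ : ℝ} (hs : 0 ≤ s) (hα : 0 < α) (hM : 1 ≤ M)
    (hBe : 0 ≤ Be) (hBe' : Be ≤ M) (hBc : Bc ≤ M) (hB : α ≤ Bc - 3 * Be) (hρ : ρ ≤ 1)
    {P Q u u' v τ : A → ℝ} {S : (A → ℝ) →ₗ[ℝ] (A → ℝ)}
    (hS : ∀ f : A → ℝ, ∀ ρ, (∀ x, |f x| ≤ ρ) → ∀ x, |S f x| ≤ M * ρ)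
    (hP : ∀ x, |P x| ≤ M) (hQ : ∀ x, |Q x| ≤ M) (hu : ∀ x, |u x| ≤ ρ) (hu' : ∀ x, |u' x| ≤ ρ)
    (hτ : ∀ x, |s * τ x| ≤ ρ)
    (heq : v - u = s • lap d h ((fun x => eta (P x) (Q x) - eta (P x - u x) (Q x - v x))
      + Bc • ((1 / 2 : ℝ) • (v + u)) - Be • ((3 / 2 : ℝ) • u - (1 / 2 : ℝ) • u')
      - S ((3 / 2 : ℝ) • u - (1 / 2 : ℝ) • u')) + s • τ) (x : A) :
    v x ≤ 64 * M ^ 2 / α * ρ := by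
  have hρ0 : 0 ≤ ρ := (abs_nonneg _).trans (hu 0)
  set e := (3 / 2 : ℝ) • u - (1 / 2 : ℝ) • u' with he
  set ζ := (fun x => eta (P x) (Q x) - eta (P x - u x) (Q x - v x))
      + Bc • ((1 / 2 : ℝ) • (v + u)) - Be • e - S e with hζ
  have he1 : ∀ x, |e x| ≤ 2 * ρ := fun x => by
    have h1 := abs_le.1 (hu x)
    have h2 := abs_le.1 (hu' x)
    simp only [he, Pi.sub_apply, Pi.smul_apply, smul_eq_mul]
    rw [abs_le]
    constructor <;> linarith
  obtain ⟨x₀, hx₀, hv⟩ := exists_max_le_of_step (v := v) (f := u + s • τ) (ζ := ζ) (d := d)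
    (h := h) hs (by rw [← sub_sub, heq]; abel)
  set κ : A → ℝ := fun x => 1 / 4 * ((P x - u x + (Q x + (Q x - v x)) / 2) ^ 2
    + (3 / 4 * (Q x - v x) ^ 2 + 1 / 2 * Q x * (Q x - v x) + 3 / 4 * Q x ^ 2)) with hκ
  set q : A → ℝ := fun x => (eta (P x) (Q x) - eta (P x - u x) (Q x)) + Bc * (1 / 2 * u x)
    - Be * e x - S e x with hq
  have hζx : ∀ x, ζ x = (κ x + Bc / 2) * v x + q x := fun x => by
    have h1 := eta_sub_right (P x - u x) (Q x) (v x)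
    simp only [hζ, Pi.sub_apply, Pi.add_apply, Pi.smul_apply, smul_eq_mul, hκ, hq]
    linear_combination h1
  have hκ0 : ∀ x, 0 ≤ κ x := fun x => by
    simp only [hκ]
    nlinarith [sq_nonneg (P x - u x + (Q x + (Q x - v x)) / 2), sq_nonneg (Q x + (Q x - v x)),
      sq_nonneg (Q x), sq_nonneg (Q x - v x)]
  have hqx : ∀ x, |q x| ≤ 8 * M ^ 2 * ρ := fun x => by
    have h1 : |eta (P x) (Q x) - eta (P x - u x) (Q x)| ≤ 3 * M ^ 2 * ρ := by
      have e1 : eta (P x) (Q x) - eta (P x - u x) (Q x) =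
          1 / 4 * (Q x * Q x + 2 * (Q x * P x) - Q x * u x + 3 * (P x * P x) - 3 * (P x * u x)
            + u x * u x) * u x := by
        unfold eta; ring
      have hm : ∀ {y z a b : ℝ}, |y| ≤ a → |z| ≤ b → |y * z| ≤ a * b := fun hy hz => by
        rw [abs_mul]
        exact mul_le_mul hy hz (abs_nonneg _) ((abs_nonneg _).trans hy)
      have hu1 : |u x| ≤ 1 := (hu x).trans hρ
      have b1 := abs_le.1 (hm (hQ x) (hQ x))
      have b2 := abs_le.1 (hm (hQ x) (hP x))
      have b3 := abs_le.1 (hm (hQ x) hu1)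
      have b4 := abs_le.1 (hm (hP x) (hP x))
      have b5 := abs_le.1 (hm (hP x) hu1)
      have b6 := abs_le.1 (hm hu1 hu1)
      have hM1 : M ≤ M * M := le_mul_of_one_le_left (by linarith) hM
      rw [e1]
      refine hm ?_ (hu x)
      rw [abs_le]
      constructor <;> linarith
    have h2 : |Bc * (1 / 2 * u x)| ≤ M * ρ := by
      rw [abs_mul]
      refine mul_le_mul ?_ ?_ (abs_nonneg _) (by linarith)
      · rw [abs_of_nonneg (by linarith)]; exact hBc
      · rw [abs_mul, abs_of_pos (by norm_num)]; linarith [abs_nonneg (u x), hu x]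
    have h3 : |Be * e x| ≤ M * (2 * ρ) := by
      rw [abs_mul, abs_of_nonneg hBe]
      exact mul_le_mul hBe' (he1 x) (abs_nonneg _) (by linarith)
    have h4 := hS e (2 * ρ) he1 x
    have h5 : M * ρ ≤ M ^ 2 * ρ := by
      refine mul_le_mul_of_nonneg_right ?_ hρ0
      nlinarith
    rw [abs_le] at h1 h2 h3 h4 ⊢
    simp only [hq]
    constructor <;> linarith
  have hv0 : v x₀ ≤ 2 * ρ := by
    have h1 := le_of_abs_le (hu x₀)
    have h2 := le_of_abs_le (hτ x₀)
    simp only [Pi.add_apply, Pi.smul_apply, smul_eq_mul] at hv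
    linarith
  have hBc0 : α ≤ Bc := by linarith
  have hmax : ζ x₀ ≤ 24 * M ^ 2 * ρ := by
    rw [hζx]
    have h1 := le_of_abs_le (hqx x₀)
    have hMρ : 0 ≤ M ^ 2 * ρ := by positivity
    -- The coefficient κ depends on v and has no a priori upper bound. One is needed only if v is
    -- positive at the maximum point, and there 0 ≤ v ≤ 2ρ provides it.
    rcases le_total (v x₀) 0 with hneg | hpos
    · have : (κ x₀ + Bc / 2) * v x₀ ≤ 0 :=
        mul_nonpos_of_nonneg_of_nonpos (by linarith [hκ0 x₀]) hneg
      linarith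
    · have hκM : κ x₀ ≤ 7 * M ^ 2 := by
        have hu1 := abs_le.1 ((hu x₀).trans hρ)
        have hP1 := abs_le.1 (hP x₀)
        have hQ1 := abs_le.1 (hQ x₀)
        have k1 : (P x₀ - u x₀ + (Q x₀ + (Q x₀ - v x₀)) / 2) ^ 2 ≤ (4 * M) ^ 2 :=
          sq_le_sq' (by linarith) (by linarith)
        have k2 : (Q x₀ - v x₀) ^ 2 ≤ (3 * M) ^ 2 := sq_le_sq' (by linarith) (by linarith)
        have k3 : Q x₀ ^ 2 ≤ M ^ 2 := sq_le_sq' (by linarith) (by linarith)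
        have k4 : Q x₀ * (Q x₀ - v x₀) ≤ 3 * M ^ 2 := by
          have := abs_mul (Q x₀) (Q x₀ - v x₀)
          have k5 : |Q x₀ - v x₀| ≤ 3 * M := abs_le.2 ⟨by linarith, by linarith⟩
          have := mul_le_mul (hQ x₀) k5 (abs_nonneg _) (by linarith)
          linarith [le_abs_self (Q x₀ * (Q x₀ - v x₀))]
        simp only [hκ]
        linarith [sq_nonneg M]
      have hM2 : M ≤ M ^ 2 := by nlinarith
      have : (κ x₀ + Bc / 2) * v x₀ ≤ (8 * M ^ 2) * (2 * ρ) :=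
        mul_le_mul (by linarith) hv0 hpos (by positivity)
      linarith
  have hx := hx₀ x
  have hqx' := neg_le_of_abs_le (hqx x)
  rw [hζx] at hx
  rcases le_total (v x) 0 with hneg | hpos
  · exact hneg.trans (by positivity)
  · have h1 : α / 2 * v x ≤ (κ x + Bc / 2) * v x :=
      mul_le_mul_of_nonneg_right (by linarith [hκ0 x]) hpos
    have h2 : α / 2 * v x ≤ 32 * M ^ 2 * ρ := by linarith
    rw [div_mul_eq_mul_div, le_div_iff₀ hα]
    linarith

/-- The lower bound is the upper bound for the negated data, because `eta` is odd. -/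
theorem rough_bound {s α M Bc Be ρ : ℝ} (hs : 0 ≤ s) (hα : 0 < α) (hM : 1 ≤ M)
    (hBe : 0 ≤ Be) (hBe' : Be ≤ M) (hBc : Bc ≤ M) (hB : α ≤ Bc - 3 * Be) (hρ : ρ ≤ 1)
    {P Q u u' v τ : A → ℝ} {S : (A → ℝ) →ₗ[ℝ] (A → ℝ)}
    (hS : ∀ f : A → ℝ, ∀ ρ, (∀ x, |f x| ≤ ρ) → ∀ x, |S f x| ≤ M * ρ)
    (hP : ∀ x, |P x| ≤ M) (hQ : ∀ x, |Q x| ≤ M) (hu : ∀ x, |u x| ≤ ρ) (hu' : ∀ x, |u' x| ≤ ρ)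
    (hτ : ∀ x, |s * τ x| ≤ ρ)
    (heq : v - u = s • lap d h ((fun x => eta (P x) (Q x) - eta (P x - u x) (Q x - v x))
      + Bc • ((1 / 2 : ℝ) • (v + u)) - Be • ((3 / 2 : ℝ) • u - (1 / 2 : ℝ) • u')
      - S ((3 / 2 : ℝ) • u - (1 / 2 : ℝ) • u')) + s • τ) (x : A) :
    |v x| ≤ 64 * M ^ 2 / α * ρ := by
  refine abs_le.2 ⟨?_, rough_upper_bound hs hα hM hBe hBe' hBc hB hρ hS hP hQ hu hu' hτ heq x⟩
  have h1 := rough_upper_bound (d := d) (h := h) (P := -P) (Q := -Q) (u := -u) (u' := -u')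
    (v := -v) (τ := -τ) hs hα hM hBe hBe' hBc hB hρ hS (by simpa using hP) (by simpa using hQ)
    (by simpa using hu) (by simpa using hu') (by simpa using hτ) ?_ x
  · rw [Pi.neg_apply] at h1
    linarith
  · rw [neg_sub_neg, ← neg_sub, heq, neg_add, ← smul_neg, ← map_neg, ← smul_neg]
    congr 3
    have e1 : (3 / 2 : ℝ) • -u - (1 / 2 : ℝ) • -u' = -((3 / 2 : ℝ) • u - (1 / 2 : ℝ) • u') := by
      simp only [smul_neg]; abel
    rw [e1, map_neg]
    ext y
    simp only [Pi.neg_apply, Pi.sub_apply, Pi.add_apply, Pi.smul_apply, smul_eq_mul, eta]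
    ring

end MaximumPrinciple

/-! ### A discrete Gronwall inequality -/

/-- The bound on `E 1` is a separate hypothesis since the first step has a larger truncation error.
The implicit term is absorbed by (1 + 3x) ≤ (1 + 8x)(1 - x) for 0 ≤ x ≤ 1/8. -/
theorem gronwall_three_term {E : ℕ → ℝ} {c s X : ℝ} {N : ℕ} (hc : 0 ≤ c) (hs : 0 ≤ s)
    (hcs : c * s ≤ 1 / 8) (hX : 0 ≤ X) (h0 : E 0 ≤ X) (h1 : 1 ≤ N → E 1 ≤ X)
    (hE : ∀ k, 1 ≤ k → k + 1 ≤ N →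
      E (k + 1) ≤ E k + c * s * (E (k + 1) + E k + E (k - 1)) + c * s * X) :
    ∀ l, l ≤ N → E l ≤ X * Real.exp (8 * c * (l * s)) := by
  have hcs0 : 0 ≤ c * s := mul_nonneg hc hs
  have key : ∀ l, l ≤ N → E l ≤ X * (1 + 8 * (c * s)) ^ l := by
    intro l
    induction l using Nat.strong_induction_on with
    | _ l ih =>
      intro hl
      rcases l with _ | _ | k
      · simpa using h0
      · refine (h1 hl).trans (le_mul_of_one_le_right hX ?_)
        rw [zero_add, pow_one]
        linarith
      · have e1 := ih (k + 1) (by omega) (by omega)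
        have e0 := ih k (by omega) (by omega)
        have e2 := hE (k + 1) (by omega) hl
        rw [Nat.add_sub_cancel] at e2
        set Y := X * (1 + 8 * (c * s)) ^ (k + 1) with hY
        have hY0 : 0 ≤ Y := by positivity
        have e3 : X * (1 + 8 * (c * s)) ^ k ≤ Y := by
          rw [hY]
          gcongr
          · linarith
          · omega
        have e4 : X ≤ Y := le_mul_of_one_le_right hX (one_le_pow₀ (by linarith))
        have e5 : E (k + 1 + 1) * (1 - c * s) ≤ Y * (1 + 3 * (c * s)) := by
          have a1 : c * s * E (k + 1) ≤ c * s * Y := mul_le_mul_of_nonneg_left e1 hcs0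
          have a2 : c * s * E k ≤ c * s * Y := mul_le_mul_of_nonneg_left (e0.trans e3) hcs0
          have a3 : c * s * X ≤ c * s * Y := mul_le_mul_of_nonneg_left e4 hcs0
          linarith
        have e6 : Y * (1 + 3 * (c * s)) ≤ Y * (1 + 8 * (c * s)) * (1 - c * s) := by
          rw [mul_assoc Y (1 + 8 * (c * s))]
          refine mul_le_mul_of_nonneg_left ?_ hY0
          nlinarith
        have e7 : X * (1 + 8 * (c * s)) ^ (k + 1 + 1) = Y * (1 + 8 * (c * s)) := by
          rw [hY, pow_succ (1 + 8 * (c * s)) (k + 1)]; ring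
        rw [e7]
        exact le_of_mul_le_mul_right (e5.trans e6) (by linarith)
  intro l hl
  refine (key l hl).trans (mul_le_mul_of_nonneg_left ?_ hX)
  calc (1 + 8 * (c * s)) ^ l ≤ Real.exp (8 * (c * s)) ^ l := by
        refine pow_le_pow_left₀ (by positivity) ?_ l
        linarith [Real.add_one_le_exp (8 * (c * s))]
    _ = Real.exp (8 * c * (l * s)) := by rw [← Real.exp_nat_mul]; ring_nf

/-! ### Stability: from consistency to convergence in the maximum norm -/

section Stability

/-- The discrete error equation on the time levels up to `T`: the errors `e k`, the exact values
`P k` and the truncation errors `τ k` on a periodic grid. -/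
structure IsErrorSequence {A : Type*} [AddCommGroup A] [Fintype A] (d : Bool → A)
    (M K T h s Bc Be : ℝ) (J : A → ℝ) (P e τ : ℕ → A → ℝ) : Prop where
  kernel_bdd : DqBdd d h 1 M J
  exact_bdd : ∀ k : ℕ, k * s ≤ T → DqBdd d h 3 M (P k)
  exact_diff_bdd : ∀ k : ℕ, (k + 1 : ℕ) * s ≤ T → DqBdd d h 3 (M * s) (P (k + 1) - P k)
  trunc_zero_bdd : s ≤ T → DqBdd d h 2 (M * (s + h ^ 2)) (τ 0)
  trunc_bdd : ∀ k : ℕ, 1 ≤ k → (k + 1 : ℕ) * s ≤ T → DqBdd d h 2 (M * (s ^ 2 + h ^ 2)) (τ k)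
  initial : e 0 = 0
  step : ∀ k : ℕ, (k + 1 : ℕ) * s ≤ T → e (k + 1) - e k =
    s • lap d h ((fun x => eta (P k x) (P (k + 1) x) - eta (P k x - e k x) (P (k + 1) x - e (k + 1) x))
      + Bc • ((1 / 2 : ℝ) • (e (k + 1) + e k))
      - Be • ((3 / 2 : ℝ) • e k - (1 / 2 : ℝ) • e (k - 1))
      - gconv h J ((3 / 2 : ℝ) • e k - (1 / 2 : ℝ) • e (k - 1))) + s • τ k

variable {A : Type*} [AddCommGroup A] [Fintype A] {d : Bool → A}
  {M K T h s Bc Be α V : ℝ} {J : A → ℝ} {P e τ : ℕ → A → ℝ}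

theorem level_le_of_succ {k : ℕ} (hs : 0 ≤ s) (hk : (k + 1 : ℕ) * s ≤ T) : k * s ≤ T := by
  push_cast at hk
  linarith

/-- The increment of the energy of the error in one step. -/
theorem IsErrorSequence.energy_step (H : IsErrorSequence d M K T h s Bc Be J P e τ)
    (hh : 0 < h) (hh1 : h ≤ 1) (hs : 0 ≤ s) (hsK : s ≤ K * h) (hα : 0 < α) (hBe : 0 ≤ Be)
    (hB : α ≤ Bc - 3 * Be) (hV : h ^ 2 * Fintype.card A = V) {μ : ℝ} (hμ : 0 < μ) {k : ℕ}
    (hk : (k + 1 : ℕ) * s ≤ T) (hu : ∀ x, |e k x| ≤ h) (hv : ∀ x, |e (k + 1) x| ≤ h) :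
    sobEnergy d h s Be (e (k + 1)) (e k) ≤ sobEnergy d h s Be (e k) (e (k - 1))
      + (18434 * (24 * M ^ 2) ^ 2 / α + 18 / α * (2 * (10 ^ 8 * M ^ 4 * K ^ 2 + 10 ^ 9 * M ^ 2
        + 10 ^ 9 + 1000 * (V * M) ^ 2))) * s *
        (sobEnergy d h s Be (e (k + 1)) (e k) + sobEnergy d h s Be (e k) (e (k - 1))
          + sobEnergy d h s Be (e (k - 1)) (e (k - 1 - 1)))
      + (s ^ 2 / (4 * μ) * sobSq d h 2 (τ k) + μ *
        (sobEnergy d h s Be (e (k + 1)) (e k) + sobEnergy d h s Be (e k) (e (k - 1)))) := by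
  have hP := H.exact_bdd k (level_le_of_succ hs hk)
  have hQ := H.exact_bdd (k + 1) hk
  set a : A → ℝ := P k * P k + P k * P (k + 1) + P (k + 1) * P (k + 1) with ha
  have ha0 : ∀ x, 0 ≤ a x := fun x => by
    simp only [ha, Pi.add_apply, Pi.mul_apply]
    nlinarith [sq_nonneg (P k x + P (k + 1) x), sq_nonneg (P k x), sq_nonneg (P (k + 1) x)]
  have haM : DqBdd d h 3 (24 * M ^ 2) a :=
    (((hP.mul hP).add (hP.mul hQ)).add (hQ.mul hQ)).mono_const (by ring_nf; rfl)
  have heq : e (k + 1) - e k = s • lap d h (a * ((1 / 2 : ℝ) • (e (k + 1) + e k))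
      + Bc • ((1 / 2 : ℝ) • (e (k + 1) + e k))
      - Be • ((3 / 2 : ℝ) • e k - (1 / 2 : ℝ) • e (k - 1))
      + forcing h J (P k) (P (k + 1)) (e (k + 1)) (e k) (e (k - 1))) + s • τ k := by
    rw [H.step k hk]
    congr 3
    ext x
    have := eta_sub_eta (P k x) (P (k + 1) x) (e k x) (e (k + 1) x)
    simp only [forcing, ha, Pi.add_apply, Pi.sub_apply, Pi.mul_apply, Pi.smul_apply, smul_eq_mul]
    linear_combination this
  have h1 := sobEnergy_step hs hα hBe hB hμ ha0 haM heq
  have h2 := sobSq_forcing_le (u' := e (k - 1)) hh hh1 hs hsK hV H.kernel_bdd hP hQ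
    (H.exact_diff_bdd k hk) hu hv
  set E1 := sobEnergy d h s Be (e (k + 1)) (e k) with hE1
  set E0 := sobEnergy d h s Be (e k) (e (k - 1)) with hE0
  set Em := sobEnergy d h s Be (e (k - 1)) (e (k - 1 - 1)) with hEm
  have n1 : sobSq d h 2 (e (k + 1)) ≤ 2 * E1 := sobSq_le_sobEnergy hs hBe _ _
  have n0 : sobSq d h 2 (e k) ≤ 2 * E0 := sobSq_le_sobEnergy hs hBe _ _
  have nm : sobSq d h 2 (e (k - 1)) ≤ 2 * Em := sobSq_le_sobEnergy hs hBe _ _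
  have hE1' : 0 ≤ E1 := sobEnergy_nonneg hs hBe _ _
  have hE0' : 0 ≤ E0 := sobEnergy_nonneg hs hBe _ _
  have hEm' : 0 ≤ Em := sobEnergy_nonneg hs hBe _ _
  have nb : sobSq d h 2 ((1 / 2 : ℝ) • (e (k + 1) + e k)) ≤ E1 + E0 := by
    rw [sobSq_smul]
    linarith [sobSq_add_le (d := d) (h := h) (r := 2) (e (k + 1)) (e k)]
  set Cf := 10 ^ 8 * M ^ 4 * K ^ 2 + 10 ^ 9 * M ^ 2 + 10 ^ 9 + 1000 * (V * M) ^ 2 with hCf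
  have hCf0 : 0 ≤ Cf := by positivity
  have nf : sobSq d h 3 (forcing h J (P k) (P (k + 1)) (e (k + 1)) (e k) (e (k - 1))) ≤
      2 * Cf * (E1 + E0 + Em) := by
    refine h2.trans ?_
    calc Cf * (sobSq d h 2 (e (k + 1)) + sobSq d h 2 (e k) + sobSq d h 2 (e (k - 1)))
        ≤ Cf * (2 * (E1 + E0 + Em)) := by gcongr; linarith
      _ = _ := by ring
  have k1 : 18434 * (24 * M ^ 2) ^ 2 / α * sobSq d h 2 ((1 / 2 : ℝ) • (e (k + 1) + e k)) ≤
      18434 * (24 * M ^ 2) ^ 2 / α * (E1 + E0 + Em) := by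
    gcongr
    linarith
  have k2 : 18 / α * sobSq d h 3 (forcing h J (P k) (P (k + 1)) (e (k + 1)) (e k) (e (k - 1))) ≤
      18 / α * (2 * Cf * (E1 + E0 + Em)) := by gcongr
  have k3 : μ * sobSq d h 2 ((1 / 2 : ℝ) • (e (k + 1) + e k)) ≤ μ * (E1 + E0) := by gcongr
  have k4 := mul_le_mul_of_nonneg_left (add_le_add k1 k2) hs
  linarith

set_option maxHeartbeats 1000000 in
/-- The energy of the error is of the optimal order as long as the error is at most `h`. -/
theorem exists_energy_bound (M K T α V : ℝ) (hα : 0 < α) :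
    ∃ C > 0, ∃ s₀ > 0, ∀ {A : Type} [AddCommGroup A] [Fintype A] (d : Bool → A) (h s Bc Be : ℝ)
      (J : A → ℝ) (P e τ : ℕ → A → ℝ), IsErrorSequence d M K T h s Bc Be J P e τ →
      0 < h → h ≤ 1 → 0 < s → s ≤ s₀ → s ≤ K * h → 0 ≤ Be → α ≤ Bc - 3 * Be →
      h ^ 2 * Fintype.card A = V →
      ∀ l : ℕ, l * s ≤ T → (∀ j ≤ l, ∀ x, |e j x| ≤ h) →
        sobSq d h 2 (e l) ≤ C * (Fintype.card A * (h ^ 2 + s ^ 2) ^ 2) := by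
  set c₀ := 18434 * (24 * M ^ 2) ^ 2 / α + 18 / α * (2 * (10 ^ 8 * M ^ 4 * K ^ 2 + 10 ^ 9 * M ^ 2
    + 10 ^ 9 + 1000 * (V * M) ^ 2)) with hc₀
  have hc₀0 : 0 ≤ c₀ := by positivity
  -- The additional 1 takes up the Young term with weight μ = s in the later steps.
  set c := c₀ + 1 with hc
  have hc1 : 1 ≤ c := by linarith
  clear_value c₀
  refine ⟨2 * (18 * (M ^ 2 + 1)) * Real.exp (8 * c * T), by positivity, min 1 (1 / (8 * c)),
    by positivity, ?_⟩
  intro A _ _ d h s Bc Be J P e τ H hh hh1 hs hs₀ hsK hBe hB hV l hl hle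
  have hs1 : s ≤ 1 := hs₀.trans (min_le_left _ _)
  have hcs : c * s ≤ 1 / 8 := by
    have := hs₀.trans (min_le_right _ _)
    rw [le_div_iff₀ (by positivity)] at this
    linarith
  set E : ℕ → ℝ := fun k => sobEnergy d h s Be (e k) (e (k - 1)) with hE
  have hEn : ∀ k, 0 ≤ E k := fun k => sobEnergy_nonneg hs.le hBe _ _
  set ε := h ^ 2 + s ^ 2 with hε
  set X := 18 * (M ^ 2 + 1) * (Fintype.card A * ε ^ 2) with hX
  have hX0 : 0 ≤ X := by positivity
  have hE0 : E 0 = 0 := by simp only [hE, H.initial, Nat.zero_sub, sobEnergy_zero]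
  have hlev : ∀ k, k ≤ l → (k : ℝ) * s ≤ T := fun k hk =>
    le_trans (mul_le_mul_of_nonneg_right (Nat.cast_le.2 hk) hs.le) hl
  have hG := gronwall_three_term (E := E) (c := c) (s := s) (X := X) (N := l) (by linarith) hs.le
    hcs hX0 (hE0.le.trans hX0) ?_ ?_ l le_rfl
  · have h1 : sobSq d h 2 (e l) ≤ 2 * E l := sobSq_le_sobEnergy hs.le hBe _ _
    have h2 : Real.exp (8 * c * (l * s)) ≤ Real.exp (8 * c * T) := by
      apply Real.exp_le_exp.2
      exact mul_le_mul_of_nonneg_left hl (by linarith)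
    calc sobSq d h 2 (e l) ≤ 2 * (X * Real.exp (8 * c * (l * s))) := by linarith
      _ ≤ 2 * (X * Real.exp (8 * c * T)) := by gcongr
      _ = _ := by rw [hX]; ring
  · intro hl1
    have hk := hlev 1 hl1
    -- In the first step a fixed weight allows E 1 to be absorbed on the left, while the square of s
    -- τ^0 = O(s² + s h²) is already of the optimal order.
    have h1 := H.energy_step hh hh1 hs.le hsK hα hBe hB hV (μ := 1 / 4) (by norm_num) (k := 0)
      (by simpa using hk) (hle 0 (Nat.zero_le _)) (hle 1 hl1)
    have h2 : E (0 + 1) ≤ E 0 + c₀ * s * (E (0 + 1) + E 0 + E 0)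
      + (s ^ 2 / (4 * (1 / 4)) * sobSq d h 2 (τ 0) + 1 / 4 * (E (0 + 1) + E 0)) := by
      rw [hc₀]
      exact h1
    rw [hE0, zero_add] at h2
    have h3 := sobSq_le_of_dqBdd (H.trunc_zero_bdd (by simpa using hk))
    have h4 : s ^ 2 * sobSq d h 2 (τ 0) ≤ 9 * M ^ 2 * (Fintype.card A * ε ^ 2) := by
      calc s ^ 2 * sobSq d h 2 (τ 0)
          ≤ s ^ 2 * (3 ^ 2 * (Fintype.card A * (M * (s + h ^ 2)) ^ 2)) := by gcongr
        _ = 9 * M ^ 2 * (Fintype.card A * (s ^ 2 + s * h ^ 2) ^ 2) := by ring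
        _ ≤ 9 * M ^ 2 * (Fintype.card A * ε ^ 2) := by
          gcongr
          rw [hε]
          linarith [mul_le_of_le_one_left (sq_nonneg h) hs1]
    have h5 : c₀ * s * E 1 ≤ 1 / 8 * E 1 :=
      mul_le_mul_of_nonneg_right (by linarith) (hEn 1)
    have h6 : 0 ≤ (Fintype.card A * ε ^ 2 : ℝ) := by positivity
    have h7 : 0 ≤ M ^ 2 * (Fintype.card A * ε ^ 2 : ℝ) := by positivity
    linarith [hEn 1]
  · intro k hk1 hkl
    have hk := hlev (k + 1) hkl
    -- Here μ = s, so both the truncation term and the energy term carry the factor s that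
    -- Gronwall's inequality requires.
    have h1 := H.energy_step hh hh1 hs.le hsK hα hBe hB hV hs hk (hle k (by omega))
      (hle (k + 1) hkl)
    have h2 : E (k + 1) ≤ E k + c₀ * s * (E (k + 1) + E k + E (k - 1))
      + (s ^ 2 / (4 * s) * sobSq d h 2 (τ k) + s * (E (k + 1) + E k)) := by
      rw [hc₀]
      exact h1
    have h3 := sobSq_le_of_dqBdd (H.trunc_bdd k hk1 hk)
    have h4 : s ^ 2 / (4 * s) * sobSq d h 2 (τ k) ≤ s * X := by
      calc s ^ 2 / (4 * s) * sobSq d h 2 (τ k)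
          ≤ s ^ 2 / (4 * s) * (3 ^ 2 * (Fintype.card A * (M * (s ^ 2 + h ^ 2)) ^ 2)) := by gcongr
        _ = s * (9 / 4 * M ^ 2 * (Fintype.card A * ε ^ 2)) := by
          rw [hε]; field_simp; ring
        _ ≤ s * X := by
          rw [hX]
          gcongr
          all_goals linarith [sq_nonneg M]
    have h5 : s * X ≤ c * s * X := by
      rw [mul_assoc]
      exact le_mul_of_one_le_left (by positivity) hc1
    have h6 : 0 ≤ s * E (k - 1) := mul_nonneg hs.le (hEn _)
    rw [hc]
    rw [hc] at h5
    linarith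

set_option maxHeartbeats 1000000 in
-- Strong induction on the level closes the circle: the bound at earlier levels gives smallness at
-- the present one, smallness gives the energy bound, and the energy bound gives the claim with the
-- same constant.
theorem exists_error_bound (L₁ L₂ α M K T : ℝ) (hL₁ : 0 < L₁) (hL₂ : 0 < L₂) (hα : 0 < α)
    (hM : 1 ≤ M) :
    ∃ C > 0, ∃ h₀ > 0, ∃ s₀ > 0, ∀ (m n : ℕ) [NeZero m] [NeZero n] (h s Bc Be : ℝ)
      (J : ZMod m × ZMod n → ℝ) (P e τ : ℕ → ZMod m × ZMod n → ℝ),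
      IsErrorSequence (gridStep m n) M K T h s Bc Be J P e τ →
      0 < h → h ≤ h₀ → L₁ = m * h → L₂ = n * h → 0 < s → s ≤ s₀ → s ≤ K * h →
      0 ≤ Be → Be ≤ M → Bc ≤ M → α ≤ Bc - 3 * Be →
      ∀ l : ℕ, l * s ≤ T → ∀ x, |e l x| ≤ C * (h ^ 2 + s ^ 2) := by
  obtain ⟨C₁, hC₁, s₁, hs₁, hE⟩ := exists_energy_bound M K T α (L₁ * L₂) hα
  -- The energy and Sobolev constants bound the square of the error by (C - 1) ε², and C - 1 ≤ C²
  -- because C ≥ 1.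
  set C := L₁ * L₂ * ((1 / L₁ + 2) * (1 / L₂ + 2)) * C₁ + 1 with hC
  have hC1 : 1 ≤ C := by
    have : 0 ≤ L₁ * L₂ * ((1 / L₁ + 2) * (1 / L₂ + 2)) * C₁ := by positivity
    linarith
  -- This dominates both M and the maximum-norm bound L₁L₂M of the discrete convolution.
  set M' := M + L₁ * L₂ * M with hM'
  have hM'1 : 1 ≤ M' := by
    have : 0 ≤ L₁ * L₂ * M := by positivity
    linarith
  have hMM' : M ≤ M' := by
    have : 0 ≤ L₁ * L₂ * M := by positivity
    linarith
  -- Chosen so that the outcome of the rough bound is at most D h², which is at most h once h ≤ 1/D.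
  set D := (64 * M' ^ 2 / α + 1) * ((C + M) * (1 + K ^ 2)) with hD
  have hD0 : 0 < D := by positivity
  refine ⟨C, by linarith, min 1 (1 / D), by positivity, min 1 s₁, by positivity, ?_⟩
  intro m n _ _ h s Bc Be J P e τ H hh hh₀ hm hn hs hs₀ hsK hBe hBeM hBcM hB
  have hh1 : h ≤ 1 := hh₀.trans (min_le_left _ _)
  have hs1 : s ≤ 1 := hs₀.trans (min_le_left _ _)
  have hhD : D * h ≤ 1 := by
    have := hh₀.trans (min_le_right _ _)
    rw [le_div_iff₀ hD0] at this
    linarith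
  clear_value D
  have hV : h ^ 2 * Fintype.card (ZMod m × ZMod n) = L₁ * L₂ := by
    rw [Fintype.card_prod, ZMod.card, ZMod.card, hm, hn]
    push_cast
    ring
  set ε := h ^ 2 + s ^ 2 with hε
  have hε0 : 0 ≤ ε := by positivity
  have hεh : ε ≤ (1 + K ^ 2) * h ^ 2 := by
    have : s ^ 2 ≤ (K * h) ^ 2 := by gcongr
    rw [hε]; linarith
  set ρ := (C + M) * ε with hρ
  have hρ0 : 0 ≤ ρ := by positivity
  have hρh : (64 * M' ^ 2 / α + 1) * ρ ≤ h := by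
    calc (64 * M' ^ 2 / α + 1) * ρ ≤ (64 * M' ^ 2 / α + 1) * ((C + M) * ((1 + K ^ 2) * h ^ 2)) := by
          rw [hρ]; gcongr
      _ = D * h * h := by rw [hD]; ring
      _ ≤ 1 * h := by gcongr
      _ = h := one_mul h
  have hρh' : ρ ≤ h := by
    have : 0 ≤ 64 * M' ^ 2 / α * ρ := by positivity
    linarith
  have hS : ∀ f : ZMod m × ZMod n → ℝ, ∀ ρ, (∀ x, |f x| ≤ ρ) →
      ∀ x, |gconv h J f x| ≤ M' * ρ := fun f ρ hf x => by
    refine (abs_gconv_le hV H.kernel_bdd.le hf x).trans ?_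
    refine mul_le_mul_of_nonneg_right ?_ ((abs_nonneg _).trans (hf x))
    linarith
  have hlev : ∀ {j k : ℕ}, j ≤ k → (k : ℝ) * s ≤ T → (j : ℝ) * s ≤ T := fun hjk hk =>
    le_trans (mul_le_mul_of_nonneg_right (Nat.cast_le.2 hjk) hs.le) hk
  have key : ∀ l : ℕ, l * s ≤ T → ∀ x, |e l x| ≤ C * ε := by
    intro l
    induction l using Nat.strong_induction_on with
    | _ l ih =>
      intro hl x
      -- Earlier levels are small by induction; the present one is reached from them by a single use
      -- of the maximum principle.
      have hsmall : ∀ j ≤ l, ∀ x, |e j x| ≤ h := by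
        intro j hj y
        rcases hj.lt_or_eq with hlt | rfl
        · refine (ih j hlt (hlev hj hl) y).trans (le_trans ?_ hρh')
          rw [hρ]
          gcongr
          linarith
        · rcases j with _ | k
          · simp [H.initial, hh.le]
          · have hk := level_le_of_succ hs.le hl
            have hCρ : C * ε ≤ ρ := by rw [hρ]; gcongr; linarith
            have hτ : ∀ x, |s * τ k x| ≤ ρ := by
              intro x
              have hMε : M * ε ≤ ρ := by rw [hρ]; gcongr; linarith
              rw [abs_mul, abs_of_pos hs]
              rcases Nat.eq_zero_or_pos k with rfl | hk1
              · have h1 := (H.trunc_zero_bdd (by simpa using hl)).le x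
                calc s * |τ 0 x| ≤ s * (M * (s + h ^ 2)) := by gcongr
                  _ = M * (s ^ 2 + s * h ^ 2) := by ring
                  _ ≤ M * ε := by
                    gcongr
                    rw [hε]
                    linarith [mul_le_of_le_one_left (sq_nonneg h) hs1]
                  _ ≤ ρ := hMε
              · have h1 := (H.trunc_bdd k hk1 hl).le x
                calc s * |τ k x| ≤ 1 * (M * (s ^ 2 + h ^ 2)) := by gcongr
                  _ = M * ε := by rw [hε]; ring
                  _ ≤ ρ := hMε
            have h1 := rough_bound (d := gridStep m n) hs.le hα hM'1 hBe (by linarith)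
              (by linarith) hB (hρh'.trans hh1) hS
              (fun x => ((H.exact_bdd k hk).le x).trans (by linarith))
              (fun x => ((H.exact_bdd (k + 1) hl).le x).trans (by linarith))
              (fun x => (ih k (by omega) hk x).trans hCρ)
              (fun x => (ih (k - 1) (by omega) (hlev (Nat.sub_le k 1) hk) x).trans hCρ)
              hτ (H.step k hl) y
            linarith
      have h1 := hE (gridStep m n) h s Bc Be J P e τ H hh hh1 hs (hs₀.trans (min_le_right _ _)) hsK
        hBe hB hV l hl hsmall
      have h2 := sq_le_sobSq_two hh hm hn (e l) x
      have h3 : e l x ^ 2 ≤ (C * ε) ^ 2 := by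
        calc e l x ^ 2 ≤ h ^ 2 * ((1 / L₁ + 2) * (1 / L₂ + 2)) *
              (C₁ * (Fintype.card (ZMod m × ZMod n) * ε ^ 2)) := by
              refine h2.trans ?_
              gcongr
          _ = (h ^ 2 * Fintype.card (ZMod m × ZMod n)) * ((1 / L₁ + 2) * (1 / L₂ + 2)) * C₁
              * ε ^ 2 := by ring
          _ = (C - 1) * ε ^ 2 := by rw [hV, hC]; ring
          _ ≤ C ^ 2 * ε ^ 2 := by
            gcongr
            linarith [le_mul_of_one_le_left (by linarith : 0 ≤ C) hC1, sq C]
          _ = _ := by ring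
      exact abs_le_of_sq_le_sq h3 (by positivity)
  exact key

end Stability
-- Consistency: calculus on the slab, quadrature and truncation errors.
section

open Set

/-! ### Smooth periodic functions on the space-time slab -/

/-- The space-time slab `ℝ² × [0, T]`. -/
def slab (T : ℝ) : Set (ℝ × ℝ × ℝ) := univ ×ˢ univ ×ˢ Icc 0 T

/-- Smooth functions on the space-time slab which are periodic in space. -/
structure SmoothPer (L₁ L₂ T : ℝ) (F : ℝ × ℝ × ℝ → ℝ) : Prop where
  smooth : ContDiffOn ℝ ∞ F (slab T)
  left : ∀ x y t, t ∈ Icc 0 T → F (x + L₁, y, t) = F (x, y, t)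
  right : ∀ x y t, t ∈ Icc 0 T → F (x, y + L₂, t) = F (x, y, t)

/-- The directional derivative of `F` in the direction `v`, within the slab. -/
def part (T : ℝ) (v : ℝ × ℝ × ℝ) (F : ℝ × ℝ × ℝ → ℝ) (p : ℝ × ℝ × ℝ) : ℝ :=
  fderivWithin ℝ F (slab T) p v

/-- The spatial unit vectors. -/
def spaceDir : Bool → ℝ × ℝ × ℝ := fun b => cond b (0, 1, 0) (1, 0, 0)

/-- The temporal unit vector. -/
def timeDir : ℝ × ℝ × ℝ := (0, 0, 1)

/-- The spatial Laplacian of a function on the slab. -/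
def spaceLap (T : ℝ) (F : ℝ × ℝ × ℝ → ℝ) : ℝ × ℝ × ℝ → ℝ := fun p =>
  ∑ b, part T (spaceDir b) (part T (spaceDir b) F) p

/-- The values of `F` at time `t`. -/
def slice (F : ℝ × ℝ × ℝ → ℝ) (t : ℝ) (p : ℝ × ℝ) : ℝ := F (p.1, p.2, t)

/-- The steps of a grid of width `h` in the plane. -/
def planeStep (h : ℝ) : Bool → ℝ × ℝ := fun b => cond b (0, h) (h, 0)

theorem mem_slab {T : ℝ} {p : ℝ × ℝ × ℝ} : p ∈ slab T ↔ p.2.2 ∈ Icc 0 T := by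
  simp [slab]

theorem uniqueDiffOn_slab {T : ℝ} (hT : 0 < T) : UniqueDiffOn ℝ (slab T) :=
  uniqueDiffOn_univ.prod (uniqueDiffOn_univ.prod (uniqueDiffOn_Icc hT))

namespace SmoothPer

variable {L₁ L₂ T : ℝ} {F G : ℝ × ℝ × ℝ → ℝ}

theorem add (hF : SmoothPer L₁ L₂ T F) (hG : SmoothPer L₁ L₂ T G) :
    SmoothPer L₁ L₂ T (fun p => F p + G p) :=
  ⟨hF.smooth.add hG.smooth, fun x y t ht => by rw [hF.left x y t ht, hG.left x y t ht],
    fun x y t ht => by rw [hF.right x y t ht, hG.right x y t ht]⟩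

theorem mul (hF : SmoothPer L₁ L₂ T F) (hG : SmoothPer L₁ L₂ T G) :
    SmoothPer L₁ L₂ T (fun p => F p * G p) :=
  ⟨hF.smooth.mul hG.smooth, fun x y t ht => by rw [hF.left x y t ht, hG.left x y t ht],
    fun x y t ht => by rw [hF.right x y t ht, hG.right x y t ht]⟩

open scoped Pointwise in
-- A purely spatial shift maps the slab onto itself, so derivatives within the slab inherit the
-- periodicity.
theorem part_add_eq {c : ℝ × ℝ × ℝ} (hc : c.2.2 = 0)
    (hper : ∀ p ∈ slab T, F (p + c) = F p) (v : ℝ × ℝ × ℝ) {p : ℝ × ℝ × ℝ}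
    (hp : p ∈ slab T) : part T v F (p + c) = part T v F p := by
  have hset : c +ᵥ slab T = slab T := by
    ext q
    rw [mem_vadd_set_iff_neg_vadd_mem, mem_slab, mem_slab]
    simp [hc]
  have h1 : fderivWithin ℝ (fun x => F (x + c)) (slab T) p = fderivWithin ℝ F (slab T) (p + c) := by
    rw [fderivWithin_comp_add_right, hset]
  rw [part, part, ← h1, fderivWithin_congr hper (hper p hp)]

theorem of_part (hF : SmoothPer L₁ L₂ T F) (hT : 0 < T) (v : ℝ × ℝ × ℝ) :
    SmoothPer L₁ L₂ T (part T v F) := by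
  refine ⟨?_, fun x y t ht => ?_, fun x y t ht => ?_⟩
  · exact (hF.smooth.fderivWithin (uniqueDiffOn_slab hT) le_rfl).clm_apply contDiffOn_const
  · have := part_add_eq (c := (L₁, 0, 0)) rfl (fun p hp => by
      have := hF.left p.1 p.2.1 p.2.2 (mem_slab.1 hp)
      simpa [Prod.add_def] using this) v (p := (x, y, t)) (mem_slab.2 ht)
    simpa using this
  · have := part_add_eq (c := (0, L₂, 0)) rfl (fun p hp => by
      have := hF.right p.1 p.2.1 p.2.2 (mem_slab.1 hp)
      simpa [Prod.add_def] using this) v (p := (x, y, t)) (mem_slab.2 ht)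
    simpa using this

theorem of_spaceLap (hF : SmoothPer L₁ L₂ T F) (hT : 0 < T) : SmoothPer L₁ L₂ T (spaceLap T F) := by
  have := ((hF.of_part hT (spaceDir true)).of_part hT (spaceDir true)).add
    ((hF.of_part hT (spaceDir false)).of_part hT (spaceDir false))
  have e : spaceLap T F = fun p => part T (spaceDir true) (part T (spaceDir true) F) p
      + part T (spaceDir false) (part T (spaceDir false) F) p := by
    ext p
    simp [spaceLap]
  rwa [e]

theorem exists_bound (hF : SmoothPer L₁ L₂ T F) (hL₁ : 0 < L₁) (hL₂ : 0 < L₂) :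
    ∃ M, ∀ p ∈ slab T, |F p| ≤ M := by
  have hK : IsCompact (Icc 0 L₁ ×ˢ Icc 0 L₂ ×ˢ Icc 0 T) :=
    isCompact_Icc.prod (isCompact_Icc.prod isCompact_Icc)
  obtain ⟨M, hM⟩ := hK.exists_bound_of_continuousOn
    (hF.smooth.continuousOn.mono fun p hp => mem_slab.2 hp.2.2)
  refine ⟨M, fun ⟨x, y, t⟩ hp => ?_⟩
  have ht : t ∈ Icc 0 T := mem_slab.1 hp
  have hx : Function.Periodic (fun x => F (x, y, t)) L₁ := fun x => hF.left x y t ht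
  obtain ⟨x', hx', e1⟩ := hx.exists_mem_Ico₀ hL₁ x
  have hy : Function.Periodic (fun y => F (x', y, t)) L₂ := fun y => hF.right x' y t ht
  obtain ⟨y', hy', e2⟩ := hy.exists_mem_Ico₀ hL₂ y
  have e1' : F (x, y, t) = F (x', y, t) := e1
  have e2' : F (x', y, t) = F (x', y', t) := e2
  rw [e1', e2']
  exact hM _ ⟨⟨hx'.1, hx'.2.le⟩, ⟨hy'.1, hy'.2.le⟩, ht⟩

theorem hasDerivWithinAt_comp (hF : SmoothPer L₁ L₂ T F) {γ : ℝ → ℝ × ℝ × ℝ} {v : ℝ × ℝ × ℝ}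
    {I : Set ℝ} {r : ℝ} (hγ : HasDerivWithinAt γ v I r) (hmaps : MapsTo γ I (slab T))
    (hr : r ∈ I) : HasDerivWithinAt (fun r => F (γ r)) (part T v F (γ r)) I r :=
  ((hF.smooth.differentiableOn (by simp) (γ r) (hmaps hr)).hasFDerivWithinAt).comp_hasDerivWithinAt
    r hγ hmaps

theorem hasDerivWithinAt_time (hF : SmoothPer L₁ L₂ T F) (p : ℝ × ℝ) {t : ℝ} (ht : t ∈ Icc 0 T) :
    HasDerivWithinAt (fun t => slice F t p) (slice (part T timeDir F) t p)
      (Icc 0 T) t :=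
  hF.hasDerivWithinAt_comp (γ := fun t => (p.1, p.2, t))
    ((hasDerivWithinAt_const _ _ _).prodMk ((hasDerivWithinAt_const _ _ _).prodMk
      (hasDerivWithinAt_id _ _))) (fun _ ht => mem_slab.2 ht) ht

theorem hasDerivAt_space (hF : SmoothPer L₁ L₂ T F) (b : Bool) (p : ℝ × ℝ) {t : ℝ}
    (ht : t ∈ Icc 0 T) (r : ℝ) :
    HasDerivAt (fun r => slice F t (p + planeStep r b))
      (slice (part T (spaceDir b) F) t (p + planeStep r b)) r := by
  rw [← hasDerivWithinAt_univ]
  cases b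
  · refine hF.hasDerivWithinAt_comp (γ := fun r => (p.1 + r, p.2 + 0, t)) ?_
      (fun _ _ => mem_slab.2 ht) (mem_univ r)
    exact ((hasDerivWithinAt_id _ _).const_add _).prodMk
      ((hasDerivWithinAt_const _ _ _).prodMk (hasDerivWithinAt_const _ _ _))
  · refine hF.hasDerivWithinAt_comp (γ := fun r => (p.1 + 0, p.2 + r, t)) ?_
      (fun _ _ => mem_slab.2 ht) (mem_univ r)
    exact (hasDerivWithinAt_const _ _ _).prodMk
      (((hasDerivWithinAt_id _ _).const_add _).prodMk (hasDerivWithinAt_const _ _ _))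

end SmoothPer

/-! ### Taylor estimates along a line -/

section Taylor

variable {I : Set ℝ} {M a : ℝ}

/-- The mean value inequality on the segment from a to b raises the order of a remainder by one;
iterated, it gives the Taylor estimates below, without factorials in the constants. Derivatives
within a convex set allow the end points of the time interval. -/
theorem abs_le_mul_pow_succ (hI : Convex ℝ I) {R R' : ℝ → ℝ} {n : ℕ}
    (hR : ∀ r ∈ I, HasDerivWithinAt R (R' r) I r) (hR' : ∀ r ∈ I, |R' r| ≤ M * |r - a| ^ n)
    (ha : a ∈ I) (h0 : R a = 0) (hM : 0 ≤ M) {b : ℝ} (hb : b ∈ I) :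
    |R b| ≤ M * |b - a| ^ (n + 1) := by
  have hsub : uIcc a b ⊆ I := hI.ordConnected.uIcc_subset ha hb
  have h1 := (convex_uIcc a b).norm_image_sub_le_of_norm_hasDerivWithin_le (f := R) (f' := R')
    (C := M * |b - a| ^ n) (fun r hr => (hR r (hsub hr)).mono hsub) (fun r hr => by
      refine (hR' r (hsub hr)).trans ?_
      gcongr M * ?_ ^ n
      have := abs_sub_left_of_mem_uIcc hr
      simpa [abs_sub_comm] using this) left_mem_uIcc right_mem_uIcc
  rw [h0, sub_zero, Real.norm_eq_abs, Real.norm_eq_abs] at h1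
  rw [pow_succ, ← mul_assoc]
  exact h1

variable {g g₁ g₂ g₃ g₄ : ℝ → ℝ}

theorem taylor_one (hI : Convex ℝ I) (h₁ : ∀ r ∈ I, HasDerivWithinAt g (g₁ r) I r)
    (hM : ∀ r ∈ I, |g₁ r| ≤ M) (ha : a ∈ I) {b : ℝ} (hb : b ∈ I) :
    |g b - g a| ≤ M * |b - a| := by
  have := abs_le_mul_pow_succ (n := 0) (R := fun r => g r - g a) hI
    (fun r hr => (h₁ r hr).sub_const _) (fun r hr => by simpa using hM r hr) ha (by simp)
    ((abs_nonneg _).trans (hM a ha)) hb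
  simpa using this

theorem taylor_two (hI : Convex ℝ I) (h₁ : ∀ r ∈ I, HasDerivWithinAt g (g₁ r) I r)
    (h₂ : ∀ r ∈ I, HasDerivWithinAt g₁ (g₂ r) I r)
    (hM : ∀ r ∈ I, |g₂ r| ≤ M) (ha : a ∈ I) {b : ℝ} (hb : b ∈ I) :
    |g b - g a - g₁ a * (b - a)| ≤ M * |b - a| ^ 2 :=
  abs_le_mul_pow_succ (n := 1) (R := fun r => g r - g a - g₁ a * (r - a))
    (R' := fun r => g₁ r - g₁ a) hI
    (fun r hr => by
      have := ((h₁ r hr).sub_const (g a)).sub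
        (((hasDerivWithinAt_id r I).sub_const a).const_mul (g₁ a))
      exact this.congr_deriv (by simp))
    (fun r hr => by simpa using taylor_one hI h₂ hM ha hr) ha (by simp)
    ((abs_nonneg _).trans (hM a ha)) hb

theorem taylor_three (hI : Convex ℝ I) (h₁ : ∀ r ∈ I, HasDerivWithinAt g (g₁ r) I r)
    (h₂ : ∀ r ∈ I, HasDerivWithinAt g₁ (g₂ r) I r) (h₃ : ∀ r ∈ I, HasDerivWithinAt g₂ (g₃ r) I r)
    (hM : ∀ r ∈ I, |g₃ r| ≤ M) (ha : a ∈ I) {b : ℝ} (hb : b ∈ I) :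
    |g b - g a - g₁ a * (b - a) - g₂ a / 2 * (b - a) ^ 2| ≤ M * |b - a| ^ 3 :=
  abs_le_mul_pow_succ (n := 2) (R := fun r => g r - g a - g₁ a * (r - a) - g₂ a / 2 * (r - a) ^ 2)
    (R' := fun r => g₁ r - g₁ a - g₂ a * (r - a)) hI
    (fun r hr => by
      have := (((h₁ r hr).sub_const (g a)).sub
        (((hasDerivWithinAt_id r I).sub_const a).const_mul (g₁ a))).sub
        ((((hasDerivWithinAt_id r I).sub_const a).pow 2).const_mul (g₂ a / 2))
      refine this.congr_deriv ?_
      simp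
      ring)
    (fun r hr => taylor_two hI h₂ h₃ hM ha hr) ha (by simp)
    ((abs_nonneg _).trans (hM a ha)) hb

theorem taylor_four (hI : Convex ℝ I) (h₁ : ∀ r ∈ I, HasDerivWithinAt g (g₁ r) I r)
    (h₂ : ∀ r ∈ I, HasDerivWithinAt g₁ (g₂ r) I r) (h₃ : ∀ r ∈ I, HasDerivWithinAt g₂ (g₃ r) I r)
    (h₄ : ∀ r ∈ I, HasDerivWithinAt g₃ (g₄ r) I r)
    (hM : ∀ r ∈ I, |g₄ r| ≤ M) (ha : a ∈ I) {b : ℝ} (hb : b ∈ I) :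
    |g b - g a - g₁ a * (b - a) - g₂ a / 2 * (b - a) ^ 2 - g₃ a / 6 * (b - a) ^ 3| ≤
      M * |b - a| ^ 4 :=
  abs_le_mul_pow_succ (n := 3)
    (R := fun r => g r - g a - g₁ a * (r - a) - g₂ a / 2 * (r - a) ^ 2 - g₃ a / 6 * (r - a) ^ 3)
    (R' := fun r => g₁ r - g₁ a - g₂ a * (r - a) - g₃ a / 2 * (r - a) ^ 2) hI
    (fun r hr => by
      have := ((((h₁ r hr).sub_const (g a)).sub
        (((hasDerivWithinAt_id r I).sub_const a).const_mul (g₁ a))).sub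
        ((((hasDerivWithinAt_id r I).sub_const a).pow 2).const_mul (g₂ a / 2))).sub
        ((((hasDerivWithinAt_id r I).sub_const a).pow 3).const_mul (g₃ a / 6))
      refine this.congr_deriv ?_
      simp
      ring)
    (fun r hr => taylor_three hI h₂ h₃ h₄ hM ha hr) ha (by simp)
    ((abs_nonneg _).trans (hM a ha)) hb

end Taylor

/-! ### Difference quotients of smooth periodic functions -/

section SliceBounds

/-- Since difference quotients are finite linear combinations, they can be differentiated in a
parameter; each Taylor estimate thus holds for all of them at once. -/
theorem hasDerivWithinAt_dqs {A : Type*} [AddCommGroup A] (d : Bool → A) (h : ℝ) {I : Set ℝ}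
    {r : ℝ} (w : List Bool) {f : ℝ → A → ℝ} {f' : A → ℝ}
    (hf : ∀ a, HasDerivWithinAt (fun r => f r a) (f' a) I r) (a : A) :
    HasDerivWithinAt (fun r => dqs d h w (f r) a) (dqs d h w f' a) I r := by
  induction w generalizing f f' a with
  | nil => exact hf a
  | cons b w ih =>
    refine ih (f := fun r => dq d h b (f r)) (f' := dq d h b f') (fun a => ?_) a
    exact ((hf (a + d b)).sub (hf a)).div_const h

variable {L₁ L₂ T : ℝ} {F : ℝ × ℝ × ℝ → ℝ}

theorem SmoothPer.hasDerivWithinAt_dqs_time (hF : SmoothPer L₁ L₂ T F) (h : ℝ) (w : List Bool)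
    (p : ℝ × ℝ) {t : ℝ} (ht : t ∈ Icc 0 T) :
    HasDerivWithinAt (fun t => dqs (planeStep h) h w (slice F t) p)
      (dqs (planeStep h) h w (slice (part T timeDir F) t) p) (Icc 0 T) t :=
  hasDerivWithinAt_dqs _ _ _ (fun p => hF.hasDerivWithinAt_time p ht) p

theorem SmoothPer.hasDerivWithinAt_dqs_space (hF : SmoothPer L₁ L₂ T F) (h : ℝ) (w : List Bool)
    (b : Bool) (p : ℝ × ℝ) {t : ℝ} (ht : t ∈ Icc 0 T) (r : ℝ) :
    HasDerivWithinAt (fun r => dqs (planeStep h) h w (slice F t) (p + planeStep r b))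
      (dqs (planeStep h) h w (slice (part T (spaceDir b) F) t) (p + planeStep r b))
      univ r := by
  have := hasDerivWithinAt_dqs (planeStep h) h w (I := univ) (r := r)
    (f := fun r => trans (planeStep r b) (slice F t))
    (f' := trans (planeStep r b) (slice (part T (spaceDir b) F) t))
    (fun p => hasDerivWithinAt_univ.2 (hF.hasDerivAt_space b p ht r)) p
  simpa only [dqs_trans, trans_apply] using this

theorem planeStep_zero (b : Bool) : planeStep 0 b = 0 := by cases b <;> rfl

theorem planeStep_neg (h : ℝ) (b : Bool) : planeStep (-h) b = -planeStep h b := by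
  cases b <;> simp [planeStep]

/-- By the mean value inequality one difference quotient is bounded by a derivative, which is again
smooth and periodic; induction does the rest, with a constant independent of h. -/
theorem SmoothPer.exists_dqBdd (hF : SmoothPer L₁ L₂ T F) (hL₁ : 0 < L₁) (hL₂ : 0 < L₂)
    (hT : 0 < T) (r : ℕ) :
    ∃ M, ∀ h > 0, ∀ t ∈ Icc 0 T, DqBdd (planeStep h) h r M (slice F t) := by
  induction r generalizing F with
  | zero =>
    obtain ⟨M, hM⟩ := hF.exists_bound hL₁ hL₂
    refine ⟨M, fun h _ t ht w hw a => ?_⟩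
    obtain rfl : w = [] := List.length_eq_zero_iff.1 (Nat.le_zero.1 hw)
    exact hM _ (mem_slab.2 ht)
  | succ r ih =>
    obtain ⟨M₀, hM₀⟩ := ih hF
    have h1 : ∀ b, ∃ M, ∀ h > 0, ∀ t ∈ Icc 0 T,
        DqBdd (planeStep h) h r M (slice (part T (spaceDir b) F) t) :=
      fun b => ih (hF.of_part hT _)
    choose M hM using h1
    refine ⟨max M₀ (max (M true) (M false)), fun h hh t ht => dqBdd_succ_iff.2 ⟨fun a => ?_,
      fun b w hw a => ?_⟩⟩
    · exact ((hM₀ h hh t ht).le a).trans (le_max_left _ _)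
    · rw [dqs_dq, dq_apply]
      have h2 := taylor_one convex_univ
        (fun r _ => hF.hasDerivWithinAt_dqs_space h w b a ht r)
        (fun r _ => hM b h hh t ht w hw _) (mem_univ 0) (mem_univ h)
      rw [planeStep_zero, add_zero, sub_zero, abs_of_pos hh] at h2
      rw [abs_div, abs_of_pos hh, div_le_iff₀ hh]
      refine h2.trans (mul_le_mul_of_nonneg_right ?_ hh.le)
      cases b <;> simp

/-- In the sum of the fourth order Taylor expansions for the steps h and -h the odd terms cancel. -/
theorem SmoothPer.exists_dqBdd_lap (hF : SmoothPer L₁ L₂ T F) (hL₁ : 0 < L₁) (hL₂ : 0 < L₂)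
    (hT : 0 < T) (r : ℕ) :
    ∃ M, ∀ h > 0, ∀ t ∈ Icc 0 T,
      DqBdd (planeStep h) h r (M * h ^ 2) (slice (spaceLap T F) t - lap (planeStep h) h (slice F t)) := by
  have h1 : ∀ b, ∃ M, ∀ h > 0, ∀ t ∈ Icc 0 T, DqBdd (planeStep h) h r M
      (slice (part T (spaceDir b) (part T (spaceDir b) (part T (spaceDir b)
        (part T (spaceDir b) F)))) t) := fun b =>
    ((((hF.of_part hT _).of_part hT _).of_part hT _).of_part hT _).exists_dqBdd hL₁ hL₂ hT r
  choose M hM using h1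
  refine ⟨2 * (M true + M false), fun h hh t ht w hw p => ?_⟩
  have e1 : dqs (planeStep h) h w (slice (spaceLap T F) t) p =
      ∑ b, dqs (planeStep h) h w (slice (part T (spaceDir b) (part T (spaceDir b) F)) t) p := by
    have : slice (spaceLap T F) t =
        ∑ b, slice (part T (spaceDir b) (part T (spaceDir b) F)) t := by
      ext p
      simp [slice, spaceLap]
    rw [this, map_sum, Finset.sum_apply]
  rw [map_sub, Pi.sub_apply, dqs_lap, lap_apply, e1, ← Finset.sum_sub_distrib, Fintype.sum_bool]
  have key : ∀ b, |dqs (planeStep h) h w (slice (part T (spaceDir b) (part T (spaceDir b) F)) t) p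
      - (dqs (planeStep h) h w (slice F t) (p + planeStep h b)
        + dqs (planeStep h) h w (slice F t) (p - planeStep h b)
        - 2 * dqs (planeStep h) h w (slice F t) p) / h ^ 2| ≤ 2 * M b * h ^ 2 := by
    intro b
    have h4 := fun {c : ℝ} => taylor_four convex_univ (b := c) (a := 0)
      (fun r _ => hF.hasDerivWithinAt_dqs_space h w b p ht r)
      (fun r _ => (hF.of_part hT _).hasDerivWithinAt_dqs_space h w b p ht r)
      (fun r _ => ((hF.of_part hT _).of_part hT _).hasDerivWithinAt_dqs_space h w b p ht r)
      (fun r _ => (((hF.of_part hT _).of_part hT _).of_part hT _).hasDerivWithinAt_dqs_space h w b p ht r)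
      (fun r _ => hM b h hh t ht w hw _) (mem_univ 0) (mem_univ c)
    have hp := h4 (c := h)
    have hm := h4 (c := -h)
    rw [planeStep_neg, ← sub_eq_add_neg] at hm
    rw [planeStep_zero, add_zero] at hp hm
    rw [sub_zero, abs_of_pos hh] at hp
    rw [sub_zero, abs_neg, abs_of_pos hh] at hm
    have h2 : (0 : ℝ) < h ^ 2 := by positivity
    rw [abs_le] at hp hm ⊢
    rw [sub_div' h2.ne', le_div_iff₀ h2, div_le_iff₀ h2]
    constructor <;> nlinarith
  have k1 := key true
  have k2 := key false
  rw [abs_le] at k1 k2 ⊢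
  constructor <;> linarith

theorem SmoothPer.exists_dqBdd_sub (hF : SmoothPer L₁ L₂ T F) (hL₁ : 0 < L₁) (hL₂ : 0 < L₂)
    (hT : 0 < T) (r : ℕ) :
    ∃ M, ∀ h > 0, ∀ t ∈ Icc 0 T, ∀ t' ∈ Icc 0 T,
      DqBdd (planeStep h) h r (M * |t' - t|) (slice F t' - slice F t) := by
  obtain ⟨M, hM⟩ := (hF.of_part hT timeDir).exists_dqBdd hL₁ hL₂ hT r
  refine ⟨M, fun h hh t ht t' ht' w hw p => ?_⟩
  rw [map_sub]
  exact taylor_one (convex_Icc 0 T) (fun r hr => hF.hasDerivWithinAt_dqs_time h w p hr)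
    (fun r hr => hM h hh r hr w hw p) ht ht'

/-- Expansion about the midpoint: the linear terms cancel in the average. -/
theorem SmoothPer.exists_dqBdd_midpoint (hF : SmoothPer L₁ L₂ T F) (hL₁ : 0 < L₁) (hL₂ : 0 < L₂)
    (hT : 0 < T) (r : ℕ) :
    ∃ M, ∀ h > 0, ∀ t s, t ∈ Icc 0 T → t + s ∈ Icc 0 T →
      DqBdd (planeStep h) h r (M * s ^ 2)
        (slice F (t + s / 2) - (1 / 2 : ℝ) • (slice F (t + s) + slice F t)) := by
  obtain ⟨M, hM⟩ := ((hF.of_part hT timeDir).of_part hT timeDir).exists_dqBdd hL₁ hL₂ hT r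
  refine ⟨M, fun h hh t s ht hts w hw p => ?_⟩
  have hmid : t + s / 2 ∈ Icc 0 T := ⟨by linarith [ht.1, hts.1], by linarith [ht.2, hts.2]⟩
  have h2 := fun {c : ℝ} (hc : c ∈ Icc 0 T) => taylor_two (convex_Icc 0 T)
    (fun r hr => hF.hasDerivWithinAt_dqs_time h w p hr)
    (fun r hr => (hF.of_part hT timeDir).hasDerivWithinAt_dqs_time h w p hr)
    (fun r hr => hM h hh r hr w hw p) hmid hc
  have k1 := h2 ht
  have k2 := h2 hts
  rw [sq_abs] at k1 k2
  rw [map_sub, map_smul, map_add]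
  simp only [Pi.sub_apply, Pi.smul_apply, Pi.add_apply, smul_eq_mul]
  have hn : 0 ≤ M * s ^ 2 :=
    mul_nonneg ((abs_nonneg _).trans ((hM h hh t ht).le 0)) (sq_nonneg _)
  rw [abs_le] at k1 k2 ⊢
  constructor <;> linarith

/-- Expansion about t: the extrapolation is exact for functions that are affine in time. -/
theorem SmoothPer.exists_dqBdd_extrapolation (hF : SmoothPer L₁ L₂ T F) (hL₁ : 0 < L₁)
    (hL₂ : 0 < L₂) (hT : 0 < T) (r : ℕ) :
    ∃ M, ∀ h > 0, ∀ t s, t - s ∈ Icc 0 T → t ∈ Icc 0 T → t + s ∈ Icc 0 T →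
      DqBdd (planeStep h) h r (M * s ^ 2)
        (slice F (t + s / 2) - ((3 / 2 : ℝ) • slice F t - (1 / 2 : ℝ) • slice F (t - s))) := by
  obtain ⟨M, hM⟩ := ((hF.of_part hT timeDir).of_part hT timeDir).exists_dqBdd hL₁ hL₂ hT r
  refine ⟨M, fun h hh t s hts ht hts' w hw p => ?_⟩
  have hmid : t + s / 2 ∈ Icc 0 T := ⟨by linarith [ht.1, hts'.1], by linarith [ht.2, hts'.2]⟩
  have h2 := fun {c : ℝ} (hc : c ∈ Icc 0 T) => taylor_two (convex_Icc 0 T)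
    (fun r hr => hF.hasDerivWithinAt_dqs_time h w p hr)
    (fun r hr => (hF.of_part hT timeDir).hasDerivWithinAt_dqs_time h w p hr)
    (fun r hr => hM h hh r hr w hw p) ht hc
  have k1 := h2 hts
  have k2 := h2 hmid
  rw [sq_abs] at k1 k2
  simp only [map_sub, map_smul]
  simp only [Pi.sub_apply, Pi.smul_apply, smul_eq_mul]
  have hn : 0 ≤ M * s ^ 2 :=
    mul_nonneg ((abs_nonneg _).trans ((hM h hh t ht).le 0)) (sq_nonneg _)
  rw [abs_le] at k1 k2 ⊢
  constructor <;> linarith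

/-- Expansion about the midpoint to third order: the quadratic terms cancel in the difference, which
leaves s³ before division by s. -/
theorem SmoothPer.exists_dqBdd_timeDeriv (hF : SmoothPer L₁ L₂ T F) (hL₁ : 0 < L₁)
    (hL₂ : 0 < L₂) (hT : 0 < T) (r : ℕ) :
    ∃ M, ∀ h > 0, ∀ t s, 0 < s → t ∈ Icc 0 T → t + s ∈ Icc 0 T →
      DqBdd (planeStep h) h r (M * s ^ 2)
        (s⁻¹ • (slice F (t + s) - slice F t) - slice (part T timeDir F) (t + s / 2)) := by
  obtain ⟨M, hM⟩ := (((hF.of_part hT timeDir).of_part hT timeDir).of_part hT timeDir).exists_dqBdd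
    hL₁ hL₂ hT r
  refine ⟨M, fun h hh t s hs ht hts w hw p => ?_⟩
  have hmid : t + s / 2 ∈ Icc 0 T := ⟨by linarith [ht.1, hts.1], by linarith [ht.2, hts.2]⟩
  have h2 := fun {c : ℝ} (hc : c ∈ Icc 0 T) => taylor_three (convex_Icc 0 T)
    (fun r hr => hF.hasDerivWithinAt_dqs_time h w p hr)
    (fun r hr => (hF.of_part hT timeDir).hasDerivWithinAt_dqs_time h w p hr)
    (fun r hr => ((hF.of_part hT timeDir).of_part hT timeDir).hasDerivWithinAt_dqs_time h w p hr)
    (fun r hr => hM h hh r hr w hw p) hmid hc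
  have k1 := h2 ht
  have k2 := h2 hts
  have e1 : t - (t + s / 2) = -(s / 2) := by ring
  have e2 : t + s - (t + s / 2) = s / 2 := by ring
  rw [e1, abs_neg (s / 2), abs_of_pos (half_pos hs)] at k1
  rw [e2, abs_of_pos (half_pos hs)] at k2
  have hn : 0 ≤ M * s ^ 3 :=
    mul_nonneg ((abs_nonneg _).trans ((hM h hh t ht).le 0)) (by positivity)
  rw [map_sub, map_smul, map_sub]
  simp only [Pi.sub_apply, Pi.smul_apply, smul_eq_mul]
  rw [inv_mul_eq_div, div_sub' hs.ne', abs_div, abs_of_pos hs, div_le_iff₀ hs]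
  rw [abs_le] at k1 k2 ⊢
  constructor <;> linarith

end SliceBounds

/-! ### Quadrature on periodic grids -/

section Quadrature

theorem abs_integral_sub_trapezoid_le {q q₁ q₂ : ℝ → ℝ} {M a h : ℝ}
    (h₁ : ∀ r, HasDerivAt q (q₁ r) r) (h₂ : ∀ r, HasDerivAt q₁ (q₂ r) r) (hM : ∀ r, |q₂ r| ≤ M) :
    |(∫ r in a..a + h, q r) - h * ((q a + q (a + h)) / 2)| ≤ M * |h| ^ 3 := by
  have hq : Continuous q := continuous_iff_continuousAt.2 fun r => (h₁ r).continuousAt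
  have hM0 : 0 ≤ M := (abs_nonneg _).trans (hM 0)
  -- As a function of the right end point, the trapezoidal error has half a first order Taylor
  -- remainder, expanded at r and evaluated at a, as its derivative.
  have h3 := abs_le_mul_pow_succ (I := univ) (M := M) (a := a) (n := 2)
    (R := fun r => (∫ x in a..r, q x) - (r - a) * ((q a + q r) / 2))
    (R' := fun r => -(q a - q r - q₁ r * (a - r)) / 2) convex_univ
    (fun r _ => by
      have e1 : HasDerivAt (fun r => ∫ x in a..r, q x) (q r) r :=
        intervalIntegral.integral_hasDerivAt_right (hq.intervalIntegrable _ _)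
          (hq.stronglyMeasurableAtFilter _ _) hq.continuousAt
      have e2 := (e1.sub (((hasDerivAt_id r).sub_const a).mul
        (((h₁ r).const_add (q a)).div_const 2))).hasDerivWithinAt (s := univ)
      refine e2.congr_deriv ?_
      simp
      ring)
    (fun r _ => by
      have e3 := taylor_two convex_univ (fun r _ => (h₁ r).hasDerivWithinAt)
        (fun r _ => (h₂ r).hasDerivWithinAt) (fun r _ => hM r) (mem_univ r) (mem_univ a)
      rw [abs_sub_comm a r] at e3
      rw [abs_div, abs_neg, abs_of_pos (zero_lt_two' ℝ)]
      have : 0 ≤ M * |r - a| ^ 2 := by positivity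
      linarith)
    (mem_univ a) (by simp) hM0 (mem_univ (a + h))
  simpa using h3

theorem abs_integral_sub_sum_le {q q₁ q₂ : ℝ → ℝ} {M h : ℝ} (hh : 0 < h)
    (h₁ : ∀ r, HasDerivAt q (q₁ r) r) (h₂ : ∀ r, HasDerivAt q₁ (q₂ r) r) (hM : ∀ r, |q₂ r| ≤ M)
    {m : ℕ} {L : ℝ} (hL : L = m * h) (hper : q L = q 0) :
    |(∫ r in (0 : ℝ)..L, q r) - h * ∑ k ∈ Finset.Icc 1 m, q (k * h)| ≤ M * L * h ^ 2 := by
  have hq : Continuous q := continuous_iff_continuousAt.2 fun r => (h₁ r).continuousAt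
  -- The one-sided sum differs from the trapezoidal sum by an end point correction, which vanishes
  -- by periodicity.
  have key : ∀ m : ℕ, |(∫ r in (0 : ℝ)..m * h, q r) - (h * ∑ k ∈ Finset.Icc 1 m, q (k * h)
      - h / 2 * (q (m * h) - q 0))| ≤ m * (M * h ^ 3) := by
    intro m
    induction m with
    | zero => simp
    | succ m ih =>
      have e1 := abs_integral_sub_trapezoid_le (a := m * h) (h := h) h₁ h₂ hM
      rw [abs_of_pos hh] at e1
      have e2 : (∫ r in (0 : ℝ)..(m + 1 : ℕ) * h, q r) =
          (∫ r in (0 : ℝ)..m * h, q r) + ∫ r in m * h..m * h + h, q r := by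
        rw [intervalIntegral.integral_add_adjacent_intervals (hq.intervalIntegrable _ _)
          (hq.intervalIntegrable _ _)]
        congr 1
        push_cast
        ring
      have e3 : ((m + 1 : ℕ) : ℝ) * h = m * h + h := by push_cast; ring
      rw [e2, Finset.sum_Icc_succ_top (by omega), e3]
      rw [abs_le] at ih e1 ⊢
      push_cast
      constructor <;> linarith
  have := key m
  rw [← hL, hper, sub_self, mul_zero, sub_zero] at this
  refine this.trans (le_of_eq ?_)
  rw [hL]
  ring

theorem abs_integral_integral_sub_sum_le {g : ℝ → ℝ → ℝ} {gu guu gv gvv : ℝ → ℝ → ℝ} {M h : ℝ}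
    (hh : 0 < h) (hg : Continuous (Function.uncurry g))
    (hu : ∀ u v, HasDerivAt (fun u => g u v) (gu u v) u)
    (huu : ∀ u v, HasDerivAt (fun u => gu u v) (guu u v) u)
    (hv : ∀ u v, HasDerivAt (fun v => g u v) (gv u v) v)
    (hvv : ∀ u v, HasDerivAt (fun v => gv u v) (gvv u v) v)
    (hMu : ∀ u v, |guu u v| ≤ M) (hMv : ∀ u v, |gvv u v| ≤ M)
    {m n : ℕ} {L₁ L₂ : ℝ} (hL₁ : L₁ = m * h) (hL₂ : L₂ = n * h)
    (hper₁ : ∀ v, g L₁ v = g 0 v) (hper₂ : ∀ u, g u L₂ = g u 0) :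
    |(∫ u in (0 : ℝ)..L₁, ∫ v in (0 : ℝ)..L₂, g u v)
      - h ^ 2 * ∑ k ∈ Finset.Icc 1 m, ∑ l ∈ Finset.Icc 1 n, g (k * h) (l * h)| ≤
      2 * M * L₁ * L₂ * h ^ 2 := by
  have hL₁0 : 0 ≤ L₁ := by rw [hL₁]; positivity
  have hL₂0 : 0 ≤ L₂ := by rw [hL₂]; positivity
  have c1 : Continuous fun u => ∫ v in (0 : ℝ)..L₂, g u v :=
    intervalIntegral.continuous_parametric_intervalIntegral_of_continuous' hg _ _
  have c2 : ∀ v, Continuous fun u => g u v := fun v => hg.comp (by fun_prop : Continuous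
    fun u : ℝ => (u, v))
  have c3 : Continuous fun u => h * ∑ l ∈ Finset.Icc 1 n, g u (l * h) :=
    continuous_const.mul (continuous_finsetSum _ fun l _ => c2 _)
  have e1 : |(∫ u in (0 : ℝ)..L₁, ∫ v in (0 : ℝ)..L₂, g u v)
      - ∫ u in (0 : ℝ)..L₁, h * ∑ l ∈ Finset.Icc 1 n, g u (l * h)| ≤ M * L₂ * h ^ 2 * L₁ := by
    rw [← intervalIntegral.integral_sub (c1.intervalIntegrable _ _) (c3.intervalIntegrable _ _)]
    have := intervalIntegral.norm_integral_le_of_norm_le_const (a := 0) (b := L₁)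
      (f := fun u => (∫ v in (0 : ℝ)..L₂, g u v) - h * ∑ l ∈ Finset.Icc 1 n, g u (l * h))
      (C := M * L₂ * h ^ 2)
      (fun u _ => abs_integral_sub_sum_le hh (hv u) (hvv u) (hMv u) hL₂ (hper₂ u))
    rwa [sub_zero, abs_of_nonneg hL₁0] at this
  have e2 : ∫ u in (0 : ℝ)..L₁, h * ∑ l ∈ Finset.Icc 1 n, g u (l * h) =
      h * ∑ l ∈ Finset.Icc 1 n, ∫ u in (0 : ℝ)..L₁, g u (l * h) := by
    rw [intervalIntegral.integral_const_mul, intervalIntegral.integral_finsetSum]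
    exact fun l _ => (c2 _).intervalIntegrable _ _
  have e3 : |h * ∑ l ∈ Finset.Icc 1 n, (∫ u in (0 : ℝ)..L₁, g u (l * h))
      - h * ∑ l ∈ Finset.Icc 1 n, h * ∑ k ∈ Finset.Icc 1 m, g (k * h) (l * h)| ≤
      M * L₁ * h ^ 2 * L₂ := by
    rw [← mul_sub, ← Finset.sum_sub_distrib, abs_mul, abs_of_pos hh]
    calc h * |∑ l ∈ Finset.Icc 1 n, ((∫ u in (0 : ℝ)..L₁, g u (l * h))
          - h * ∑ k ∈ Finset.Icc 1 m, g (k * h) (l * h))|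
        ≤ h * ∑ _l ∈ Finset.Icc 1 n, M * L₁ * h ^ 2 := by
          gcongr
          refine (Finset.abs_sum_le_sum_abs _ _).trans (Finset.sum_le_sum fun l _ => ?_)
          exact abs_integral_sub_sum_le hh (fun u => hu u _) (fun u => huu u _)
            (fun u => hMu u _) hL₁ (hper₁ _)
      _ = M * L₁ * h ^ 2 * L₂ := by rw [hL₂]; simp; ring
  have e4 : h * ∑ l ∈ Finset.Icc 1 n, h * ∑ k ∈ Finset.Icc 1 m, g (k * h) (l * h) =
      h ^ 2 * ∑ k ∈ Finset.Icc 1 m, ∑ l ∈ Finset.Icc 1 n, g (k * h) (l * h) := by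
    rw [← Finset.mul_sum, Finset.sum_comm]
    ring
  rw [e2] at e1
  rw [e4] at e3
  rw [abs_le] at e1 e3 ⊢
  constructor <;> linarith

end Quadrature

/-! ### Convolution with a smooth kernel -/

section PlaneConvolution

variable {L₁ L₂ T : ℝ} {J F : ℝ × ℝ × ℝ → ℝ}

/-- Periodic convolution of functions on the plane. -/
def planeConv (L₁ L₂ : ℝ) (J f : ℝ × ℝ → ℝ) (p : ℝ × ℝ) : ℝ :=
  ∫ u in (0 : ℝ)..L₁, ∫ v in (0 : ℝ)..L₂, J (u, v) * f (p - (u, v))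

/-- The quadrature of `planeConv` on an `m × n` grid of width `h`. -/
def planeSum (m n : ℕ) (h : ℝ) (J : ℝ × ℝ → ℝ) : (ℝ × ℝ → ℝ) →ₗ[ℝ] (ℝ × ℝ → ℝ) where
  toFun f p := h ^ 2 * ∑ k ∈ Finset.Icc 1 m, ∑ l ∈ Finset.Icc 1 n,
    J ((k : ℝ) * h, (l : ℝ) * h) * f (p - ((k : ℝ) * h, (l : ℝ) * h))
  map_add' f g := by ext p; simp only [Pi.add_apply, mul_add, Finset.sum_add_distrib]
  map_smul' c f := by
    ext p
    simp only [Pi.smul_apply, smul_eq_mul, RingHom.id_apply, Finset.mul_sum]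
    exact Finset.sum_congr rfl fun _ _ => Finset.sum_congr rfl fun _ _ => by ring

theorem planeSum_apply (m n : ℕ) (h : ℝ) (J f : ℝ × ℝ → ℝ) (p : ℝ × ℝ) :
    planeSum m n h J f p = h ^ 2 * ∑ k ∈ Finset.Icc 1 m, ∑ l ∈ Finset.Icc 1 n,
      J ((k : ℝ) * h, (l : ℝ) * h) * f (p - ((k : ℝ) * h, (l : ℝ) * h)) := rfl

theorem planeSum_trans (m n : ℕ) (h : ℝ) (J : ℝ × ℝ → ℝ) (c : ℝ × ℝ) (f : ℝ × ℝ → ℝ) :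
    planeSum m n h J (trans c f) = trans c (planeSum m n h J f) := by
  ext p
  simp only [planeSum_apply, trans_apply, sub_add_eq_add_sub]

theorem continuous_dqs_plane (d : Bool → ℝ × ℝ) (h : ℝ) (w : List Bool) {f : ℝ × ℝ → ℝ}
    (hf : Continuous f) : Continuous (dqs d h w f) := by
  induction w generalizing f with
  | nil => exact hf
  | cons b w ih =>
    refine ih (f := dq d h b f) ?_
    exact ((hf.comp (continuous_id.add continuous_const)).sub hf).div_const _

/-- The shift and the two coefficients make this cover both a difference quotient and, with q = 0,
the sum of the two second derivatives. -/
theorem planeConv_linear (L₁ L₂ : ℝ) {J f g : ℝ × ℝ → ℝ} (hJ : Continuous J) (hf : Continuous f)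
    (hg : Continuous g) (a b : ℝ) (p q : ℝ × ℝ) :
    planeConv L₁ L₂ J (fun x => a * f (x + q) + b * g x) p =
      a * planeConv L₁ L₂ J f (p + q) + b * planeConv L₁ L₂ J g p := by
  have c1 : Continuous (Function.uncurry fun u v => a * (J (u, v) * f (p + q - (u, v)))) := by
    simp only [Function.uncurry_def]
    fun_prop
  have c2 : Continuous (Function.uncurry fun u v => b * (J (u, v) * g (p - (u, v)))) := by
    simp only [Function.uncurry_def]
    fun_prop
  have e1 : ∀ u v, J (u, v) * (a * f (p - (u, v) + q) + b * g (p - (u, v))) =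
      a * (J (u, v) * f (p + q - (u, v))) + b * (J (u, v) * g (p - (u, v))) := fun u v => by
    rw [sub_add_eq_add_sub]
    ring
  have c1' : ∀ u, Continuous fun v => a * (J (u, v) * f (p + q - (u, v))) :=
    fun u => by fun_prop
  have c2' : ∀ u, Continuous fun v => b * (J (u, v) * g (p - (u, v))) := fun u => by fun_prop
  simp only [planeConv, e1]
  simp only [← intervalIntegral.integral_const_mul]
  rw [← intervalIntegral.integral_add
    ((intervalIntegral.continuous_parametric_intervalIntegral_of_continuous' c1
      0 L₂).intervalIntegrable _ _)
    ((intervalIntegral.continuous_parametric_intervalIntegral_of_continuous' c2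
      0 L₂).intervalIntegrable _ _)]
  congr 1
  ext u
  exact intervalIntegral.integral_add ((c1' u).intervalIntegrable _ _)
    ((c2' u).intervalIntegrable _ _)

theorem dqs_planeConv (d : Bool → ℝ × ℝ) (h : ℝ) (w : List Bool) {J f : ℝ × ℝ → ℝ}
    (hJ : Continuous J) (hf : Continuous f) :
    dqs d h w (planeConv L₁ L₂ J f) = planeConv L₁ L₂ J (dqs d h w f) := by
  induction w generalizing f with
  | nil => rfl
  | cons b w ih =>
    have e : dq d h b (planeConv L₁ L₂ J f) = planeConv L₁ L₂ J (dq d h b f) := by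
      ext p
      have e1 : dq d h b f = fun x => h⁻¹ * f (x + d b) + -h⁻¹ * f x := by
        ext x
        rw [dq_apply]
        ring
      rw [e1, planeConv_linear L₁ L₂ hJ hf hf, dq_apply]
      ring
    have hc : Continuous (dq d h b f) := continuous_dqs_plane d h [b] hf
    rw [dqs_cons, e, ih hc, dqs_cons]

theorem dqs_planeSum (d : Bool → ℝ × ℝ) (h : ℝ) (w : List Bool) (m n : ℕ) (J f : ℝ × ℝ → ℝ) :
    dqs d h w (planeSum m n h J f) = planeSum m n h J (dqs d h w f) :=
  (dqs_comm_of_trans d h _ (planeSum_trans m n h J) w f).symm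

theorem hasDerivAt_mul_comp_neg {a a₁ c c₁ : ℝ → ℝ} (ha : ∀ r, HasDerivAt a (a₁ r) r)
    (hc : ∀ r, HasDerivAt c (c₁ r) r) (r : ℝ) :
    HasDerivAt (fun r => a r * c (-r)) (a₁ r * c (-r) - a r * c₁ (-r)) r := by
  have h1 : HasDerivAt (fun r => c (-r)) (-c₁ (-r)) r := by
    exact ((hc (-r)).comp r (hasDerivAt_neg r)).congr_deriv (by simp)
  exact ((ha r).mul h1).congr_deriv (by ring)

theorem SmoothPer.continuous_slice (hF : SmoothPer L₁ L₂ T F) {t : ℝ} (ht : t ∈ Icc 0 T) :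
    Continuous (slice F t) :=
  hF.smooth.continuousOn.comp_continuous (f := fun p : ℝ × ℝ => (p.1, p.2, t)) (by fun_prop)
    fun _ => mem_slab.2 ht

theorem SmoothPer.slice_sub_left (hF : SmoothPer L₁ L₂ T F) {t : ℝ} (ht : t ∈ Icc 0 T)
    (p : ℝ × ℝ) (v : ℝ) : slice F t (p - (L₁, v)) = slice F t (p - (0, v)) := by
  have := hF.left (p.1 - L₁) (p.2 - v) t ht
  rw [sub_add_cancel] at this
  simp [slice, this]

theorem SmoothPer.slice_sub_right (hF : SmoothPer L₁ L₂ T F) {t : ℝ} (ht : t ∈ Icc 0 T)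
    (p : ℝ × ℝ) (u : ℝ) : slice F t (p - (u, L₂)) = slice F t (p - (u, 0)) := by
  have := hF.right (p.1 - u) (p.2 - L₂) t ht
  rw [sub_add_cancel] at this
  simp [slice, this]

theorem dqs_periodic {A : Type*} [AddCommGroup A] (d : Bool → A) (h : ℝ) (w : List Bool)
    {f : A → ℝ} {q q' : A} (hf : ∀ p, f (p - q) = f (p - q')) (p : A) :
    dqs d h w f (p - q) = dqs d h w f (p - q') := by
  have h1 : trans (-q) f = trans (-q') f := by
    ext p
    simpa [sub_eq_add_neg] using hf p
  have h2 := congrFun (congrArg (dqs d h w) h1) p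
  simpa [dqs_trans, sub_eq_add_neg] using h2

/-- The quadrature of the convolution is of second order, uniformly in all difference quotients. -/
theorem SmoothPer.exists_dqBdd_conv (hJ : SmoothPer L₁ L₂ T J) (hF : SmoothPer L₁ L₂ T F)
    (hL₁ : 0 < L₁) (hL₂ : 0 < L₂) (hT : 0 < T) (r : ℕ) :
    ∃ M, ∀ (m n : ℕ) (h : ℝ), 0 < h → L₁ = m * h → L₂ = n * h → ∀ t ∈ Icc 0 T,
      DqBdd (planeStep h) h r (M * h ^ 2)
        (planeConv L₁ L₂ (slice J 0) (slice F t) - planeSum m n h (slice J 0) (slice F t)) := by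
  have h0 : (0 : ℝ) ∈ Icc 0 T := ⟨le_rfl, hT.le⟩
  have bd : ∀ G, SmoothPer L₁ L₂ T G → ∃ M, ∀ b, ∀ h > 0, ∀ t ∈ Icc 0 T,
      DqBdd (planeStep h) h r M (slice G t) ∧
      DqBdd (planeStep h) h r M (slice (part T (spaceDir b) G) t) ∧
      DqBdd (planeStep h) h r M (slice (part T (spaceDir b) (part T (spaceDir b) G)) t) := by
    intro G hG
    obtain ⟨M₀, hM₀⟩ := hG.exists_dqBdd hL₁ hL₂ hT r
    obtain ⟨M₁, hM₁⟩ := (hG.of_part hT (spaceDir true)).exists_dqBdd hL₁ hL₂ hT r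
    obtain ⟨M₂, hM₂⟩ := (hG.of_part hT (spaceDir false)).exists_dqBdd hL₁ hL₂ hT r
    obtain ⟨M₃, hM₃⟩ := ((hG.of_part hT (spaceDir true)).of_part hT
      (spaceDir true)).exists_dqBdd hL₁ hL₂ hT r
    obtain ⟨M₄, hM₄⟩ := ((hG.of_part hT (spaceDir false)).of_part hT
      (spaceDir false)).exists_dqBdd hL₁ hL₂ hT r
    have n0 := (hM₀ 1 one_pos 0 h0).nonneg
    have n1 := (hM₁ 1 one_pos 0 h0).nonneg
    have n2 := (hM₂ 1 one_pos 0 h0).nonneg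
    have n3 := (hM₃ 1 one_pos 0 h0).nonneg
    have n4 := (hM₄ 1 one_pos 0 h0).nonneg
    refine ⟨M₀ + M₁ + M₂ + M₃ + M₄, fun b h hh t ht =>
      ⟨(hM₀ h hh t ht).mono_const (by linarith), ?_, ?_⟩⟩
    · cases b
      · exact (hM₂ h hh t ht).mono_const (by linarith)
      · exact (hM₁ h hh t ht).mono_const (by linarith)
    · cases b
      · exact (hM₄ h hh t ht).mono_const (by linarith)
      · exact (hM₃ h hh t ht).mono_const (by linarith)
  obtain ⟨MJ, hMJ⟩ := bd J hJ
  obtain ⟨MF, hMF⟩ := bd F hF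
  refine ⟨2 * (4 * (MJ * MF)) * L₁ * L₂, fun m n h hh hm hn t ht w hw p => ?_⟩
  have hJc := hJ.continuous_slice h0
  have hFc := hF.continuous_slice ht
  -- All difference quotients are moved onto the second factor; what remains is the quadrature error
  -- of one smooth periodic integrand, whose first and second derivatives are `g₁` and `g₂` below.
  rw [map_sub, dqs_planeConv _ _ _ hJc hFc, dqs_planeSum, Pi.sub_apply, planeConv, planeSum_apply]
  set D : (ℝ × ℝ × ℝ → ℝ) → ℝ × ℝ → ℝ := fun G => dqs (planeStep h) h w (slice G t) with hD
  have hDc : Continuous (D F) := continuous_dqs_plane _ _ _ hFc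
  have dJ : ∀ G, SmoothPer L₁ L₂ T G → ∀ (b : Bool) (q : ℝ × ℝ) (r : ℝ),
      HasDerivAt (fun r => slice G 0 (q + planeStep r b))
        (slice (part T (spaceDir b) G) 0 (q + planeStep r b)) r :=
    fun G hG b q r => hG.hasDerivAt_space b q h0 r
  have dF : ∀ G, SmoothPer L₁ L₂ T G → ∀ (b : Bool) (q : ℝ × ℝ) (r : ℝ),
      HasDerivAt (fun r => D G (q + planeStep r b))
        (D (part T (spaceDir b) G) (q + planeStep r b)) r :=
    fun G hG b q r => hasDerivWithinAt_univ.1 (hG.hasDerivWithinAt_dqs_space h w b q ht r)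
  set g₁ : Bool → ℝ × ℝ → ℝ := fun b x => slice (part T (spaceDir b) J) 0 x * D F (p - x)
    - slice J 0 x * D (part T (spaceDir b) F) (p - x) with hg₁
  set g₂ : Bool → ℝ × ℝ → ℝ := fun b x =>
    (slice (part T (spaceDir b) (part T (spaceDir b) J)) 0 x * D F (p - x)
      - slice (part T (spaceDir b) J) 0 x * D (part T (spaceDir b) F) (p - x))
    - (slice (part T (spaceDir b) J) 0 x * D (part T (spaceDir b) F) (p - x)
      - slice J 0 x * D (part T (spaceDir b) (part T (spaceDir b) F)) (p - x)) with hg₂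
  have epl : ∀ (b : Bool) (q : ℝ × ℝ) (r : ℝ),
      p - (q + planeStep r b) = (p - q) + planeStep (-r) b := fun b q r => by
    rw [planeStep_neg]; abel
  have k1 : ∀ (b : Bool) (q : ℝ × ℝ) (r : ℝ),
      HasDerivAt (fun r => slice J 0 (q + planeStep r b) * D F (p - (q + planeStep r b)))
        (g₁ b (q + planeStep r b)) r := fun b q r => by
    simp only [hg₁, epl]
    exact hasDerivAt_mul_comp_neg (fun r => dJ J hJ b q r) (fun r => dF F hF b (p - q) r) r
  have k2 : ∀ (b : Bool) (q : ℝ × ℝ) (r : ℝ),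
      HasDerivAt (fun r => g₁ b (q + planeStep r b)) (g₂ b (q + planeStep r b)) r :=
    fun b q r => by
    simp only [hg₁, hg₂, epl]
    exact (hasDerivAt_mul_comp_neg (fun r => dJ _ (hJ.of_part hT _) b q r)
      (fun r => dF F hF b (p - q) r) r).sub
      (hasDerivAt_mul_comp_neg (fun r => dJ J hJ b q r)
        (fun r => dF _ (hF.of_part hT _) b (p - q) r) r)
  have kM : ∀ b x, |g₂ b x| ≤ 4 * (MJ * MF) := by
    intro b x
    obtain ⟨a0, a1, a2⟩ := hMJ b h hh 0 h0
    obtain ⟨c0, c1, c2⟩ := hMF b h hh t ht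
    have hm : ∀ {y z : ℝ}, |y| ≤ MJ → |z| ≤ MF → |y * z| ≤ MJ * MF := fun hy hz => by
      rw [abs_mul]
      exact mul_le_mul hy hz (abs_nonneg _) ((abs_nonneg _).trans hy)
    have m1 := abs_le.1 (hm (a2.le x) (c0 w hw (p - x)))
    have m2 := abs_le.1 (hm (a1.le x) (c1 w hw (p - x)))
    have m3 := abs_le.1 (hm (a0.le x) (c2 w hw (p - x)))
    simp only [hg₂, hD]
    rw [abs_le]
    constructor <;> linarith
  have ex : ∀ u v : ℝ, (u, v) = (0, v) + planeStep u false := fun u v => by simp [planeStep]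
  have ey : ∀ u v : ℝ, (u, v) = (u, 0) + planeStep v true := fun u v => by simp [planeStep]
  refine abs_integral_integral_sub_sum_le (g := fun u v => slice J 0 (u, v) * D F (p - (u, v)))
    (gu := fun u v => g₁ false (u, v)) (guu := fun u v => g₂ false (u, v))
    (gv := fun u v => g₁ true (u, v)) (gvv := fun u v => g₂ true (u, v)) hh ?_
    (fun u v => ?_) (fun u v => ?_) (fun u v => ?_) (fun u v => ?_) (fun u v => kM _ _)
    (fun u v => kM _ _) hm hn (fun v => ?_) (fun u => ?_)
  · simp only [Function.uncurry_def]
    fun_prop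
  · have := k1 false (0, v) u
    simp only [← ex] at this
    exact this
  · have := k2 false (0, v) u
    simp only [← ex] at this
    exact this
  · have := k1 true (u, 0) v
    simp only [← ey] at this
    exact this
  · have := k2 true (u, 0) v
    simp only [← ey] at this
    exact this
  · have e1 := hJ.left 0 v 0 h0
    rw [zero_add] at e1
    have e2 := dqs_periodic (planeStep h) h w (f := slice F t) (q := (L₁, v)) (q' := (0, v))
      (fun p => hF.slice_sub_left ht p v) p
    simp only [hD, e2]
    simp only [slice, e1]
  · have e1 := hJ.right u 0 0 h0
    rw [zero_add] at e1
    have e2 := dqs_periodic (planeStep h) h w (f := slice F t) (q := (u, L₂)) (q' := (u, 0))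
      (fun p => hF.slice_sub_right ht p u) p
    simp only [hD, e2]
    simp only [slice, e1]

theorem hasDerivAt_integral_of_continuous {q q' : ℝ → ℝ → ℝ}
    (hq : Continuous (Function.uncurry q)) (hq' : Continuous (Function.uncurry q'))
    (hd : ∀ r u, HasDerivAt (fun r => q r u) (q' r u) r) (a b r : ℝ) :
    HasDerivAt (fun r => ∫ u in a..b, q r u) (∫ u in a..b, q' r u) r := by
  obtain ⟨C, hC⟩ := ((isCompact_closedBall r 1).prod (isCompact_uIcc (a := a)
    (b := b))).exists_bound_of_continuousOn hq'.continuousOn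
  have c1 : ∀ r, Continuous (q r) := fun r => hq.comp (by fun_prop : Continuous fun u : ℝ => (r, u))
  have c2 : ∀ r, Continuous (q' r) :=
    fun r => hq'.comp (by fun_prop : Continuous fun u : ℝ => (r, u))
  refine (intervalIntegral.hasDerivAt_integral_of_dominated_loc_of_deriv_le
    (Metric.closedBall_mem_nhds r one_pos) (bound := fun _ => C)
    (Filter.Eventually.of_forall fun r => (c1 r).aestronglyMeasurable)
    ((c1 r).intervalIntegrable _ _) (c2 r).aestronglyMeasurable
    (Filter.Eventually.of_forall fun u hu x hx => hC (x, u) ⟨hx, uIoc_subset_uIcc hu⟩)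
    intervalIntegrable_const (Filter.Eventually.of_forall fun u _ x _ => hd x u)).2

theorem hasDerivAt_planeConv {J f f' : ℝ × ℝ → ℝ} (hJ : Continuous J) (hf : Continuous f)
    (hf' : Continuous f') (b : Bool)
    (hd : ∀ p r, HasDerivAt (fun r => f (p + planeStep r b)) (f' (p + planeStep r b)) r)
    (p : ℝ × ℝ) (r : ℝ) :
    HasDerivAt (fun r => planeConv L₁ L₂ J f (p + planeStep r b))
      (planeConv L₁ L₂ J f' (p + planeStep r b)) r := by
  have cs : Continuous fun r : ℝ => planeStep r b := by
    cases b <;> simp only [planeStep, cond_true, cond_false] <;> fun_prop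
  unfold planeConv
  refine hasDerivAt_integral_of_continuous
    (q := fun r u => ∫ v in (0 : ℝ)..L₂, J (u, v) * f (p + planeStep r b - (u, v)))
    (q' := fun r u => ∫ v in (0 : ℝ)..L₂, J (u, v) * f' (p + planeStep r b - (u, v)))
    ?_ ?_ (fun r u => ?_) 0 L₁ r
  · exact intervalIntegral.continuous_parametric_intervalIntegral_of_continuous'
      (f := fun (x : ℝ × ℝ) v => J (x.2, v) * f (p + planeStep x.1 b - (x.2, v)))
      (by simp only [Function.uncurry_def]; fun_prop) 0 L₂
  · exact intervalIntegral.continuous_parametric_intervalIntegral_of_continuous'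
      (f := fun (x : ℝ × ℝ) v => J (x.2, v) * f' (p + planeStep x.1 b - (x.2, v)))
      (by simp only [Function.uncurry_def]; fun_prop) 0 L₂
  · refine hasDerivAt_integral_of_continuous
      (q := fun r v => J (u, v) * f (p + planeStep r b - (u, v)))
      (q' := fun r v => J (u, v) * f' (p + planeStep r b - (u, v)))
      (by simp only [Function.uncurry_def]; fun_prop)
      (by simp only [Function.uncurry_def]; fun_prop) (fun r v => ?_) 0 L₂ r
    have := (hd (p - (u, v)) r).const_mul (J (u, v))
    simpa only [sub_add_eq_add_sub] using this

end PlaneConvolution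

/-! ### Consistency of the scheme -/

section Consistency

theorem lap_comm_of_trans {A : Type*} [AddCommGroup A] (d : Bool → A) (h : ℝ)
    (S : (A → ℝ) →ₗ[ℝ] (A → ℝ)) (hS : ∀ c f, S (trans c f) = trans c (S f)) (f : A → ℝ) :
    S (lap d h f) = lap d h (S f) := by
  rw [lap_eq_sum_dq, lap_eq_sum_dq, map_sum]
  refine Finset.sum_congr rfl fun b _ => ?_
  rw [hS, dq_comm_of_trans d h b S hS, dq_comm_of_trans d h b S hS]

theorem DqBdd.planeSum {m n : ℕ} {h MJ M L₁ L₂ : ℝ} (hL₁ : L₁ = m * h)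
    (hL₂ : L₂ = n * h) {J f : ℝ × ℝ → ℝ} (hJ : ∀ p, |J p| ≤ MJ) {d : Bool → ℝ × ℝ} {r : ℕ}
    (hf : DqBdd d h r M f) :
    DqBdd d h r (L₁ * L₂ * MJ * M) (planeSum m n h J f) := by
  intro w hw p
  rw [dqs_planeSum, planeSum_apply, abs_mul, abs_of_nonneg (sq_nonneg h)]
  have hMJ : 0 ≤ MJ := (abs_nonneg _).trans (hJ 0)
  calc h ^ 2 * |∑ k ∈ Finset.Icc 1 m, ∑ l ∈ Finset.Icc 1 n,
        J ((k : ℝ) * h, (l : ℝ) * h) * dqs d h w f (p - ((k : ℝ) * h, (l : ℝ) * h))|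
      ≤ h ^ 2 * ∑ _k ∈ Finset.Icc 1 m, ∑ _l ∈ Finset.Icc 1 n, MJ * M := by
        gcongr
        refine (Finset.abs_sum_le_sum_abs _ _).trans (Finset.sum_le_sum fun k _ => ?_)
        refine (Finset.abs_sum_le_sum_abs _ _).trans (Finset.sum_le_sum fun l _ => ?_)
        rw [abs_mul]
        exact mul_le_mul (hJ _) (hf w hw _) (abs_nonneg _) hMJ
    _ = L₁ * L₂ * MJ * M := by rw [hL₁, hL₂]; simp; ring

/-- The truncation error of the scheme on the plane, for the extrapolated value `ext`. -/
def trunc (m n : ℕ) (h s Bc Be : ℝ) (J ext cur next : ℝ × ℝ → ℝ) : ℝ × ℝ → ℝ :=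
  s⁻¹ • (next - cur) - lap (planeStep h) h ((fun p => eta (cur p) (next p))
    + Bc • ((1 / 2 : ℝ) • (next + cur)) - Be • ext - planeSum m n h J ext)

variable {L₁ L₂ T : ℝ} {J Φ : ℝ × ℝ × ℝ → ℝ}

/-- The truncation error in terms of the errors of the individual approximations. -/
theorem trunc_eq {m n : ℕ} {h s Bc Be κ : ℝ} {j ext cur next mid dt cub lapcub lapmid cv :
    ℝ × ℝ → ℝ} (hpde : dt = lapcub + (κ + Bc - Be) • lapmid - cv) :
    trunc m n h s Bc Be j ext cur next =
      (s⁻¹ • (next - cur) - dt) + (lapcub - lap (planeStep h) h cub)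
      + lap (planeStep h) h (cub - (fun p => eta (cur p) (next p)))
      + κ • lapmid + (Bc - Be) • (lapmid - lap (planeStep h) h mid)
      + Bc • lap (planeStep h) h (mid - (1 / 2 : ℝ) • (next + cur))
      - Be • lap (planeStep h) h (mid - ext)
      - (cv - planeSum m n h j lapmid)
      - planeSum m n h j (lapmid - lap (planeStep h) h mid)
      - planeSum m n h j (lap (planeStep h) h (mid - ext)) := by
  rw [trunc, hpde]
  simp only [map_sub, map_add, map_smul,
    lap_comm_of_trans (planeStep h) h _ (planeSum_trans m n h j)]
  ext p
  simp only [Pi.add_apply, Pi.sub_apply, Pi.smul_apply, smul_eq_mul]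
  ring

/-- The extrapolation error is kept as a parameter δ, so that the first step (δ = s) and the later
ones (δ = s²) are treated together. Two extra orders are required of it because the discrete
Laplacian is applied to it. -/
theorem exists_trunc_bound (hL₁ : 0 < L₁) (hL₂ : 0 < L₂) (hT : 0 < T)
    (hJ : SmoothPer L₁ L₂ T J) (hΦ : SmoothPer L₁ L₂ T Φ) (cm : ℝ)
    (hpde : ∀ t ∈ Ioc 0 T, slice (part T timeDir Φ) t =
      slice (spaceLap T fun p => Φ p * (Φ p * Φ p)) t + cm • slice (spaceLap T Φ) t
        - planeConv L₁ L₂ (slice J 0) (slice (spaceLap T Φ) t)) (MB Mκ ME : ℝ) (r : ℕ) :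
    ∃ M, 0 ≤ M ∧ ∀ (m n : ℕ) (h s δ Bc Be t : ℝ) (ext : ℝ × ℝ → ℝ), 0 < h → L₁ = m * h →
      L₂ = n * h → 0 < s → |Bc| ≤ MB → |Be| ≤ MB → |cm - (Bc - Be)| ≤ Mκ * h ^ 2 → 0 ≤ t →
      t + s ≤ T → 0 ≤ δ → DqBdd (planeStep h) h (r + 2) (ME * δ) (slice Φ (t + s / 2) - ext) →
      DqBdd (planeStep h) h r (M * (s ^ 2 + h ^ 2 + δ))
        (trunc m n h s Bc Be (slice J 0) ext (slice Φ t) (slice Φ (t + s))) := by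
  have hC : SmoothPer L₁ L₂ T fun p => Φ p * (Φ p * Φ p) := hΦ.mul (hΦ.mul hΦ)
  have h0 : (0 : ℝ) ∈ Icc 0 T := ⟨le_rfl, hT.le⟩
  obtain ⟨M₁, hM₁⟩ := hΦ.exists_dqBdd_timeDeriv hL₁ hL₂ hT r
  obtain ⟨M₂, hM₂⟩ := hC.exists_dqBdd_lap hL₁ hL₂ hT r
  obtain ⟨M₃, hM₃⟩ := hC.exists_dqBdd_midpoint hL₁ hL₂ hT (r + 2)
  obtain ⟨M₄, hM₄⟩ := hΦ.exists_dqBdd hL₁ hL₂ hT (r + 2)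
  obtain ⟨M₅, hM₅⟩ := hΦ.exists_dqBdd_sub hL₁ hL₂ hT (r + 2)
  obtain ⟨M₆, hM₆⟩ := (hΦ.of_spaceLap hT).exists_dqBdd hL₁ hL₂ hT r
  obtain ⟨M₇, hM₇⟩ := hΦ.exists_dqBdd_lap hL₁ hL₂ hT r
  obtain ⟨M₈, hM₈⟩ := hΦ.exists_dqBdd_midpoint hL₁ hL₂ hT (r + 2)
  obtain ⟨M₉, hM₉⟩ := hJ.exists_dqBdd_conv (hΦ.of_spaceLap hT) hL₁ hL₂ hT r
  obtain ⟨MJ, hMJ⟩ := hJ.exists_bound hL₁ hL₂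
  set V := L₁ * L₂ * MJ with hV
  set Mη := 2 ^ (r + 2) * (2 ^ (r + 2) * (M₅ * M₅) * (M₄ + M₄)) with hMη
  have hMJ' : ∀ p, |slice J 0 p| ≤ MJ := fun p => hMJ _ (mem_slab.2 h0)
  set M' := |M₁| + |M₂| + 2 * (|M₃| + |Mη|) + |Mκ| * |M₆| + 2 * |MB| * |M₇| + |MB| * (2 * |M₈|)
    + |MB| * (2 * |ME|) + |M₉| + |V| * |M₇| + |V| * (2 * |ME|) with hM'
  refine ⟨M', by positivity, ?_⟩
  intro m n h s δ Bc Be t ext hh hm hn hs hBc hBe hκ ht hts hδ hext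
  have htI : t ∈ Icc 0 T := ⟨ht, by linarith⟩
  have htsI : t + s ∈ Icc 0 T := ⟨by linarith, hts⟩
  have hmidI : t + s / 2 ∈ Icc 0 T := ⟨by linarith, by linarith⟩
  -- The equation is used at the half step, which is positive even for t = 0.
  have hpde' := hpde (t + s / 2) ⟨by linarith, hmidI.2⟩
  rw [show cm = (cm - (Bc - Be)) + Bc - Be by ring] at hpde'
  rw [trunc_eq (mid := slice Φ (t + s / 2))
    (cub := slice (fun p => Φ p * (Φ p * Φ p)) (t + s / 2)) hpde']
  have b1 := hM₁ h hh t s hs htI htsI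
  have b2 := hM₂ h hh _ hmidI
  have b3 : DqBdd (planeStep h) h r (2 * ((|M₃| + |Mη|) * s ^ 2))
      (lap (planeStep h) h (slice (fun p => Φ p * (Φ p * Φ p)) (t + s / 2)
        - fun p => eta (slice Φ t p) (slice Φ (t + s) p))) := by
    refine DqBdd.lap ?_
    -- This rests on η(a, b) = (a³ + b³)/2 - (b - a)²(a + b)/4, whose last term is O(s²).
    have e : slice (fun p => Φ p * (Φ p * Φ p)) (t + s / 2)
        - (fun p => eta (slice Φ t p) (slice Φ (t + s) p)) =
        (slice (fun p => Φ p * (Φ p * Φ p)) (t + s / 2)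
          - (1 / 2 : ℝ) • (slice (fun p => Φ p * (Φ p * Φ p)) (t + s)
            + slice (fun p => Φ p * (Φ p * Φ p)) t))
        + (1 / 4 : ℝ) • ((slice Φ (t + s) - slice Φ t) * (slice Φ (t + s) - slice Φ t)
          * (slice Φ t + slice Φ (t + s))) := by
      ext p
      simp only [slice, eta, Pi.add_apply, Pi.sub_apply, Pi.smul_apply, Pi.mul_apply, smul_eq_mul]
      ring
    rw [e]
    have c1 := hM₅ h hh t htI (t + s) htsI
    rw [add_sub_cancel_left, abs_of_pos hs] at c1
    refine ((hM₃ h hh t s htI htsI).add (((c1.mul c1).mul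
      ((hM₄ h hh t htI).add (hM₄ h hh _ htsI))).smul _)).mono_const ?_
    have e2 : |(1 / 4 : ℝ)| * (2 ^ (r + 2) * (2 ^ (r + 2) * (M₅ * s * (M₅ * s)) * (M₄ + M₄))) =
        1 / 4 * (Mη * s ^ 2) := by rw [abs_of_pos (by norm_num), hMη]; ring
    rw [e2]
    have k1 : M₃ * s ^ 2 ≤ |M₃| * s ^ 2 := by gcongr; exact le_abs_self _
    have k2 : Mη * s ^ 2 ≤ |Mη| * s ^ 2 := by gcongr; exact le_abs_self _
    have k3 : 0 ≤ |Mη| * s ^ 2 := by positivity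
    linarith
  have b4 := (hM₆ h hh _ hmidI).smul (cm - (Bc - Be))
  have b5 := (hM₇ h hh _ hmidI).smul (Bc - Be)
  have b6 := ((hM₈ h hh t s htI htsI).lap).smul Bc
  have b7 := (hext.lap).smul Be
  have b8 := hM₉ m n h hh hm hn _ hmidI
  have b9 := (hM₇ h hh _ hmidI).planeSum hm hn hMJ'
  have b10 := (hext.lap).planeSum hm hn hMJ'
  refine (((((((((b1.add b2).add b3).add b4).add b5).add b6).sub b7).sub b8).sub b9).sub
    b10).mono_const ?_
  set σ := s ^ 2 + h ^ 2 + δ with hσ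
  have hsσ : s ^ 2 ≤ σ := by linarith [sq_nonneg h]
  have hhσ : h ^ 2 ≤ σ := by linarith [sq_nonneg s]
  have hδσ : δ ≤ σ := by linarith [sq_nonneg h, sq_nonneg s]
  have hp : ∀ a b x : ℝ, |a| ≤ b → 0 ≤ x → x ≤ σ → a * x ≤ b * σ := fun a b x hab hx hxσ => by
    calc a * x ≤ b * x := by gcongr; exact (le_abs_self _).trans hab
      _ ≤ b * σ := by gcongr; exact (abs_nonneg _).trans hab
  have hBc' : |Bc| ≤ |MB| := hBc.trans (le_abs_self _)
  have hBe' : |Be| ≤ |MB| := hBe.trans (le_abs_self _)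
  have p1 := hp M₁ |M₁| (s ^ 2) le_rfl (sq_nonneg s) hsσ
  have p2 := hp M₂ |M₂| (h ^ 2) le_rfl (sq_nonneg h) hhσ
  have p3 := hp (2 * (|M₃| + |Mη|)) (2 * (|M₃| + |Mη|)) (s ^ 2)
    (by rw [abs_of_nonneg (by positivity)]) (sq_nonneg s) hsσ
  have p4 : |cm - (Bc - Be)| * M₆ ≤ |Mκ| * |M₆| * σ := by
    calc |cm - (Bc - Be)| * M₆ ≤ (|Mκ| * h ^ 2) * |M₆| :=
          mul_le_mul (hκ.trans (by gcongr; exact le_abs_self _)) (le_abs_self _)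
            ((hM₆ h hh _ hmidI).nonneg) (by positivity)
      _ ≤ (|Mκ| * σ) * |M₆| := by gcongr
      _ = _ := by ring
  have p5 := hp (|Bc - Be| * M₇) (2 * |MB| * |M₇|) (h ^ 2) (by
    rw [abs_mul, abs_abs]
    gcongr
    linarith [abs_sub Bc Be]) (sq_nonneg h) hhσ
  have p6 := hp (|Bc| * (2 * M₈)) (|MB| * (2 * |M₈|)) (s ^ 2) (by
    rw [abs_mul, abs_abs, abs_mul, abs_two]
    gcongr) (sq_nonneg s) hsσ
  have p7 := hp (|Be| * (2 * ME)) (|MB| * (2 * |ME|)) δ (by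
    rw [abs_mul, abs_abs, abs_mul, abs_two]
    gcongr) hδ hδσ
  have p8 := hp M₉ |M₉| (h ^ 2) le_rfl (sq_nonneg h) hhσ
  have p9 := hp (V * M₇) (|V| * |M₇|) (h ^ 2) (abs_mul _ _).le (sq_nonneg h) hhσ
  have p10 := hp (V * (2 * ME)) (|V| * (2 * |ME|)) δ (by rw [abs_mul V, abs_mul 2, abs_two]) hδ hδσ
  have e3 : M' * σ = |M₁| * σ + |M₂| * σ + 2 * (|M₃| + |Mη|) * σ + |Mκ| * |M₆| * σ
      + 2 * |MB| * |M₇| * σ + |MB| * (2 * |M₈|) * σ + |MB| * (2 * |ME|) * σ + |M₉| * σ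
      + |V| * |M₇| * σ + |V| * (2 * |ME|) * σ := by
    rw [hM']; ring
  rw [e3]
  linarith

end Consistency

/-! ### The equation in terms of directional derivatives -/

section Equation

theorem laplacian_eq_sum {f : ℝ × ℝ → ℝ} {f₁ f₂ : Bool → ℝ × ℝ → ℝ}
    (h₁ : ∀ b p r, HasDerivAt (fun r => f (p + planeStep r b)) (f₁ b (p + planeStep r b)) r)
    (h₂ : ∀ b p r, HasDerivAt (fun r => f₁ b (p + planeStep r b)) (f₂ b (p + planeStep r b)) r)
    (x y : ℝ) : laplacian (fun x y => f (x, y)) x y = ∑ b, f₂ b (x, y) := by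
  have hl : ∀ x, ((0, y) : ℝ × ℝ) + planeStep x false = (x, y) := fun x => by simp [planeStep]
  have hr : ∀ y, ((x, 0) : ℝ × ℝ) + planeStep y true = (x, y) := fun y => by simp [planeStep]
  have l₁ := h₁ false (0, y)
  have l₂ := h₂ false (0, y)
  have r₁ := h₁ true (x, 0)
  have r₂ := h₂ true (x, 0)
  simp only [hl] at l₁ l₂
  simp only [hr] at r₁ r₂
  rw [laplacian, iteratedDeriv_succ, iteratedDeriv_one, iteratedDeriv_succ, iteratedDeriv_one,
    deriv_eq l₁, deriv_eq r₁, (l₂ x).deriv, (r₂ y).deriv, Fintype.sum_bool, add_comm]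

variable {L₁ L₂ T : ℝ}

theorem SmoothPer.of_plane {J : ℝ → ℝ → ℝ} (hJ : ContDiff ℝ ∞ fun p : ℝ × ℝ => J p.1 p.2)
    (hper : IsPeriodic L₁ L₂ J) : SmoothPer L₁ L₂ T fun p => J p.1 p.2.1 :=
  ⟨(hJ.comp (contDiff_fst.prodMk contDiff_snd.fst)).contDiffOn, fun x y _ _ => (hper x y).1,
    fun x y _ _ => (hper x y).2⟩

theorem SmoothPer.of_isSmoothSolution {γc γe : ℝ} {J : ℝ → ℝ → ℝ} {Φ : ℝ → ℝ → ℝ → ℝ}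
    (hΦ : IsSmoothSolution L₁ L₂ γc γe J T Φ) :
    SmoothPer L₁ L₂ T fun p => Φ p.1 p.2.1 p.2.2 :=
  ⟨hΦ.smooth, fun x y t ht => (hΦ.periodic t ht x y).1, fun x y t ht => (hΦ.periodic t ht x y).2⟩

theorem SmoothPer.planeConv_spaceLap {Φ : ℝ × ℝ × ℝ → ℝ} (hΦ : SmoothPer L₁ L₂ T Φ) (hT : 0 < T)
    {j : ℝ × ℝ → ℝ} (hj : Continuous j) {t : ℝ} (ht : t ∈ Icc 0 T) (p : ℝ × ℝ) :
    planeConv L₁ L₂ j (slice (spaceLap T Φ) t) p =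
      ∑ b, planeConv L₁ L₂ j (slice (part T (spaceDir b) (part T (spaceDir b) Φ)) t) p := by
  have c : ∀ b, Continuous (slice (part T (spaceDir b) (part T (spaceDir b) Φ)) t) := fun b =>
    ((hΦ.of_part hT _).of_part hT _).continuous_slice ht
  have := planeConv_linear L₁ L₂ hj (c true) (c false) 1 1 p 0
  simp only [add_zero, one_mul] at this
  rw [Fintype.sum_bool, ← this]
  congr 1
  ext q
  simp [slice, spaceLap]

/-- The Laplacian is taken inside the convolution by differentiating under the integral, so that the
equation can be compared term by term with the scheme. -/
theorem IsSmoothSolution.slice_timeDeriv {γc γe : ℝ} {J : ℝ → ℝ → ℝ} {Φ : ℝ → ℝ → ℝ → ℝ}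
    (hΦ : IsSmoothSolution L₁ L₂ γc γe J T Φ) (hJ : ContDiff ℝ ∞ fun p : ℝ × ℝ => J p.1 p.2)
    (hT : 0 < T) {t : ℝ} (ht : t ∈ Ioc 0 T) :
    slice (part T timeDir fun p => Φ p.1 p.2.1 p.2.2) t =
      slice (spaceLap T fun p => Φ p.1 p.2.1 p.2.2 * (Φ p.1 p.2.1 p.2.2 * Φ p.1 p.2.1 p.2.2)) t
        + (γc - γe + kernelMass L₁ L₂ J) • slice (spaceLap T fun p => Φ p.1 p.2.1 p.2.2) t
        - planeConv L₁ L₂ (slice (fun p => J p.1 p.2.1) 0)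
            (slice (spaceLap T fun p => Φ p.1 p.2.1 p.2.2) t) := by
  have htI : t ∈ Icc 0 T := ⟨ht.1.le, ht.2⟩
  set F : ℝ × ℝ × ℝ → ℝ := fun p => Φ p.1 p.2.1 p.2.2
  have hF : SmoothPer L₁ L₂ T F := .of_isSmoothSolution hΦ
  set G : ℝ × ℝ × ℝ → ℝ := fun p => F p * (F p * F p)
  have hG : SmoothPer L₁ L₂ T G := hF.mul (hF.mul hF)
  set j := slice (fun p => J p.1 p.2.1) 0
  have hj : Continuous j := hJ.continuous
  set cm := γc - γe + kernelMass L₁ L₂ J with hcm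
  let comb : (ℝ × ℝ × ℝ → ℝ) → (ℝ × ℝ × ℝ → ℝ) → ℝ × ℝ → ℝ := fun u v p =>
    slice u t p + cm * slice v t p - planeConv L₁ L₂ j (slice v t) p
  have hcomb : ∀ {u v}, SmoothPer L₁ L₂ T u → SmoothPer L₁ L₂ T v → ∀ b p r,
      HasDerivAt (fun r => comb u v (p + planeStep r b))
        (comb (part T (spaceDir b) u) (part T (spaceDir b) v) (p + planeStep r b)) r :=
    fun hu hv b p r => ((hu.hasDerivAt_space b p htI r).add
      ((hv.hasDerivAt_space b p htI r).const_mul cm)).sub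
        (hasDerivAt_planeConv hj (hv.continuous_slice htI)
          ((hv.of_part hT _).continuous_slice htI) b (fun p r => hv.hasDerivAt_space b p htI r) p r)
  ext ⟨x, y⟩
  have e1 : chemPot L₁ L₂ γc γe J (fun x y => Φ x y t) = fun x y => comb G F (x, y) := by
    ext x y
    have : conv L₁ L₂ J (fun x y => Φ x y t) x y = planeConv L₁ L₂ j (slice F t) (x, y) := rfl
    simp only [chemPot, comb, this, hcm]
    simp only [G, F, slice]
    ring
  have e2 := hΦ.equation x y t ht
  rw [e1, laplacian_eq_sum (f₁ := fun b => comb (part T (spaceDir b) G) (part T (spaceDir b) F))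
    (fun b => hcomb hG hF b) (fun b => hcomb (hG.of_part hT _) (hF.of_part hT _) b)] at e2
  -- Both time derivatives are taken within [0, T], where they are unique.
  have e3 := (uniqueDiffOn_Icc hT t htI).eq_deriv _ (hF.hasDerivWithinAt_time (x, y) htI) e2
  rw [e3, Pi.sub_apply, Pi.add_apply, Pi.smul_apply, smul_eq_mul,
    hF.planeConv_spaceLap hT hj htI]
  simp only [comb, slice, spaceLap, Finset.sum_sub_distrib, Finset.sum_add_distrib, Finset.mul_sum]

end Equation

/-! ### Periodic grid functions as functions on a finite group -/

section Transfer

/-- The function on `ℤ/m × ℤ/n` given by a periodic grid function. -/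
def gridVal (m n : ℕ) (φ : ℤ → ℤ → ℝ) (a : ZMod m × ZMod n) : ℝ := φ a.1.val a.2.val

/-- The residue classes of a grid index. -/
def gridIdx (m n : ℕ) (i j : ℤ) : ZMod m × ZMod n := (i, j)

variable {m n : ℕ} [NeZero m] [NeZero n] {h : ℝ}

theorem IsGridPeriodic.gridVal_gridIdx {φ : ℤ → ℤ → ℝ} (hφ : IsGridPeriodic m n φ) (i j : ℤ) :
    gridVal m n φ (gridIdx m n i j) = φ i j := by
  have h1 : ∀ j, Function.Periodic (fun i => φ i j) (m : ℤ) := fun j i => (hφ i j).1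
  have h2 : ∀ i, Function.Periodic (fun j => φ i j) (n : ℤ) := fun i j => (hφ i j).2
  rw [gridVal, gridIdx, ZMod.val_intCast, ZMod.val_intCast, Int.emod_def, Int.emod_def,
    mul_comm, mul_comm (n : ℤ)]
  exact ((h1 _).sub_int_mul_eq (i / m)).trans ((h2 _).sub_int_mul_eq (j / n))

theorem exists_gridIdx (a : ZMod m × ZMod n) : ∃ i j : ℤ, gridIdx m n i j = a :=
  ⟨a.1.val, a.2.val, by simp [gridIdx]⟩

theorem lap_gridStep (g : ZMod m × ZMod n → ℝ) (i j : ℤ) :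
    lap (gridStep m n) h g (gridIdx m n i j) =
      gridLaplacian h (fun i j => g (gridIdx m n i j)) i j := by
  simp only [lap_apply, Fintype.sum_bool, gridLaplacian, gridStep, gridIdx, cond_true, cond_false,
    Prod.mk_add_mk, Prod.mk_sub_mk, add_zero, sub_zero, Int.cast_add, Int.cast_sub, Int.cast_one]
  ring

theorem sum_Icc_zmod (m : ℕ) [NeZero m] (F : ZMod m → ℝ) :
    ∑ k ∈ Finset.Icc 1 m, F (k : ZMod m) = ∑ z, F z := by
  rw [← sum_range_zmod m F, Finset.range_eq_Ico, ← Finset.Ico_add_one_right_eq_Icc,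
    Finset.sum_Ico_succ_top (NeZero.one_le), Finset.sum_eq_sum_Ico_succ_bot (NeZero.pos m)]
  simp [add_comm]

theorem gconv_gridIdx (f g : ZMod m × ZMod n → ℝ) (i j : ℤ) :
    gconv h f g (gridIdx m n i j) = gridConv m n h (fun i j => f (gridIdx m n i j))
      (fun i j => g (gridIdx m n i j)) i j := by
  rw [gconv_apply, gridConv, Fintype.sum_prod_type, ← sum_Icc_zmod m]
  congr 1
  refine Finset.sum_congr rfl fun k _ => ?_
  rw [← sum_Icc_zmod n]
  refine Finset.sum_congr rfl fun l _ => ?_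
  simp [gridIdx]

variable {r : ℕ} {M c : ℝ} {F J : ℝ × ℝ → ℝ} {g : ZMod m × ZMod n → ℝ}

/-- The point of the plane with grid coordinates `i + c`, `j + c`. -/
def gridPos (h c : ℝ) (i j : ℤ) : ℝ × ℝ := (gridPt h (i + c), gridPt h (j + c))

/-- Both functions pull back to the same function on ℤ × ℤ, along maps that respect the grid steps.
-/
theorem DqBdd.of_plane (hF : DqBdd (planeStep h) h r M F)
    (hg : ∀ i j, g (gridIdx m n i j) = F (gridPos h c i j)) : DqBdd (gridStep m n) h r M g := by
  intro w hw a
  obtain ⟨i, j, rfl⟩ := exists_gridIdx a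
  let d : Bool → ℤ × ℤ := fun b => cond b (0, 1) (1, 0)
  let p : ℤ × ℤ → ZMod m × ZMod n := fun a => gridIdx m n a.1 a.2
  let q : ℤ × ℤ → ℝ × ℝ := fun a => gridPos h c a.1 a.2
  have e1 := dqs_comp d (gridStep m n) h p (by
    rintro a (_ | _) <;> simp [p, d, gridIdx, gridStep]) w g
  have e2 := dqs_comp d (planeStep h) h q (by
    rintro a (_ | _) <;> simp [q, d, gridPos, gridPt, planeStep] <;> ring) w F
  have e3 : g ∘ p = F ∘ q := funext fun a => hg a.1 a.2
  rw [← e3, e1] at e2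
  have := congrFun e2 (i, j)
  simp only [Function.comp_apply, p] at this
  rw [this]
  exact hF w hw _

theorem lap_planeStep_gridPos (i j : ℤ) :
    lap (planeStep h) h F (gridPos h c i j) = gridLaplacian h (fun i j => F (gridPos h c i j)) i j := by
  have e1 : ∀ i j, gridPos h c (i + 1) j = gridPos h c i j + (h, 0) := fun i j => by
    simp [gridPos, gridPt]; ring
  have e2 : ∀ i j, gridPos h c (i - 1) j = gridPos h c i j - (h, 0) := fun i j => by
    simp [gridPos, gridPt]; ring
  have e3 : ∀ i j, gridPos h c i (j + 1) = gridPos h c i j + (0, h) := fun i j => by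
    simp [gridPos, gridPt]; ring
  have e4 : ∀ i j, gridPos h c i (j - 1) = gridPos h c i j - (0, h) := fun i j => by
    simp [gridPos, gridPt]; ring
  simp only [lap_apply, Fintype.sum_bool, gridLaplacian, planeStep, cond_true, cond_false, e1, e2,
    e3, e4]
  ring

/-- The vertex with indices k and l is the point (kh, lh), so the discrete convolution is exactly
the trapezoidal sum, whatever the offset c of the second factor. -/
theorem planeSum_gridPos (i j : ℤ) :
    planeSum m n h J F (gridPos h c i j) = gridConv m n h (fun i j => J (gridPos h (1 / 2) i j))
      (fun i j => F (gridPos h c i j)) i j := by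
  rw [planeSum_apply, gridConv]
  congr 1
  refine Finset.sum_congr rfl fun k _ => Finset.sum_congr rfl fun l _ => ?_
  congr 2
  · simp [gridPos, gridPt]
  · simp [gridPos, gridPt]
    constructor <;> ring

theorem isGridPeriodic_gridPos {L₁ L₂ : ℝ} (hL₁ : L₁ = m * h) (hL₂ : L₂ = n * h) {f : ℝ → ℝ → ℝ}
    (hf : IsPeriodic L₁ L₂ f) (c : ℝ) :
    IsGridPeriodic m n fun i j => f (gridPt h (i + c)) (gridPt h (j + c)) := by
  intro i j
  have e1 : gridPt h ((i + m : ℤ) + c) = gridPt h (i + c) + L₁ := by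
    rw [hL₁]; simp [gridPt]; ring
  have e2 : gridPt h ((j + n : ℤ) + c) = gridPt h (j + c) + L₂ := by
    rw [hL₂]; simp [gridPt]; ring
  simp only [e1, e2]
  exact hf _ _

/-! ### The discrete mass of the kernel -/

theorem gridMass_sub (m n : ℕ) (h : ℝ) (f g : ℝ → ℝ → ℝ) :
    gridMass m n h (fun x y => f x y - g x y) = gridMass m n h f - gridMass m n h g := by
  simp only [gridMass, gridConv, vertexRestrict, sub_mul, mul_sub, Finset.sum_sub_distrib]

theorem gridMass_nonneg {f : ℝ → ℝ → ℝ} (hf : ∀ x y, 0 ≤ f x y) (m n : ℕ) (h : ℝ) :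
    0 ≤ gridMass m n h f :=
  mul_nonneg (sq_nonneg h) (Finset.sum_nonneg fun _ _ => Finset.sum_nonneg fun _ _ =>
    mul_nonneg (hf _ _) zero_le_one)

theorem gridMass_eq_planeSum (m n : ℕ) (h : ℝ) (f : ℝ → ℝ → ℝ) :
    gridMass m n h f = planeSum m n h (fun p => f p.1 p.2) (fun _ => 1) 0 := by
  simp [gridMass, gridConv, planeSum_apply, vertexRestrict, gridPt]

variable {L₁ L₂ T : ℝ}

theorem SmoothPer.const (L₁ L₂ T a : ℝ) : SmoothPer L₁ L₂ T fun _ => a :=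
  ⟨contDiffOn_const, fun _ _ _ _ => rfl, fun _ _ _ _ => rfl⟩

theorem exists_gridMass_bound {f : ℝ → ℝ → ℝ} (hf : ContDiff ℝ ∞ fun p : ℝ × ℝ => f p.1 p.2)
    (hper : IsPeriodic L₁ L₂ f) (hL₁ : 0 < L₁) (hL₂ : 0 < L₂) :
    ∃ M, ∀ (m n : ℕ) (h : ℝ), 0 < h → L₁ = m * h → L₂ = n * h →
      |gridMass m n h f| ≤ M ∧ |kernelMass L₁ L₂ f - gridMass m n h f| ≤ M * h ^ 2 := by
  -- The time horizon 1 is arbitrary, as nothing here depends on time. The mass is then the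
  -- convolution with the constant 1 at the origin.
  have hs : SmoothPer L₁ L₂ 1 _ := .of_plane hf hper
  have h0 : (0 : ℝ) ∈ Icc (0 : ℝ) 1 := by simp
  obtain ⟨M₁, hM₁⟩ := hs.exists_bound hL₁ hL₂
  obtain ⟨M₂, hM₂⟩ := hs.exists_dqBdd_conv (.const L₁ L₂ 1 1) hL₁ hL₂ one_pos 0
  refine ⟨max (L₁ * L₂ * M₁ * 1) M₂, fun m n h hh hm hn => ⟨?_, ?_⟩⟩
  · have b : DqBdd (planeStep h) h 0 1 fun _ => (1 : ℝ) := fun w hw a => by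
      obtain rfl : w = [] := List.length_eq_zero_iff.1 (Nat.le_zero.1 hw)
      simp
    rw [gridMass_eq_planeSum]
    exact ((b.planeSum hm hn fun p => hM₁ (p.1, p.2, 0) (mem_slab.2 h0)).le 0).trans
      (le_max_left _ _)
  · have := (hM₂ m n h hh hm hn 0 h0).le 0
    rw [gridMass_eq_planeSum]
    have e : kernelMass L₁ L₂ f = planeConv L₁ L₂ (slice (fun p => f p.1 p.2.1) 0)
        (slice (fun _ => 1) 0) 0 := by
      simp [kernelMass, planeConv, slice]
    rw [e]
    refine this.trans ?_
    gcongr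
    exact le_max_right _ _

end Transfer

/-! ### The error equation of the scheme -/

section ErrorEquation

/-- The discrete chemical potential on a periodic grid. -/
def latticeChemPot {A : Type*} [AddCommGroup A] [Fintype A] (h Bc Be : ℝ) (J ext cur next : A → ℝ) :
    A → ℝ :=
  (fun x => eta (cur x) (next x)) + Bc • ((1 / 2 : ℝ) • (next + cur)) - Be • ext - gconv h J ext

/-- The second order extrapolation to the time `(k + 1/2) s` of a sequence. -/
def extrapolate {A : Type*} (u : ℕ → A → ℝ) (k : ℕ) : A → ℝ :=
  (3 / 2 : ℝ) • u k - (1 / 2 : ℝ) • u (k - 1)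

variable {m n : ℕ} [NeZero m] [NeZero n] {h s T γc γe : ℝ} {Jc Je : ℝ → ℝ → ℝ}

theorem IsNumericalSolution.gridVal_step {φ₀ : ℤ → ℤ → ℝ} {φ : ℕ → ℤ → ℤ → ℝ}
    (H : IsNumericalSolution m n h s T γc γe Jc Je φ₀ φ) (hs : 0 ≤ s)
    (hJ : IsGridPeriodic m n (vertexRestrict h fun x y => Jc x y - Je x y)) {k : ℕ}
    (hk : (k + 1 : ℕ) * s ≤ T) :
    gridVal m n (φ (k + 1)) - gridVal m n (φ k) = s • lap (gridStep m n) h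
      (latticeChemPot h (gridMass m n h Jc + γc) (gridMass m n h Je + γe)
        (gridVal m n (vertexRestrict h fun x y => Jc x y - Je x y))
        (extrapolate (fun k => gridVal m n (φ k)) k) (gridVal m n (φ k))
        (gridVal m n (φ (k + 1)))) := by
  have h1 := H.periodic _ hk
  have h0 := H.periodic _ (level_le_of_succ hs hk)
  have hp : IsGridPeriodic m n (φ (k - 1)) := by
    cases k with
    | zero => exact h0
    | succ k => exact H.periodic _ (level_le_of_succ hs (level_le_of_succ hs hk))
  -- Truncated subtraction, 0 - 1 = 0, reproduces the convention φ^{-1} = φ^0.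
  have hprev : prevLevel φ k = φ (k - 1) := by cases k <;> rfl
  ext a
  obtain ⟨i, j, rfl⟩ := exists_gridIdx a
  simp only [latticeChemPot, extrapolate, Pi.sub_apply, Pi.add_apply, Pi.smul_apply, smul_eq_mul,
    lap_gridStep, gconv_gridIdx, h1.gridVal_gridIdx, h0.gridVal_gridIdx, hp.gridVal_gridIdx,
    hJ.gridVal_gridIdx]
  rw [H.step k hk i j, hprev]
  congr 2
  ext i j
  rw [gridChemPot, add_comm (φ k i j)]

theorem trunc_gridPos {Bc Be c : ℝ} {J ext cur next : ℝ × ℝ → ℝ}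
    {J' ext' cur' next' : ZMod m × ZMod n → ℝ}
    (hJ : ∀ i j, J' (gridIdx m n i j) = J (gridPos h (1 / 2) i j))
    (hext : ∀ i j, ext' (gridIdx m n i j) = ext (gridPos h c i j))
    (hcur : ∀ i j, cur' (gridIdx m n i j) = cur (gridPos h c i j))
    (hnext : ∀ i j, next' (gridIdx m n i j) = next (gridPos h c i j)) (i j : ℤ) :
    (s⁻¹ • (next' - cur') - lap (gridStep m n) h (latticeChemPot h Bc Be J' ext' cur' next'))
      (gridIdx m n i j) = trunc m n h s Bc Be J ext cur next (gridPos h c i j) := by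
  simp only [latticeChemPot, trunc, Pi.sub_apply, Pi.add_apply, Pi.smul_apply, smul_eq_mul,
    lap_gridStep, lap_planeStep_gridPos, gconv_gridIdx, planeSum_gridPos, hJ, hext, hcur, hnext]

/-- An algebraic identity: the truncation error is by definition what the exact values leave over in
the scheme. -/
theorem error_step {A : Type*} [AddCommGroup A] [Fintype A] {d : Bool → A} {Bc Be : ℝ} (hs : s ≠ 0)
    {J : A → ℝ} {P V : ℕ → A → ℝ} {k : ℕ}
    (hV : V (k + 1) - V k =
      s • lap d h (latticeChemPot h Bc Be J (extrapolate V k) (V k) (V (k + 1)))) :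
    (P (k + 1) - V (k + 1)) - (P k - V k) =
      s • lap d h ((fun x => eta (P k x) (P (k + 1) x)
          - eta (P k x - (P k - V k) x) (P (k + 1) x - (P (k + 1) - V (k + 1)) x))
        + Bc • ((1 / 2 : ℝ) • ((P (k + 1) - V (k + 1)) + (P k - V k)))
        - Be • ((3 / 2 : ℝ) • (P k - V k) - (1 / 2 : ℝ) • (P (k - 1) - V (k - 1)))
        - gconv h J ((3 / 2 : ℝ) • (P k - V k) - (1 / 2 : ℝ) • (P (k - 1) - V (k - 1))))
      + s • (s⁻¹ • (P (k + 1) - P k)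
        - lap d h (latticeChemPot h Bc Be J (extrapolate P k) (P k) (P (k + 1)))) := by
  have e1 : (fun x => eta (P k x) (P (k + 1) x)
      - eta (P k x - (P k - V k) x) (P (k + 1) x - (P (k + 1) - V (k + 1)) x)) =
      (fun x => eta (P k x) (P (k + 1) x)) - fun x => eta (V k x) (V (k + 1) x) := by
    ext x
    simp
  have e2 : (3 / 2 : ℝ) • (P k - V k) - (1 / 2 : ℝ) • (P (k - 1) - V (k - 1)) =
      extrapolate P k - extrapolate V k := by
    simp only [extrapolate]
    module
  have e3 : (P (k + 1) - V (k + 1)) - (P k - V k) = (P (k + 1) - P k) - (V (k + 1) - V k) := by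
    abel
  have e4 : (P (k + 1) - V (k + 1)) + (P k - V k) = (P (k + 1) + P k) - (V (k + 1) + V k) := by
    abel
  rw [e1, e2, e3, e4, hV, smul_sub s (s⁻¹ • _), smul_inv_smul₀ hs]
  simp only [latticeChemPot, map_add, map_sub, map_smul, smul_sub, smul_add]
  abel

end ErrorEquation

/-! ### The numerical errors as an error sequence. -/

section Convergence

variable {L₁ L₂ T γc γe : ℝ} {Jc Je : ℝ → ℝ → ℝ} {Φ : ℝ → ℝ → ℝ → ℝ}

theorem IsKernelPart.sub_smooth (hJc : IsKernelPart L₁ L₂ Jc) (hJe : IsKernelPart L₁ L₂ Je) :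
    ContDiff ℝ ∞ fun p : ℝ × ℝ => Jc p.1 p.2 - Je p.1 p.2 :=
  hJc.smooth.sub hJe.smooth

theorem IsKernelPart.sub_periodic (hJc : IsKernelPart L₁ L₂ Jc) (hJe : IsKernelPart L₁ L₂ Je) :
    IsPeriodic L₁ L₂ fun x y => Jc x y - Je x y := fun x y => by
  simp only [(hJc.periodic x y).1, (hJc.periodic x y).2, (hJe.periodic x y).1,
    (hJe.periodic x y).2, and_self]

/-- The exact solution at the time level `k s`, on the grid. -/
def exactVal (m n : ℕ) (h s : ℝ) (Φ : ℝ → ℝ → ℝ → ℝ) (k : ℕ) : ZMod m × ZMod n → ℝ :=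
  gridVal m n (cellRestrict h fun x y => Φ x y (k * s))

theorem IsSmoothSolution.exactVal_gridIdx {m n : ℕ} [NeZero m] [NeZero n] {h s : ℝ}
    {J : ℝ → ℝ → ℝ} (hΦ : IsSmoothSolution L₁ L₂ γc γe J T Φ) (hm : L₁ = m * h) (hn : L₂ = n * h)
    (hs : 0 ≤ s) {k : ℕ} (hk : k * s ≤ T) (i j : ℤ) :
    exactVal m n h s Φ k (gridIdx m n i j) =
      slice (fun p => Φ p.1 p.2.1 p.2.2) (k * s) (gridPos h 0 i j) := by
  have := isGridPeriodic_gridPos hm hn (hΦ.periodic (k * s) ⟨by positivity, hk⟩) 0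
  simp only [add_zero] at this
  exact (IsGridPeriodic.gridVal_gridIdx this i j).trans (by simp [slice, gridPos])

theorem exists_isErrorSequence (hL₁ : 0 < L₁) (hL₂ : 0 < L₂) (hJc : IsKernelPart L₁ L₂ Jc)
    (hJe : IsKernelPart L₁ L₂ Je) (hT : 0 < T)
    (hΦ : IsSmoothSolution L₁ L₂ γc γe (fun x y => Jc x y - Je x y) T Φ) (K : ℝ) :
    ∃ M, 1 ≤ M ∧ ∀ (m n : ℕ) [NeZero m] [NeZero n] (h s : ℝ), 0 < h → L₁ = m * h → L₂ = n * h →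
      0 < s → s ≤ 1 → gridMass m n h Jc + γc ≤ M ∧ gridMass m n h Je + γe ≤ M ∧
      ∀ φ : ℕ → ℤ → ℤ → ℝ,
        IsNumericalSolution m n h s T γc γe Jc Je (cellRestrict h fun x y => Φ x y 0) φ →
        ∃ τ, IsErrorSequence (gridStep m n) M K T h s (gridMass m n h Jc + γc)
          (gridMass m n h Je + γe) (gridVal m n (vertexRestrict h fun x y => Jc x y - Je x y))
          (exactVal m n h s Φ) (fun k => exactVal m n h s Φ k - gridVal m n (φ k)) τ := by
  have hJs := hJc.sub_smooth hJe
  have hJp := hJc.sub_periodic hJe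
  have hJ : SmoothPer L₁ L₂ T _ := .of_plane hJs hJp
  have hF : SmoothPer L₁ L₂ T _ := .of_isSmoothSolution hΦ
  have h0 : (0 : ℝ) ∈ Icc 0 T := ⟨le_rfl, hT.le⟩
  obtain ⟨N₁, hN₁⟩ := exists_gridMass_bound hJc.smooth hJc.periodic hL₁ hL₂
  obtain ⟨N₂, hN₂⟩ := exists_gridMass_bound hJe.smooth hJe.periodic hL₁ hL₂
  obtain ⟨N₃, hN₃⟩ := exists_gridMass_bound hJs hJp hL₁ hL₂
  obtain ⟨M₁, hM₁⟩ := hJ.exists_dqBdd hL₁ hL₂ hT 1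
  obtain ⟨M₂, hM₂⟩ := hF.exists_dqBdd hL₁ hL₂ hT 3
  obtain ⟨M₃, hM₃⟩ := hF.exists_dqBdd_sub hL₁ hL₂ hT 3
  obtain ⟨M₄, hM₄⟩ := hF.exists_dqBdd_sub hL₁ hL₂ hT 4
  obtain ⟨M₅, hM₅⟩ := hF.exists_dqBdd_extrapolation hL₁ hL₂ hT 4
  set MB := N₁ + |γc| + (N₂ + |γe|) with hMB
  obtain ⟨M₆, hM₆0, hM₆⟩ := exists_trunc_bound hL₁ hL₂ hT hJ hF _
    (fun t ht => hΦ.slice_timeDeriv hJs hT ht) MB N₃ (max |M₄| M₅) 2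
  set M := 1 + |MB| + |M₁| + |M₂| + |M₃| + 2 * M₆ with hM
  have a0 := abs_nonneg MB
  have a1 := abs_nonneg M₁
  have a2 := abs_nonneg M₂
  have a3 := abs_nonneg M₃
  refine ⟨M, by linarith, fun m n _ _ h s hh hm hn hs hs1 => ?_⟩
  have n1 := (hN₁ m n h hh hm hn).1
  have n2 := (hN₂ m n h hh hm hn).1
  have n1' : 0 ≤ N₁ := (abs_nonneg _).trans n1
  have n2' : 0 ≤ N₂ := (abs_nonneg _).trans n2
  have n3 := (hN₃ m n h hh hm hn).2
  rw [gridMass_sub] at n3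
  have g1 := abs_nonneg γc
  have g2 := abs_nonneg γe
  have hBc : |gridMass m n h Jc + γc| ≤ MB := (abs_add_le _ _).trans (by linarith)
  have hBe : |gridMass m n h Je + γe| ≤ MB := (abs_add_le _ _).trans (by linarith)
  have hMB' := le_abs_self MB
  refine ⟨(le_abs_self _).trans (by linarith), (le_abs_self _).trans (by linarith),
    fun φ hφ => ?_⟩
  have hJg : IsGridPeriodic m n (vertexRestrict h fun x y => Jc x y - Je x y) :=
    isGridPeriodic_gridPos hm hn hJp (1 / 2)
  have hP := fun {k : ℕ} (hk : k * s ≤ T) => hΦ.exactVal_gridIdx hm hn hs.le hk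
  have htime : ∀ {k : ℕ}, k * s ≤ T → (k : ℝ) * s ∈ Icc 0 T := fun hk => ⟨by positivity, hk⟩
  have hsucc : ∀ k : ℕ, ((k + 1 : ℕ) : ℝ) * s = k * s + s := fun k => by push_cast; ring
  -- The truncation bound is carried from the plane to the grid for an arbitrary extrapolation error
  -- δ. Order 4 is needed here for order 2 of the truncation error.
  have htrunc : ∀ (k : ℕ) (δ : ℝ), (k + 1 : ℕ) * s ≤ T → 0 ≤ δ →
      DqBdd (planeStep h) h 4 (max |M₄| M₅ * δ)
        (slice (fun p => Φ p.1 p.2.1 p.2.2) (k * s + s / 2)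
          - extrapolate (fun k : ℕ => slice (fun p => Φ p.1 p.2.1 p.2.2) (k * s)) k) →
      DqBdd (gridStep m n) h 2 (M₆ * (s ^ 2 + h ^ 2 + δ))
        (s⁻¹ • (exactVal m n h s Φ (k + 1) - exactVal m n h s Φ k) - lap (gridStep m n) h
          (latticeChemPot h (gridMass m n h Jc + γc) (gridMass m n h Je + γe)
            (gridVal m n (vertexRestrict h fun x y => Jc x y - Je x y))
            (extrapolate (exactVal m n h s Φ) k) (exactVal m n h s Φ k)
            (exactVal m n h s Φ (k + 1)))) := by
    intro k δ hk hδ hext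
    have hk0 := level_le_of_succ hs.le hk
    have hkp : ((k - 1 : ℕ) : ℝ) * s ≤ T :=
      (mul_le_mul_of_nonneg_right (Nat.cast_le.2 k.pred_le) hs.le).trans hk0
    refine DqBdd.of_plane (hM₆ m n h s δ _ _ (k * s) _ hh hm hn hs hBc hBe ?_ (htime hk0).1
      (by rwa [← hsucc]) hδ hext) (c := 0) (trunc_gridPos ?_ ?_ (hP hk0) ?_)
    · rwa [show γc - γe + kernelMass L₁ L₂ (fun x y => Jc x y - Je x y)
        - (gridMass m n h Jc + γc - (gridMass m n h Je + γe)) =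
        kernelMass L₁ L₂ (fun x y => Jc x y - Je x y)
          - (gridMass m n h Jc - gridMass m n h Je) by ring]
    · exact fun i j => hJg.gridVal_gridIdx i j
    · intro i j
      simp only [extrapolate, Pi.sub_apply, Pi.smul_apply, hP hk0, hP hkp]
    · rw [← hsucc]
      exact hP hk
  refine ⟨fun k => s⁻¹ • (exactVal m n h s Φ (k + 1) - exactVal m n h s Φ k)
    - lap (gridStep m n) h (latticeChemPot h (gridMass m n h Jc + γc) (gridMass m n h Je + γe)
      (gridVal m n (vertexRestrict h fun x y => Jc x y - Je x y))
      (extrapolate (exactVal m n h s Φ) k) (exactVal m n h s Φ k) (exactVal m n h s Φ (k + 1))),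
    ?_, ?_, ?_, ?_, ?_, ?_, ?_⟩
  · exact ((hM₁ h hh 0 h0).mono_const (by linarith [le_abs_self M₁])).of_plane (c := 1 / 2)
      fun i j => hJg.gridVal_gridIdx i j
  · exact fun k hk => ((hM₂ h hh _ (htime hk)).mono_const (by linarith [le_abs_self M₂])).of_plane
      (hP hk)
  · intro k hk
    have hk0 := level_le_of_succ hs.le hk
    refine ((hM₃ h hh _ (htime hk0) _ (htime hk)).mono_const ?_).of_plane (c := 0) fun i j => ?_
    · rw [hsucc, add_sub_cancel_left, abs_of_pos hs]
      gcongr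
      linarith [le_abs_self M₃]
    · rw [Pi.sub_apply, Pi.sub_apply, hP hk, hP hk0]
  · intro hsT
    refine (htrunc 0 s (by simpa using hsT) hs.le ?_).mono_const ?_
    · have hs2 : s / 2 ∈ Icc 0 T := ⟨by positivity, by linarith⟩
      -- With φ^{-1} = φ^0 the extrapolation is the initial value itself, at distance O(s) from the
      -- value at s/2.
      have e : extrapolate (fun k : ℕ => slice (fun p => Φ p.1 p.2.1 p.2.2) (k * s)) 0 =
          slice (fun p => Φ p.1 p.2.1 p.2.2) 0 := by
        simp only [extrapolate, zero_tsub, Nat.cast_zero, zero_mul]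
        module
      rw [e, Nat.cast_zero, zero_mul, zero_add]
      refine (hM₄ h hh 0 h0 _ hs2).mono_const ?_
      rw [sub_zero, abs_of_nonneg hs2.1]
      exact mul_le_mul ((le_abs_self _).trans (le_max_left _ _)) (by linarith) hs2.1
        (le_max_of_le_left (abs_nonneg _))
    · calc M₆ * (s ^ 2 + h ^ 2 + s) ≤ M₆ * (2 * (s + h ^ 2)) := by
            gcongr
            nlinarith [sq_nonneg h]
        _ = 2 * M₆ * (s + h ^ 2) := by ring
        _ ≤ M * (s + h ^ 2) := by gcongr; linarith
  · intro k hk1 hk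
    have hk0 := level_le_of_succ hs.le hk
    refine (htrunc k (s ^ 2) hk (sq_nonneg s) ?_).mono_const ?_
    · have e : ((k - 1 : ℕ) : ℝ) * s = k * s - s := by
        rw [Nat.cast_sub hk1]
        push_cast
        ring
      have hkp : (k : ℝ) * s - s ∈ Icc 0 T := by
        rw [← e]
        exact ⟨by positivity, by rw [e]; linarith⟩
      simp only [extrapolate, e]
      refine (hM₅ h hh _ s hkp (htime hk0) (by rw [← hsucc]; exact htime hk)).mono_const ?_
      gcongr
      exact le_max_right _ _
    · calc M₆ * (s ^ 2 + h ^ 2 + s ^ 2) ≤ M₆ * (2 * (s ^ 2 + h ^ 2)) := by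
            gcongr
            nlinarith [sq_nonneg h]
        _ = 2 * M₆ * (s ^ 2 + h ^ 2) := by ring
        _ ≤ M * (s ^ 2 + h ^ 2) := by gcongr; linarith
  · simp [exactVal, hφ.initial]
  · exact fun k hk => error_step (V := fun k => gridVal m n (φ k)) hs.ne'
      (hφ.gridVal_step hs.le hJg hk)

end Convergence

end

end NonlocalCH

end

/-! ### The convergence theorem. -/

theorem mainTheorem3
    (L₁ L₂ : ℝ) (hL₁ : 0 < L₁) (hL₂ : 0 < L₂)
    (γc γe : ℝ) (hγc : 0 ≤ γc) (hγe : 0 ≤ γe)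
    (Jc Je : ℝ → ℝ → ℝ)
    (hJc : NonlocalCH.IsKernelPart L₁ L₂ Jc) (hJe : NonlocalCH.IsKernelPart L₁ L₂ Je)
    (hJ : 0 < NonlocalCH.kernelMass L₁ L₂ (fun x y => Jc x y - Je x y))
    (hγ₀ : 0 < γc - γe + NonlocalCH.kernelMass L₁ L₂ (fun x y => Jc x y - Je x y))
    (hα₀ : ∃ α₀ > 0, ∃ h₁ > 0, ∀ (m n : ℕ) (h : ℝ), 0 < h → h ≤ h₁ →
      L₁ = m * h → L₂ = n * h →
      α₀ ≤ (NonlocalCH.gridMass m n h Jc + γc) - 3 * (NonlocalCH.gridMass m n h Je + γe))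
    (T : ℝ) (hT : 0 < T)
    (Φ : ℝ → ℝ → ℝ → ℝ)
    (hΦ : NonlocalCH.IsSmoothSolution L₁ L₂ γc γe (fun x y => Jc x y - Je x y) T Φ)
    (K : ℝ) (hK : 0 < K) :
    ∃ C > 0, ∃ h₀ > 0, ∃ s₀ > 0,
      ∀ (m n : ℕ) (h s : ℝ), 0 < h → h ≤ h₀ → L₁ = m * h → L₂ = n * h →
        0 < s → s ≤ s₀ → s ≤ K * h →
        ∀ φ : ℕ → ℤ → ℤ → ℝ,
          NonlocalCH.IsNumericalSolution m n h s T γc γe Jc Je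
            (NonlocalCH.cellRestrict h (fun x y => Φ x y 0)) φ →
          ∀ l : ℕ, 1 ≤ l → l * s ≤ T →
            NonlocalCH.maxNorm m n
              (fun i j => NonlocalCH.cellRestrict h (fun x y => Φ x y (l * s)) i j - φ l i j)
              ≤ C * (h ^ 2 + s ^ 2) := by
  obtain ⟨α, hα, h₁, hh₁, hB⟩ := hα₀
  obtain ⟨M, hM1, hM⟩ := NonlocalCH.exists_isErrorSequence hL₁ hL₂ hJc hJe hT hΦ K
  obtain ⟨C, hC, h₀, hh₀, s₀, hs₀, key⟩ :=
    NonlocalCH.exists_error_bound L₁ L₂ α M K T hL₁ hL₂ hα hM1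
  refine ⟨C, hC, min h₀ h₁, lt_min hh₀ hh₁, min s₀ 1, lt_min hs₀ one_pos, ?_⟩
  intro m n h s hh hhle hm hn hs hsle hsK φ hφ l _ hl
  -- An empty grid would force L₁ = 0.
  have : NeZero m := ⟨fun h0 => by simp [hm, h0] at hL₁⟩
  have : NeZero n := ⟨fun h0 => by simp [hn, h0] at hL₂⟩
  obtain ⟨hBc, hBe, hτ⟩ := hM m n h s hh hm hn hs (hsle.trans (min_le_right _ _))
  obtain ⟨τ, H⟩ := hτ φ hφ
  have hbound := key m n h s _ _ _ _ _ τ H hh (hhle.trans (min_le_left _ _)) hm hn hs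
    (hsle.trans (min_le_left _ _)) hsK (add_nonneg (NonlocalCH.gridMass_nonneg hJe.nonneg m n h) hγe)
    hBe hBc (hB m n h hh (hhle.trans (min_le_right _ _)) hm hn) l hl
  refine Real.iSup_le (fun p => ?_) (by positivity)
  have e := hbound (NonlocalCH.gridIdx m n ((p.1 : ℕ) + 1) ((p.2 : ℕ) + 1))
  have hlt : (l : ℝ) * s ∈ Set.Icc 0 T := ⟨by positivity, hl⟩
  rw [Pi.sub_apply, hΦ.exactVal_gridIdx hm hn hs.le hl, (hφ.periodic l hl).gridVal_gridIdx] at e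
  simpa [NonlocalCH.cellRestrict, NonlocalCH.slice, NonlocalCH.gridPos] using e
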